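/- Let $n\ge 2$, $m\ge 1$, $0\le q<1$ and $\kappa=\frac{2}{1-q}$. Let $\Gamma\subset\mathbb{R}^n$ be an (embedded) real-analytic hypersurface, oriented by a unit normal field $\nu$, and let $V_\pm:\Gamma\to\mathbb{S}^{m-1}$ be analytic maps. A one-sided neighbourhood of $\Gamma$ on its $+$ side (resp. $-$ side) is an open set which near each point of $\Gamma$ coincides with the side of $\Gamma$ into which $\nu$ (resp. $-\nu$) points. Then on each of the two sides there are a one-sided neighbourhood $\Omega_\pm$ of $\Gamma$ and a classical solution $\mathbf u_\pm:\Omega_\pm\to\mathbb{R}^m$ of $$\Delta\mathbf u=|\mathbf u|^{q-1}\mathbf u\,\chi_{\{|\mathbf u|>0\}}$$ which has free boundary $\Gamma$, that is, $\mathbf u_\pm\neq0$ in $\Omega_\pm$ and $\mathbf u_\pm(x)\to0$ as $x\to\Gamma$; which is analytic up to the boundary in the sense that $|\mathbf u_\pm|^{1/\kappa}$ and $\mathbf u_\pm/|\mathbf u_\pm|$ are analytic in $\Omega_\pm$ and extend analytically to a neighbourhood of each point of $\Gamma$; and which satisfies $$\frac{\mathbf u_\pm(x)}{|\mathbf u_\pm(x)|}\to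 V_\pm(p)\qquad\text{as } \Omega_\pm\ni x\to p,\ \text{ for every } p\in\Gamma.$$ On each side this solution is unique as a local solution: any two pairs $(\Omega_\pm,\mathbf u_\pm)$ with these properties, with the same data, coincide in some open neighbourhood of $\Gamma$. -/

import Mathlib

open Set Filter Topology InnerProductSpace

/-- `φ` is a positively oriented analytic local defining function at `p` for the hypersurface `Γ`
with unit normal `ν`: near `p`, the set `Γ` is exactly the zero set of `φ`, and along `Γ` the
gradient of `φ` is a positive multiple of `ν` (in particular it does not vanish there). -/
structure IsDefiningFunctionAt {n : ℕ} (Γ : Set (EuclideanSpace ℝ (Fin n)))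
    (ν : EuclideanSpace ℝ (Fin n) → EuclideanSpace ℝ (Fin n)) (p : EuclideanSpace ℝ (Fin n))
    (φ : EuclideanSpace ℝ (Fin n) → ℝ) : Prop where
  analyticAt : AnalyticAt ℝ φ p
  zero_iff : ∀ᶠ x in 𝓝 p, (x ∈ Γ ↔ φ x = 0)
  gradient_eq : ∀ᶠ x in 𝓝[Γ] p, ∃ c : ℝ, 0 < c ∧ gradient φ x = c • ν x

/-- `Γ` is an (embedded) real-analytic hypersurface of `ℝⁿ`, oriented by the unit normal field `ν`.
Only the values of `ν` on `Γ` matter; the existence of defining functions makes `ν` normal to `Γ`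
and analytic (so continuous) along `Γ`. -/
structure IsOrientedAnalyticHypersurface {n : ℕ} (Γ : Set (EuclideanSpace ℝ (Fin n)))
    (ν : EuclideanSpace ℝ (Fin n) → EuclideanSpace ℝ (Fin n)) : Prop where
  norm_eq_one : ∀ p ∈ Γ, ‖ν p‖ = 1
  exists_definingFunction : ∀ p ∈ Γ, ∃ φ : EuclideanSpace ℝ (Fin n) → ℝ,
    IsDefiningFunctionAt Γ ν p φ

/-- `V` restricts to an analytic map from `Γ` to the unit sphere of `ℝᵐ`. For an embedded analytic
hypersurface, analyticity means that `V` is locally on `Γ` the restriction of an analytic map. Only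
the values of `V` on `Γ` matter. -/
structure IsAnalyticSphereMap {n m : ℕ} (Γ : Set (EuclideanSpace ℝ (Fin n)))
    (V : EuclideanSpace ℝ (Fin n) → EuclideanSpace ℝ (Fin m)) : Prop where
  norm_eq_one : ∀ p ∈ Γ, ‖V p‖ = 1
  analytic : ∀ p ∈ Γ, ∃ F : EuclideanSpace ℝ (Fin n) → EuclideanSpace ℝ (Fin m),
    AnalyticAt ℝ F p ∧ ∀ᶠ x in 𝓝[Γ] p, V x = F x

/-- `Ω` is a one-sided neighbourhood of `Γ`, on the side to which `ν` points: an open set which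
coincides, near each point of `Γ`, with `{φ > 0}` for a positively oriented defining function `φ`.
The other side is obtained by replacing `ν` by `-ν`. -/
structure IsOneSidedNhd {n : ℕ} (Γ : Set (EuclideanSpace ℝ (Fin n)))
    (ν : EuclideanSpace ℝ (Fin n) → EuclideanSpace ℝ (Fin n))
    (Ω : Set (EuclideanSpace ℝ (Fin n))) : Prop where
  isOpen : IsOpen Ω
  eventually_mem_iff : ∀ p ∈ Γ, ∃ φ : EuclideanSpace ℝ (Fin n) → ℝ,
    IsDefiningFunctionAt Γ ν p φ ∧ ∀ᶠ x in 𝓝 p, (x ∈ Ω ↔ 0 < φ x)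

/-- `f` is analytic in `Ω` and up to the part `Γ` of its boundary: near each point of `Ω ∪ Γ`, the
restriction of `f` to `Ω` is the restriction of a function analytic in a full neighbourhood. -/
def AnalyticUpTo {n : ℕ} {F : Type*} [NormedAddCommGroup F] [NormedSpace ℝ F]
    (f : EuclideanSpace ℝ (Fin n) → F) (Ω Γ : Set (EuclideanSpace ℝ (Fin n))) : Prop :=
  ∀ p ∈ Ω ∪ Γ, ∃ g : EuclideanSpace ℝ (Fin n) → F,
    AnalyticAt ℝ g p ∧ ∀ᶠ x in 𝓝[Ω] p, f x = g x

/-- `u` is a classical solution in `Ω` of `Δu = |u|^{q-1} u χ_{|u| > 0}`. -/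
def IsClassicalSolution {n m : ℕ} (q : ℝ)
    (u : EuclideanSpace ℝ (Fin n) → EuclideanSpace ℝ (Fin m))
    (Ω : Set (EuclideanSpace ℝ (Fin n))) : Prop :=
  ContDiffOn ℝ 2 u Ω ∧
    ∀ x ∈ Ω, Laplacian.laplacian u x =
      indicator {y | 0 < ‖u y‖} (fun y => ‖u y‖ ^ (q - 1) • u y) x

/-- `(Ω, u)` is a local solution of the system on the side of `Γ` to which `ν` points, with free
boundary `Γ` and boundary direction `V`, analytic up to `Γ`: the set `Ω` is a one-sided
neighbourhood of `Γ`, `u` solves the system in `Ω`, has no zero in `Ω` and vanishes at `Γ`, the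
functions `|u|^{1/κ}`, with `κ = 2 / (1 - q)`, and `u / |u|` are analytic up to `Γ`, and `u / |u|`
tends to `V` at `Γ`. -/
structure IsLocalSolution {n m : ℕ} (q : ℝ) (Γ : Set (EuclideanSpace ℝ (Fin n)))
    (ν : EuclideanSpace ℝ (Fin n) → EuclideanSpace ℝ (Fin n))
    (V : EuclideanSpace ℝ (Fin n) → EuclideanSpace ℝ (Fin m))
    (Ω : Set (EuclideanSpace ℝ (Fin n)))
    (u : EuclideanSpace ℝ (Fin n) → EuclideanSpace ℝ (Fin m)) : Prop where
  isOneSidedNhd : IsOneSidedNhd Γ ν Ω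
  isSolution : IsClassicalSolution q u Ω
  ne_zero : ∀ x ∈ Ω, u x ≠ 0
  tendsto_zero : ∀ p ∈ Γ, Tendsto u (𝓝[Ω] p) (𝓝 0)
  analytic_modulus : AnalyticUpTo (fun x => ‖u x‖ ^ (1 / (2 / (1 - q)))) Ω Γ
  analytic_direction : AnalyticUpTo (fun x => ‖u x‖⁻¹ • u x) Ω Γ
  tendsto_direction : ∀ p ∈ Γ, Tendsto (fun x => ‖u x‖⁻¹ • u x) (𝓝[Ω] p) (𝓝 (V p))

/-- There is a unique local solution on the side of `Γ` to which `ν` points. As for every local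
object, uniqueness means that any two agree in a neighbourhood of `Γ`. -/
def ExistsUniqueLocalSolution {n m : ℕ} (q : ℝ) (Γ : Set (EuclideanSpace ℝ (Fin n)))
    (ν : EuclideanSpace ℝ (Fin n) → EuclideanSpace ℝ (Fin n))
    (V : EuclideanSpace ℝ (Fin n) → EuclideanSpace ℝ (Fin m)) : Prop :=
  (∃ (Ω : Set (EuclideanSpace ℝ (Fin n)))
      (u : EuclideanSpace ℝ (Fin n) → EuclideanSpace ℝ (Fin m)),
    IsLocalSolution q Γ ν V Ω u) ∧
  ∀ (Ω₁ Ω₂ : Set (EuclideanSpace ℝ (Fin n)))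
    (u₁ u₂ : EuclideanSpace ℝ (Fin n) → EuclideanSpace ℝ (Fin m)),
    IsLocalSolution q Γ ν V Ω₁ u₁ → IsLocalSolution q Γ ν V Ω₂ u₂ →
      ∃ N : Set (EuclideanSpace ℝ (Fin n)), IsOpen N ∧ Γ ⊆ N ∧ N ∩ Ω₁ = N ∩ Ω₂ ∧
        EqOn u₁ u₂ (N ∩ Ω₁)

/-!
# Local solutions of a singular elliptic system with a prescribed free boundary

Write `u = ρ ^ κ • w` with `ρ = |u| ^ (1 / κ)` and `|w| = 1`. Since `κ (q - 1) = -2`, the factor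
`ρ ^ (κ - 2)` can be divided out of the system `Δ u = |u| ^ (q - 1) u`
(`laplacian_rpow_smul_eq_iff`), and what remains, `polarOp`, is polynomial in `ρ`, `w` and their
derivatives. It makes sense across the hypersurface `{ρ = 0}`, where it is of Fuchsian type. Using
`|w| = 1`, it splits into

* `modulusOp`: `κ (κ - 1) |∇ρ|² + κ ρ Δρ - ρ² |∇w|² = 1`,
* `directionOp`: `2 κ ∇ρ · ∇w + ρ (Δw + |∇w|² w) = 0`,

and conversely a solution of these two equations with `|w| = 1` on the hypersurface has `|w| = 1`
everywhere, because `|w|² - 1` solves a homogeneous linear equation of the same type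
(`linear_equation_of_directionOp`, `formal_linear_unique`).

Near a point of the hypersurface, with unit normal `ν` at this point, the hypersurface is a graph
over the hyperplane `Y` orthogonal to `ν`. Taylor expansion along `ν` at the points of the graph
(`graphTaylorHom`) is an injective homomorphism from the ring of germs of analytic functions to the
power series in one variable with coefficients in the ring of germs on `Y`, and it transforms each
partial derivative into an operator `c ∂/∂X + δ`. The two equations then determine the coefficients
of the expansions of `ρ` and `w` one after the other, because the indicial factors
`(k + 2) (k + 2 κ - 1)` and `(k + 1) (k + 2 κ)` do not vanish; the leading coefficient of `ρ` is
given up to its sign by `κ (κ - 1) |∇ρ|² = 1`, and the sign by the side. This gives formal existence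
and uniqueness (`formal_solution_of_recursion`, `formal_solution_unique`).

Convergence is an argument in the style of Cauchy and Kovalevskaya. The norm
`∑ rⁿ |D^n f(0)| / n! / C(n + k, k)` (`majorantNorm`) for the coefficient of index `k` is
submultiplicative with respect to the index and turns one derivative in `Y` into a factor `k + 1`
and a shift of the index, which is exactly what the indicial factors compensate. The norms of the
coefficients then satisfy a quadratic recursive inequality, and grow at most geometrically
(`IsMajorantNorm.exists_tsum_formal_solution_ne_top`). Such a power series is the expansion of a
germ (`exists_graphTaylorHom_eq`).

Finally, the local solutions of the polar system are unique, so that they agree on overlaps and can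
be glued in a neighbourhood of the hypersurface (`exists_global_polar_solution`), and the solution
on the given side is `ρ ^ κ • w` on `{ρ > 0}`. Conversely, the extensions of the modulus and of the
direction of any local solution solve the polar system on both sides, by the identity theorem
(`IsLocalSolution.exists_isPolarSolutionAt`), which gives uniqueness.
-/

set_option linter.unusedSectionVars false

/-! ### Rings of germs of analytic functions -/

section Germs

variable {E Y : Type*} [NormedAddCommGroup E] [NormedSpace ℝ E]
  [NormedAddCommGroup Y] [NormedSpace ℝ Y]

/-- The algebra of the real functions which are analytic at `p`. -/
def analyticFunctionsAt (p : E) : Subalgebra ℝ (E → ℝ) where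
  carrier := {f | AnalyticAt ℝ f p}
  mul_mem' hf hg := AnalyticAt.mul hf hg
  add_mem' hf hg := AnalyticAt.add hf hg
  algebraMap_mem' _ := analyticAt_const

/-- The ideal of the functions vanishing in a neighbourhood of `p`. -/
def vanishingIdeal (p : E) : Ideal (analyticFunctionsAt p) where
  carrier := {f | (f : E → ℝ) =ᶠ[𝓝 p] 0}
  add_mem' {f g} hf hg := by
    filter_upwards [hf, hg] with x h1 h2
    simp_all
  zero_mem' := EventuallyEq.rfl
  smul_mem' c f hf := by
    filter_upwards [hf] with x h1
    simp_all

/-- The ring of germs at `p` of real-analytic functions. -/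
def AnGerm (p : E) : Type _ := analyticFunctionsAt p ⧸ vanishingIdeal p

noncomputable instance (p : E) : CommRing (AnGerm p) :=
  inferInstanceAs (CommRing (analyticFunctionsAt p ⧸ vanishingIdeal p))

noncomputable instance (p : E) : Algebra ℝ (AnGerm p) :=
  inferInstanceAs (Algebra ℝ (analyticFunctionsAt p ⧸ vanishingIdeal p))

/-- The germ at `p` of a function which is analytic at `p`. -/
def germ {p : E} (f : E → ℝ) (hf : AnalyticAt ℝ f p) : AnGerm p :=
  Ideal.Quotient.mk (vanishingIdeal p) ⟨f, hf⟩

theorem germ_eq_iff {p : E} {f g : E → ℝ} {hf : AnalyticAt ℝ f p} {hg : AnalyticAt ℝ g p} :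
    germ f hf = germ g hg ↔ f =ᶠ[𝓝 p] g := by
  refine Iff.trans (Ideal.Quotient.eq (I := vanishingIdeal p)
    (x := (⟨f, hf⟩ : analyticFunctionsAt p)) (y := ⟨g, hg⟩)) ?_
  constructor
  · intro h
    have h' : (f - g) =ᶠ[𝓝 p] 0 := h
    filter_upwards [h'] with x hx
    simpa [sub_eq_zero] using hx
  · intro h
    change (f - g) =ᶠ[𝓝 p] 0
    filter_upwards [h] with x hx
    simpa [sub_eq_zero] using hx

theorem exists_germ_eq {p : E} (x : AnGerm p) : ∃ f, ∃ hf : AnalyticAt ℝ f p, germ f hf = x := by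
  obtain ⟨⟨f, hf⟩, rfl⟩ := Ideal.Quotient.mk_surjective x
  exact ⟨f, hf, rfl⟩

theorem germ_add {p : E} {f g : E → ℝ} (hf : AnalyticAt ℝ f p) (hg : AnalyticAt ℝ g p) :
    germ f hf + germ g hg = germ (fun x => f x + g x) (hf.add hg) := rfl

theorem germ_mul {p : E} {f g : E → ℝ} (hf : AnalyticAt ℝ f p) (hg : AnalyticAt ℝ g p) :
    germ f hf * germ g hg = germ (fun x => f x * g x) (hf.mul hg) := rfl

theorem smul_germ {p : E} {f : E → ℝ} (r : ℝ) (hf : AnalyticAt ℝ f p) :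
    r • germ f hf = germ (fun x => r * f x) (analyticAt_const.mul hf) := rfl

theorem germ_one {p : E} : (1 : AnGerm p) = germ (fun _ => 1) analyticAt_const := rfl

theorem germ_zero {p : E} : (0 : AnGerm p) = germ (fun _ => 0) analyticAt_const := rfl

theorem germ_sum {p : E} {ι : Type*} (s : Finset ι) {f : ι → E → ℝ}
    (hf : ∀ i, AnalyticAt ℝ (f i) p) :
    ∑ i ∈ s, germ (f i) (hf i)
      = germ (fun x => ∑ i ∈ s, f i x) (Finset.analyticAt_fun_sum s fun i _ => hf i) := by
  classical
  induction s using Finset.induction_on with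
  | empty => simp [germ_zero]
  | insert a s ha ih =>
    rw [Finset.sum_insert ha, ih, germ_add, germ_eq_iff]
    exact Eventually.of_forall fun x => by simp [Finset.sum_insert ha]

theorem analyticAt_fderiv_apply {p : E} {f : E → ℝ} (hf : AnalyticAt ℝ f p) (v : E) :
    AnalyticAt ℝ (fun x => fderiv ℝ f x v) p :=
  ((ContinuousLinearMap.apply ℝ ℝ v).analyticAt _).comp hf.fderiv

/-- The derivation of the ring of germs given by differentiation in the direction `v`. -/
noncomputable def germDeriv (p v : E) : Derivation ℝ (AnGerm p) (AnGerm p) :=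
  let d : AnGerm p → AnGerm p := fun x =>
    germ (fun z => fderiv ℝ (exists_germ_eq x).choose z v)
      (analyticAt_fderiv_apply (exists_germ_eq x).choose_spec.choose v)
  have hd : ∀ (f : E → ℝ) (hf : AnalyticAt ℝ f p),
      d (germ f hf) = germ (fun z => fderiv ℝ f z v) (analyticAt_fderiv_apply hf v) := by
    intro f hf
    have h := germ_eq_iff.1 (exists_germ_eq (germ f hf)).choose_spec.choose_spec
    refine germ_eq_iff.2 ?_
    filter_upwards [h.fderiv (𝕜 := ℝ)] with x hx
    rw [hx]
  Derivation.mk'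
    { toFun := d
      map_add' := fun x y => by
        obtain ⟨f, hf, rfl⟩ := exists_germ_eq x
        obtain ⟨g, hg, rfl⟩ := exists_germ_eq y
        rw [germ_add, hd, hd, hd, germ_add, germ_eq_iff]
        filter_upwards [hf.eventually_analyticAt, hg.eventually_analyticAt] with x h1 h2
        rw [fderiv_fun_add h1.differentiableAt h2.differentiableAt]
        rfl
      map_smul' := fun r x => by
        obtain ⟨f, hf, rfl⟩ := exists_germ_eq x
        rw [smul_germ, hd, hd, RingHom.id_apply, smul_germ, germ_eq_iff]
        filter_upwards [hf.eventually_analyticAt] with x h1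
        rw [fderiv_const_mul h1.differentiableAt]
        rfl }
    (fun x y => by
        obtain ⟨f, hf, rfl⟩ := exists_germ_eq x
        obtain ⟨g, hg, rfl⟩ := exists_germ_eq y
        change d _ = _ • d _ + _ • d _
        rw [germ_mul, hd, hd, hd, smul_eq_mul, smul_eq_mul, germ_mul, germ_mul, germ_add,
          germ_eq_iff]
        filter_upwards [hf.eventually_analyticAt, hg.eventually_analyticAt] with x h1 h2
        rw [fderiv_fun_mul h1.differentiableAt h2.differentiableAt]
        rfl)

theorem germDeriv_germ {p : E} (v : E) {f : E → ℝ} (hf : AnalyticAt ℝ f p) :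
    germDeriv p v (germ f hf)
      = germ (fun z => fderiv ℝ f z v) (analyticAt_fderiv_apply hf v) := by
  have h := germ_eq_iff.1 (exists_germ_eq (germ f hf)).choose_spec.choose_spec
  refine germ_eq_iff.2 ?_
  filter_upwards [h.fderiv (𝕜 := ℝ)] with x hx
  rw [hx]

theorem germDeriv_comm {p : E} (v w : E) (x : AnGerm p) :
    germDeriv p v (germDeriv p w x) = germDeriv p w (germDeriv p v x) := by
  obtain ⟨f, hf, rfl⟩ := exists_germ_eq x
  simp only [germDeriv_germ]
  rw [germ_eq_iff]
  filter_upwards [hf.eventually_analyticAt] with x hx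
  have hd : DifferentiableAt ℝ (fderiv ℝ f) x := hx.fderiv.differentiableAt
  have h1 : ∀ u : E, fderiv ℝ (fun z => fderiv ℝ f z u) x = (fderiv ℝ (fderiv ℝ f) x).flip u := by
    intro u
    have := fderiv_clm_apply hd (differentiableAt_const u)
    simpa using this
  rw [h1, h1]
  have h3 : IsSymmSndFDerivAt ℝ f x := by
    refine ContDiffAt.isSymmSndFDerivAt (n := 2) (hx.contDiffAt) ?_
    simp
  exact h3.eq v w

/-- Pullback of germs along a map `γ` analytic at `y` with `γ y = p`. -/
noncomputable def germPullback {y : Y} {p : E} (γ : Y → E) (hγ : AnalyticAt ℝ γ y)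
    (h : γ y = p) : AnGerm p →ₐ[ℝ] AnGerm y :=
  Ideal.Quotient.liftₐ (vanishingIdeal p)
    ((Ideal.Quotient.mkₐ ℝ (vanishingIdeal y)).comp
      { toFun := fun f => ⟨fun z => (f : E → ℝ) (γ z), AnalyticAt.fun_comp (h ▸ f.2) hγ⟩
        map_one' := rfl
        map_mul' := fun _ _ => rfl
        map_zero' := rfl
        map_add' := fun _ _ => rfl
        commutes' := fun _ => rfl })
    (fun f hf => by
      refine Ideal.Quotient.eq_zero_iff_mem.2 ?_
      have hf' : (f : E → ℝ) =ᶠ[𝓝 p] 0 := hf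
      have : Tendsto γ (𝓝 y) (𝓝 p) := h ▸ hγ.continuousAt
      exact this.eventually hf')

theorem germPullback_germ {y : Y} {p : E} {γ : Y → E} (hγ : AnalyticAt ℝ γ y) (h : γ y = p)
    {f : E → ℝ} (hf : AnalyticAt ℝ f p) :
    germPullback γ hγ h (germ f hf)
      = germ (fun z => f (γ z)) (AnalyticAt.fun_comp (h ▸ hf) hγ) := rfl

end Germs

/-! ### Formal Taylor expansion along a derivation -/

section FormalTaylor

open PowerSeries

variable {A R : Type*} [CommRing A] [Algebra ℝ A] [CommRing R] [Algebra ℝ R]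

/-- The Taylor series `∑ φ (∂ᵏ f) / k! Xᵏ`. -/
noncomputable def taylorSeriesAlong (φ : A →ₐ[ℝ] R) (d : Derivation ℝ A A) (f : A) : R⟦X⟧ :=
  PowerSeries.mk fun k => ((k.factorial : ℝ)⁻¹) • φ (d^[k] f)

theorem coeff_taylorSeriesAlong (φ : A →ₐ[ℝ] R) (d : Derivation ℝ A A) (f : A) (k : ℕ) :
    coeff k (taylorSeriesAlong φ d f) = ((k.factorial : ℝ)⁻¹) • φ (d^[k] f) :=
  coeff_mk _ _

theorem derivative_taylorSeriesAlong (φ : A →ₐ[ℝ] R) (d : Derivation ℝ A A) (f : A) :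
    d⁄dX R (taylorSeriesAlong φ d f) = taylorSeriesAlong φ d (d f) := by
  ext k
  rw [coeff_derivative, coeff_taylorSeriesAlong, coeff_taylorSeriesAlong,
    Function.iterate_succ_apply, smul_mul_assoc]
  have h : (((k + 1).factorial : ℝ))⁻¹ * ((k : ℝ) + 1) = ((k.factorial : ℝ))⁻¹ := by
    have := k.factorial_ne_zero
    rw [Nat.factorial_succ]
    push_cast
    field_simp
  have h2 : φ (d^[k] (d f)) * ((k : R) + 1) = ((k : ℝ) + 1) • φ (d^[k] (d f)) := by
    rw [Algebra.smul_def, mul_comm]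
    simp
  rw [h2, smul_smul, h]

theorem taylorSeriesAlong_add (φ : A →ₐ[ℝ] R) (d : Derivation ℝ A A) (f g : A) :
    taylorSeriesAlong φ d (f + g) = taylorSeriesAlong φ d f + taylorSeriesAlong φ d g := by
  ext k
  rw [map_add, coeff_taylorSeriesAlong, coeff_taylorSeriesAlong, coeff_taylorSeriesAlong,
    ← smul_add, ← map_add, iterate_map_add]

theorem cancel_natCast_succ {x y : R} (k : ℕ) (h : x * ((k : R) + 1) = y * ((k : R) + 1)) :
    x = y := by
  have h1 : ((k : ℝ) + 1) • x = ((k : ℝ) + 1) • y := by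
    rw [Algebra.smul_def, Algebra.smul_def]
    simpa [mul_comm] using h
  have h0 : ((k : ℝ) + 1) ≠ 0 := by positivity
  simpa [smul_smul, inv_mul_cancel₀ h0] using congrArg (fun z => ((k : ℝ) + 1)⁻¹ • z) h1

theorem taylorSeriesAlong_mul (φ : A →ₐ[ℝ] R) (d : Derivation ℝ A A) (f g : A) :
    taylorSeriesAlong φ d (f * g) = taylorSeriesAlong φ d f * taylorSeriesAlong φ d g := by
  ext k
  induction k generalizing f g with
  | zero => simp [coeff_mul, coeff_taylorSeriesAlong]
  | succ k ih =>
    refine cancel_natCast_succ k ?_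
    rw [← coeff_derivative, ← coeff_derivative, derivative_taylorSeriesAlong, Derivation.leibniz,
      Derivation.leibniz, derivative_taylorSeriesAlong, derivative_taylorSeriesAlong,
      taylorSeriesAlong_add, map_add, map_add, smul_eq_mul, smul_eq_mul, smul_eq_mul, smul_eq_mul,
      ih, ih]

/-- Taylor expansion along a derivation, as a homomorphism of algebras. -/
noncomputable def taylorHom (φ : A →ₐ[ℝ] R) (d : Derivation ℝ A A) : A →ₐ[ℝ] R⟦X⟧ :=
  AlgHom.ofLinearMap
    { toFun := taylorSeriesAlong φ d
      map_add' := taylorSeriesAlong_add φ d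
      map_smul' := fun r f => by
        ext k
        have h : d^[k] (r • f) = r • d^[k] f := by
          induction k with
          | zero => rfl
          | succ k ih => rw [Function.iterate_succ_apply', ih, Derivation.map_smul,
              Function.iterate_succ_apply']
        rw [RingHom.id_apply, coeff_taylorSeriesAlong, h, map_smul, coeff_smul,
          coeff_taylorSeriesAlong, smul_comm] }
    (by
      ext k
      cases k with
      | zero => simp [coeff_taylorSeriesAlong]
      | succ k =>
        have h : d^[k] (0 : A) = 0 := iterate_map_zero d k
        simp [coeff_taylorSeriesAlong, h, coeff_one])
    (taylorSeriesAlong_mul φ d)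

theorem coeff_taylorHom (φ : A →ₐ[ℝ] R) (d : Derivation ℝ A A) (f : A) (k : ℕ) :
    coeff k (taylorHom φ d f) = ((k.factorial : ℝ)⁻¹) • φ (d^[k] f) :=
  coeff_taylorSeriesAlong φ d f k

/-- The action on formal power series in the normal variable of a derivation
`c ∂/∂X + δ`, where `δ` acts on the coefficients. -/
noncomputable def formalDeriv (c : R) (δ : Derivation ℝ R R) (F : R⟦X⟧) : R⟦X⟧ :=
  PowerSeries.mk fun k => c * (coeff (k + 1) F * ((k : R) + 1)) + δ (coeff k F)

theorem coeff_formalDeriv (c : R) (δ : Derivation ℝ R R) (F : R⟦X⟧) (k : ℕ) :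
    coeff k (formalDeriv c δ F) = c * (coeff (k + 1) F * ((k : R) + 1)) + δ (coeff k F) :=
  coeff_mk _ _

theorem taylorHom_derivation {φ : A →ₐ[ℝ] R} {d d' : Derivation ℝ A A} {c : R}
    {δ : Derivation ℝ R R} (hcomm : ∀ f, d (d' f) = d' (d f))
    (h : ∀ f, φ (d' f) = c * φ (d f) + δ (φ f)) (f : A) :
    taylorHom φ d (d' f) = formalDeriv c δ (taylorHom φ d f) := by
  ext k
  have hit : d^[k] (d' f) = d' (d^[k] f) := by
    induction k with
    | zero => rfl
    | succ k ih => rw [Function.iterate_succ_apply', ih, hcomm, Function.iterate_succ_apply']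
  rw [coeff_formalDeriv, ← coeff_derivative]
  have : d⁄dX R (taylorHom φ d f) = taylorHom φ d (d f) := derivative_taylorSeriesAlong φ d f
  rw [this, coeff_taylorHom, coeff_taylorHom, coeff_taylorHom, hit, h, Derivation.map_smul, smul_add,
    mul_smul_comm, ← Function.iterate_succ_apply d k f, Function.iterate_succ_apply' d k f]

end FormalTaylor

/-! ### The polar form of the system in a differential ring -/

section PolarSystem

variable {S S' : Type*} [CommRing S] [Algebra ℝ S] [CommRing S'] [Algebra ℝ S']
  {ι B : Type*} [Fintype ι] [Fintype B]

/-- The sum of the squares of all first derivatives of the components of `w`. -/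
def energyDensity (D : ι → S → S) (w : B → S) : S := ∑ b, ∑ j, D j (w b) ^ 2

/-- The left-hand side of the equation for the modulus `ρ` in polar form. -/
def modulusOp (D : ι → S → S) (κ : ℝ) (ρ : S) (w : B → S) : S :=
  (κ * (κ - 1)) • ∑ j, D j ρ ^ 2 + κ • (ρ * ∑ j, D j (D j ρ)) - ρ ^ 2 * energyDensity D w

/-- The left-hand side of the equation for the direction `w` in polar form. -/
def directionOp (D : ι → S → S) (κ : ℝ) (ρ : S) (w : B → S) (b : B) : S :=
  (2 * κ) • ∑ j, D j ρ * D j (w b) + ρ * (∑ j, D j (D j (w b)) + energyDensity D w * w b)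

theorem map_modulusOp (f : S →ₐ[ℝ] S') {D : ι → S → S} {D' : ι → S' → S'}
    (h : ∀ j x, f (D j x) = D' j (f x)) (κ : ℝ) (ρ : S) (w : B → S) :
    f (modulusOp D κ ρ w) = modulusOp D' κ (f ρ) (fun b => f (w b)) := by
  simp only [modulusOp, energyDensity, map_sub, map_add, map_smul, map_mul, map_sum, map_pow, h]

theorem map_directionOp (f : S →ₐ[ℝ] S') {D : ι → S → S} {D' : ι → S' → S'}
    (h : ∀ j x, f (D j x) = D' j (f x)) (κ : ℝ) (ρ : S) (w : B → S) (b : B) :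
    f (directionOp D κ ρ w b) = directionOp D' κ (f ρ) (fun b => f (w b)) b := by
  simp only [directionOp, energyDensity, map_add, map_smul, map_mul, map_sum, map_pow, h]

end PolarSystem

/-! ### Formal power series solutions -/

section MiddleCoeff

open PowerSeries

variable {R : Type*} [CommSemiring R]

/-- The part of the coefficient of index `k + 1` in `F * G` which involves neither constant
coefficient. -/
noncomputable def middleCoeff (k : ℕ) (F G : R⟦X⟧) : R :=
  ∑ i ∈ Finset.range k, coeff (i + 1) F * coeff (k - i) G

theorem coeff_succ_mul_eq (k : ℕ) (F G : R⟦X⟧) :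
    coeff (k + 1) (F * G)
      = coeff 0 F * coeff (k + 1) G + coeff (k + 1) F * coeff 0 G + middleCoeff k F G := by
  rw [coeff_mul, Finset.Nat.sum_antidiagonal_eq_sum_range_succ
    (fun i j => coeff i F * coeff j G), Finset.sum_range_succ, Finset.sum_range_succ', middleCoeff]
  simp only [Nat.add_sub_add_right, Nat.sub_self, Nat.sub_zero]
  ring

end MiddleCoeff

section FormalSolution

open PowerSeries

variable {R : Type*} [CommRing R] [Algebra ℝ R] {ι B : Type*} [Fintype ι] [Fintype B]

/-- `F` and `G` have the same coefficients up to the index `k`. -/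
def AgreeUpTo (k : ℕ) (F G : R⟦X⟧) : Prop := ∀ i ≤ k, coeff i F = coeff i G

theorem AgreeUpTo.mul {k : ℕ} {F F' G G' : R⟦X⟧} (hF : AgreeUpTo k F F') (hG : AgreeUpTo k G G') :
    AgreeUpTo k (F * G) (F' * G') := by
  intro i hi
  rw [coeff_mul, coeff_mul]
  refine Finset.sum_congr rfl fun x hx => ?_
  have := Finset.HasAntidiagonal.mem_antidiagonal.1 hx
  rw [hF _ (by lia), hG _ (by lia)]

theorem AgreeUpTo.sum {k : ℕ} {F F' : ι → R⟦X⟧} (h : ∀ j, AgreeUpTo k (F j) (F' j)) :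
    AgreeUpTo k (∑ j, F j) (∑ j, F' j) := by
  intro i hi
  simp only [map_sum, h _ i hi]

theorem AgreeUpTo.middleCoeff_eq {k : ℕ} {F F' G G' : R⟦X⟧} (hF : AgreeUpTo k F F')
    (hG : AgreeUpTo k G G') : middleCoeff k F G = middleCoeff k F' G' := by
  refine Finset.sum_congr rfl fun i hi => ?_
  have := Finset.mem_range.1 hi
  rw [hF _ (by lia), hG _ (by lia)]

variable (c : ι → R) (δ : ι → Derivation ℝ R R)

/-- The derivative of `ρ = X a`. -/
noncomputable def modulusDeriv (j : ι) (a : R⟦X⟧) : R⟦X⟧ := formalDeriv (c j) (δ j) (X * a)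

/-- `X` times the Laplacian of `ρ = X a`. -/
noncomputable def modulusLaplacian (a : R⟦X⟧) : R⟦X⟧ :=
  X * ∑ j, formalDeriv (c j) (δ j) (modulusDeriv c δ j a)

/-- `X` times the derivative of `w`. -/
noncomputable def directionDeriv (j : ι) (w : R⟦X⟧) : R⟦X⟧ := X * formalDeriv (c j) (δ j) w

/-- `X ^ 2` times the Laplacian of `w`. -/
noncomputable def directionLaplacian (w : R⟦X⟧) : R⟦X⟧ :=
  X * (X * ∑ j, formalDeriv (c j) (δ j) (formalDeriv (c j) (δ j) w))

/-- `X ^ 2` times the energy density of `w`. -/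
noncomputable def directionEnergy (w : B → R⟦X⟧) : R⟦X⟧ :=
  ∑ b, ∑ j, directionDeriv c δ j (w b) * directionDeriv c δ j (w b)

theorem coeff_zero_modulusDeriv (j : ι) (a : R⟦X⟧) :
    coeff 0 (modulusDeriv c δ j a) = c j * coeff 0 a := by
  rw [modulusDeriv, coeff_formalDeriv, coeff_succ_X_mul, coeff_zero_X_mul]
  simp

theorem coeff_succ_modulusDeriv (j : ι) (a : R⟦X⟧) (k : ℕ) :
    coeff (k + 1) (modulusDeriv c δ j a)
      = c j * (coeff (k + 1) a * ((k : R) + 2)) + δ j (coeff k a) := by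
  rw [modulusDeriv, coeff_formalDeriv, coeff_succ_X_mul, coeff_succ_X_mul]
  push_cast
  ring

theorem coeff_zero_modulusLaplacian (a : R⟦X⟧) : coeff 0 (modulusLaplacian c δ a) = 0 := by
  rw [modulusLaplacian, coeff_zero_X_mul]

theorem coeff_succ_modulusLaplacian (a : R⟦X⟧) (k : ℕ) :
    coeff (k + 1) (modulusLaplacian c δ a)
      = ∑ j, (c j * (coeff (k + 1) (modulusDeriv c δ j a) * ((k : R) + 1))
          + δ j (coeff k (modulusDeriv c δ j a))) := by
  rw [modulusLaplacian, coeff_succ_X_mul, map_sum]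
  simp only [coeff_formalDeriv]

theorem coeff_zero_directionDeriv (j : ι) (w : R⟦X⟧) : coeff 0 (directionDeriv c δ j w) = 0 := by
  rw [directionDeriv, coeff_zero_X_mul]

theorem coeff_succ_directionDeriv (j : ι) (w : R⟦X⟧) (k : ℕ) :
    coeff (k + 1) (directionDeriv c δ j w)
      = c j * (coeff (k + 1) w * ((k : R) + 1)) + δ j (coeff k w) := by
  rw [directionDeriv, coeff_succ_X_mul, coeff_formalDeriv]

theorem coeff_zero_directionLaplacian (w : R⟦X⟧) : coeff 0 (directionLaplacian c δ w) = 0 := by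
  rw [directionLaplacian, coeff_zero_X_mul]

theorem coeff_succ_directionLaplacian (w : R⟦X⟧) (k : ℕ) :
    coeff (k + 1) (directionLaplacian c δ w)
      = ∑ j, (c j * (coeff (k + 1) (directionDeriv c δ j w) * (k : R))
          + δ j (coeff k (directionDeriv c δ j w))) := by
  rw [directionLaplacian, coeff_succ_X_mul]
  cases k with
  | zero => simp [directionDeriv, coeff_zero_X_mul, -coeff_zero_eq_constantCoeff]
  | succ k =>
    rw [coeff_succ_X_mul, map_sum]
    simp only [coeff_formalDeriv, directionDeriv, coeff_succ_X_mul]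
    push_cast
    rfl

theorem coeff_zero_directionEnergy (w : B → R⟦X⟧) : coeff 0 (directionEnergy c δ w) = 0 := by
  simp [directionEnergy, directionDeriv]

theorem coeff_succ_directionEnergy (w : B → R⟦X⟧) (k : ℕ) :
    coeff (k + 1) (directionEnergy c δ w)
      = ∑ b, ∑ j, middleCoeff k (directionDeriv c δ j (w b)) (directionDeriv c δ j (w b)) := by
  simp only [directionEnergy, map_sum, coeff_succ_mul_eq, coeff_zero_directionDeriv, zero_mul,
    mul_zero, zero_add]

section Agree

variable {c δ} {k : ℕ}

theorem AgreeUpTo.modulusDeriv_congr {a a' : R⟦X⟧} (h : AgreeUpTo k a a') (j : ι) :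
    AgreeUpTo k (modulusDeriv c δ j a) (modulusDeriv c δ j a') := by
  intro i hi
  cases i with
  | zero => rw [coeff_zero_modulusDeriv, coeff_zero_modulusDeriv, h 0 hi]
  | succ i => rw [coeff_succ_modulusDeriv, coeff_succ_modulusDeriv, h _ hi, h i (by lia)]

theorem AgreeUpTo.modulusLaplacian_congr {a a' : R⟦X⟧} (h : AgreeUpTo k a a') :
    AgreeUpTo k (modulusLaplacian c δ a) (modulusLaplacian c δ a') := by
  intro i hi
  cases i with
  | zero => rw [coeff_zero_modulusLaplacian, coeff_zero_modulusLaplacian]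
  | succ i =>
    rw [coeff_succ_modulusLaplacian, coeff_succ_modulusLaplacian]
    refine Finset.sum_congr rfl fun j _ => ?_
    rw [h.modulusDeriv_congr j _ hi, h.modulusDeriv_congr j i (by lia)]

theorem AgreeUpTo.directionDeriv_congr {w w' : R⟦X⟧} (h : AgreeUpTo k w w') (j : ι) :
    AgreeUpTo k (directionDeriv c δ j w) (directionDeriv c δ j w') := by
  intro i hi
  cases i with
  | zero => rw [coeff_zero_directionDeriv, coeff_zero_directionDeriv]
  | succ i => rw [coeff_succ_directionDeriv, coeff_succ_directionDeriv, h _ hi, h i (by lia)]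

theorem AgreeUpTo.directionLaplacian_congr {w w' : R⟦X⟧} (h : AgreeUpTo k w w') :
    AgreeUpTo k (directionLaplacian c δ w) (directionLaplacian c δ w') := by
  intro i hi
  cases i with
  | zero => rw [coeff_zero_directionLaplacian, coeff_zero_directionLaplacian]
  | succ i =>
    rw [coeff_succ_directionLaplacian, coeff_succ_directionLaplacian]
    refine Finset.sum_congr rfl fun j _ => ?_
    rw [h.directionDeriv_congr j _ hi, h.directionDeriv_congr j i (by lia)]

theorem AgreeUpTo.directionEnergy_congr {w w' : B → R⟦X⟧} (h : ∀ b, AgreeUpTo k (w b) (w' b)) :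
    AgreeUpTo k (directionEnergy c δ w) (directionEnergy c δ w') :=
  AgreeUpTo.sum fun b => AgreeUpTo.sum fun j =>
    ((h b).directionDeriv_congr j).mul ((h b).directionDeriv_congr j)

end Agree

/-- The part of the coefficient of index `k + 1` of the modulus equation for `ρ = X a` which only
involves the coefficients of `a` and `w` up to the index `k`. -/
noncomputable def modulusRemainder (κ : ℝ) (k : ℕ) (a : R⟦X⟧) (w : B → R⟦X⟧) : R :=
  (κ * (κ - 1)) • ∑ j, ((2 : ℝ) • (c j * coeff 0 a * δ j (coeff k a))
      + middleCoeff k (modulusDeriv c δ j a) (modulusDeriv c δ j a))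
    + κ • (coeff 0 a * (∑ j, (((k : ℝ) + 1) • (c j * δ j (coeff k a))
        + δ j (coeff k (modulusDeriv c δ j a)))) + middleCoeff k a (modulusLaplacian c δ a))
    - coeff (k + 1) (a * a * directionEnergy c δ w)

/-- The part of the coefficient of index `k + 1` of `X` times the direction equation for
`ρ = X a` which only involves the coefficients of `a` and `w` up to the index `k`. -/
noncomputable def directionRemainder (κ : ℝ) (k : ℕ) (a : R⟦X⟧) (w : B → R⟦X⟧) (b : B) : R :=
  (2 * κ) • ∑ j, (c j * coeff 0 a * δ j (coeff k (w b))
      + middleCoeff k (modulusDeriv c δ j a) (directionDeriv c δ j (w b)))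
    + (coeff 0 a * (∑ j, ((k : ℝ) • (c j * δ j (coeff k (w b)))
        + δ j (coeff k (directionDeriv c δ j (w b)))))
      + middleCoeff k a (directionLaplacian c δ (w b)))
    + coeff (k + 1) (a * w b * directionEnergy c δ w)

theorem modulusOp_X_mul (κ : ℝ) (a : R⟦X⟧) (w : B → R⟦X⟧) :
    modulusOp (fun j => formalDeriv (c j) (δ j)) κ (X * a) w
      = (κ * (κ - 1)) • ∑ j, modulusDeriv c δ j a * modulusDeriv c δ j a
        + κ • (a * modulusLaplacian c δ a) - a * a * directionEnergy c δ w := by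
  have h : directionEnergy c δ w
      = X * X * energyDensity (fun j => formalDeriv (c j) (δ j)) w := by
    simp only [directionEnergy, energyDensity, directionDeriv, Finset.mul_sum]
    refine Finset.sum_congr rfl fun b _ => Finset.sum_congr rfl fun j _ => ?_
    ring
  rw [h, modulusOp, modulusLaplacian]
  simp only [modulusDeriv, pow_two]
  congr 1
  · congr 2
    ring
  · ring

theorem X_mul_directionOp_X_mul (κ : ℝ) (a : R⟦X⟧) (w : B → R⟦X⟧) (b : B) :
    X * directionOp (fun j => formalDeriv (c j) (δ j)) κ (X * a) w b
      = (2 * κ) • ∑ j, modulusDeriv c δ j a * directionDeriv c δ j (w b)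
        + a * directionLaplacian c δ (w b) + a * w b * directionEnergy c δ w := by
  have h : directionEnergy c δ w
      = X * X * energyDensity (fun j => formalDeriv (c j) (δ j)) w := by
    simp only [directionEnergy, energyDensity, directionDeriv, Finset.mul_sum]
    refine Finset.sum_congr rfl fun b _ => Finset.sum_congr rfl fun j _ => ?_
    ring
  have h2 : ∑ j, modulusDeriv c δ j a * directionDeriv c δ j (w b)
      = X * ∑ j, formalDeriv (c j) (δ j) (X * a) * formalDeriv (c j) (δ j) (w b) := by
    rw [Finset.mul_sum]
    refine Finset.sum_congr rfl fun j _ => ?_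
    rw [modulusDeriv, directionDeriv]
    ring
  rw [h, h2, directionOp, directionLaplacian, mul_add, mul_smul_comm]
  ring

theorem coeff_zero_modulusOp (κ : ℝ) (a : R⟦X⟧) (w : B → R⟦X⟧) :
    coeff 0 (modulusOp (fun j => formalDeriv (c j) (δ j)) κ (X * a) w)
      = (κ * (κ - 1)) • ((∑ j, c j ^ 2) * coeff 0 a ^ 2) := by
  have h (F G : R⟦X⟧) : coeff 0 (F * G) = coeff 0 F * coeff 0 G := by simp
  rw [modulusOp_X_mul, map_sub, map_add, coeff_smul, coeff_smul, map_sum, h, h,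
    coeff_zero_directionEnergy, coeff_zero_modulusLaplacian]
  simp only [h, coeff_zero_modulusDeriv, mul_zero, smul_zero, add_zero, sub_zero, Finset.sum_mul]
  congr 1
  exact Finset.sum_congr rfl fun j _ => by ring

theorem coeff_succ_modulusOp (κ : ℝ) (a : R⟦X⟧) (w : B → R⟦X⟧) (k : ℕ) :
    coeff (k + 1) (modulusOp (fun j => formalDeriv (c j) (δ j)) κ (X * a) w)
      = (κ * ((k + 2) * (k + 2 * κ - 1))) • (coeff 0 a * (∑ j, c j ^ 2) * coeff (k + 1) a)
        + modulusRemainder c δ κ k a w := by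
  have hP : coeff (k + 1) (∑ j, modulusDeriv c δ j a * modulusDeriv c δ j a)
      = 2 * ((k : R) + 2) * (coeff 0 a * (∑ j, c j ^ 2) * coeff (k + 1) a)
        + ∑ j, ((2 : ℝ) • (c j * coeff 0 a * δ j (coeff k a))
          + middleCoeff k (modulusDeriv c δ j a) (modulusDeriv c δ j a)) := by
    rw [map_sum, Finset.mul_sum, Finset.sum_mul, Finset.mul_sum, ← Finset.sum_add_distrib]
    refine Finset.sum_congr rfl fun j _ => ?_
    rw [coeff_succ_mul_eq, coeff_zero_modulusDeriv, coeff_succ_modulusDeriv, two_smul]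
    ring
  have hL : coeff (k + 1) (a * modulusLaplacian c δ a)
      = ((k : R) + 1) * ((k : R) + 2) * (coeff 0 a * (∑ j, c j ^ 2) * coeff (k + 1) a)
        + (coeff 0 a * (∑ j, (((k : ℝ) + 1) • (c j * δ j (coeff k a))
          + δ j (coeff k (modulusDeriv c δ j a)))) + middleCoeff k a (modulusLaplacian c δ a)) := by
    rw [coeff_succ_mul_eq, coeff_zero_modulusLaplacian, mul_zero, add_zero, ← add_assoc]
    congr 1
    have hj : ∀ j, c j * (coeff (k + 1) (modulusDeriv c δ j a) * ((k : R) + 1))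
          + δ j (coeff k (modulusDeriv c δ j a))
        = ((k : R) + 1) * ((k : R) + 2) * (c j ^ 2 * coeff (k + 1) a)
          + (((k : ℝ) + 1) • (c j * δ j (coeff k a)) + δ j (coeff k (modulusDeriv c δ j a))) := by
      intro j
      rw [coeff_succ_modulusDeriv, Algebra.smul_def, map_add, map_natCast, map_one]
      ring
    simp only [coeff_succ_modulusLaplacian, hj]
    rw [Finset.sum_add_distrib, ← Finset.mul_sum, ← Finset.sum_mul]
    ring
  rw [modulusOp_X_mul, modulusRemainder, map_sub, map_add, coeff_smul, coeff_smul, hP, hL]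
  simp only [Algebra.smul_def, map_mul, map_add, map_sub, map_one, map_ofNat, map_natCast]
  ring

theorem coeff_succ_sum_modulusDeriv_mul_directionDeriv (a w : R⟦X⟧) (k : ℕ) :
    coeff (k + 1) (∑ j, modulusDeriv c δ j a * directionDeriv c δ j w)
      = ((k : R) + 1) * (coeff 0 a * (∑ j, c j ^ 2) * coeff (k + 1) w)
        + ∑ j, (c j * coeff 0 a * δ j (coeff k w)
          + middleCoeff k (modulusDeriv c δ j a) (directionDeriv c δ j w)) := by
  rw [map_sum, Finset.mul_sum, Finset.sum_mul, Finset.mul_sum, ← Finset.sum_add_distrib]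
  refine Finset.sum_congr rfl fun j _ => ?_
  rw [coeff_succ_mul_eq, coeff_zero_modulusDeriv, coeff_succ_directionDeriv,
    coeff_zero_directionDeriv]
  ring

theorem coeff_succ_mul_directionLaplacian (a w : R⟦X⟧) (k : ℕ) :
    coeff (k + 1) (a * directionLaplacian c δ w)
      = (k : R) * ((k : R) + 1) * (coeff 0 a * (∑ j, c j ^ 2) * coeff (k + 1) w)
        + (coeff 0 a * (∑ j, ((k : ℝ) • (c j * δ j (coeff k w))
            + δ j (coeff k (directionDeriv c δ j w))))
          + middleCoeff k a (directionLaplacian c δ w)) := by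
  rw [coeff_succ_mul_eq, coeff_zero_directionLaplacian, mul_zero, add_zero, ← add_assoc]
  congr 1
  have hj : ∀ j, c j * (coeff (k + 1) (directionDeriv c δ j w) * (k : R))
        + δ j (coeff k (directionDeriv c δ j w))
      = (k : R) * ((k : R) + 1) * (c j ^ 2 * coeff (k + 1) w)
        + ((k : ℝ) • (c j * δ j (coeff k w)) + δ j (coeff k (directionDeriv c δ j w))) := by
    intro j
    rw [coeff_succ_directionDeriv, Algebra.smul_def, map_natCast]
    ring
  simp only [coeff_succ_directionLaplacian, hj]
  rw [Finset.sum_add_distrib, ← Finset.mul_sum, ← Finset.sum_mul]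
  ring

theorem coeff_succ_X_mul_directionOp (κ : ℝ) (a : R⟦X⟧) (w : B → R⟦X⟧) (b : B) (k : ℕ) :
    coeff (k + 1) (X * directionOp (fun j => formalDeriv (c j) (δ j)) κ (X * a) w b)
      = ((k + 1) * (k + 2 * κ)) • (coeff 0 a * (∑ j, c j ^ 2) * coeff (k + 1) (w b))
        + directionRemainder c δ κ k a w b := by
  rw [X_mul_directionOp_X_mul, directionRemainder, map_add, map_add, coeff_smul,
    coeff_succ_sum_modulusDeriv_mul_directionDeriv, coeff_succ_mul_directionLaplacian]
  simp only [Algebra.smul_def, map_mul, map_add, map_one, map_ofNat, map_natCast]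
  ring

variable {c δ} in
theorem AgreeUpTo.modulusRemainder_eq {κ : ℝ} {k : ℕ} {a a' : R⟦X⟧} {w w' : B → R⟦X⟧}
    (ha : AgreeUpTo k a a') (hw : ∀ b, AgreeUpTo k (w b) (w' b)) :
    modulusRemainder c δ κ k a w = modulusRemainder c δ κ k a' w' := by
  have hQ : coeff (k + 1) (a * a * directionEnergy c δ w)
      = coeff (k + 1) (a' * a' * directionEnergy c δ w') := by
    rw [coeff_succ_mul_eq k (a * a), coeff_succ_mul_eq k (a' * a'), coeff_zero_directionEnergy,
      coeff_zero_directionEnergy, coeff_succ_directionEnergy, coeff_succ_directionEnergy,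
      ha.mul ha 0 (Nat.zero_le k), (ha.mul ha).middleCoeff_eq (AgreeUpTo.directionEnergy_congr hw)]
    simp only [((hw _).directionDeriv_congr _).middleCoeff_eq ((hw _).directionDeriv_congr _), mul_zero]
  have h1 : ∀ j, middleCoeff k (modulusDeriv c δ j a) (modulusDeriv c δ j a)
      = middleCoeff k (modulusDeriv c δ j a') (modulusDeriv c δ j a') := fun j =>
    (ha.modulusDeriv_congr j).middleCoeff_eq (ha.modulusDeriv_congr j)
  have h2 : ∀ j, coeff k (modulusDeriv c δ j a) = coeff k (modulusDeriv c δ j a') := fun j =>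
    ha.modulusDeriv_congr j k le_rfl
  rw [modulusRemainder, modulusRemainder, hQ, ha 0 (Nat.zero_le k), ha k le_rfl,
    ha.middleCoeff_eq ha.modulusLaplacian_congr]
  simp only [h1, h2]

variable {c δ} in
theorem AgreeUpTo.directionRemainder_eq {κ : ℝ} {k : ℕ} {a a' : R⟦X⟧} {w w' : B → R⟦X⟧}
    (ha : AgreeUpTo k a a') (hw : ∀ b, AgreeUpTo k (w b) (w' b)) (b : B) :
    directionRemainder c δ κ k a w b = directionRemainder c δ κ k a' w' b := by
  have hQ : coeff (k + 1) (a * w b * directionEnergy c δ w)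
      = coeff (k + 1) (a' * w' b * directionEnergy c δ w') := by
    rw [coeff_succ_mul_eq k (a * w b), coeff_succ_mul_eq k (a' * w' b), coeff_zero_directionEnergy,
      coeff_zero_directionEnergy, coeff_succ_directionEnergy, coeff_succ_directionEnergy,
      ha.mul (hw b) 0 (Nat.zero_le k),
      (ha.mul (hw b)).middleCoeff_eq (AgreeUpTo.directionEnergy_congr hw)]
    simp only [((hw _).directionDeriv_congr _).middleCoeff_eq ((hw _).directionDeriv_congr _), mul_zero]
  have h1 : ∀ j, middleCoeff k (modulusDeriv c δ j a) (directionDeriv c δ j (w b))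
      = middleCoeff k (modulusDeriv c δ j a') (directionDeriv c δ j (w' b)) := fun j =>
    (ha.modulusDeriv_congr j).middleCoeff_eq ((hw b).directionDeriv_congr j)
  have h2 : ∀ j, coeff k (directionDeriv c δ j (w b)) = coeff k (directionDeriv c δ j (w' b)) :=
    fun j => (hw b).directionDeriv_congr j k le_rfl
  rw [directionRemainder, directionRemainder, hQ, ha 0 (Nat.zero_le k), hw b k le_rfl,
    ha.middleCoeff_eq (hw b).directionLaplacian_congr]
  simp only [h1, h2]

theorem exists_seq_of_step {S : Type*} (s₀ : S) (F : ℕ → (ℕ → S) → S)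
    (hF : ∀ k f f', (∀ i ≤ k, f i = f' i) → F k f = F k f') :
    ∃ f : ℕ → S, f 0 = s₀ ∧ ∀ k, f (k + 1) = F k f := by
  let g : ℕ → ℕ → S := fun k => Nat.rec (fun _ => s₀)
    (fun k f => Function.update f (k + 1) (F k f)) k
  have hg : ∀ k, g (k + 1) = Function.update (g k) (k + 1) (F k (g k)) := fun k => rfl
  have hst : ∀ k n i, i ≤ k → g (k + n) i = g k i := by
    intro k n i hi
    induction n with
    | zero => rfl
    | succ n ih => rw [← add_assoc, hg, Function.update_of_ne (by lia), ih]
  refine ⟨fun k => g k k, rfl, fun k => ?_⟩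
  change g (k + 1) (k + 1) = _
  rw [hg, Function.update_self]
  refine hF k _ _ fun i hi => ?_
  obtain ⟨n, rfl⟩ := Nat.exists_eq_add_of_le hi
  exact hst i n i le_rfl

variable {c} {κ : ℝ} {α : R}

/-- The recursion which determines the coefficients of a formal solution. -/
theorem exists_formal_recursion (κ : ℝ) (α : R) (V : B → R) :
    ∃ (a : R⟦X⟧) (w : B → R⟦X⟧), coeff 0 a = α ∧ (∀ b, coeff 0 (w b) = V b) ∧
      (∀ k : ℕ, coeff (k + 1) a = -((κ - 1) / ((k + 2) * (k + 2 * κ - 1))) •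
        (α * modulusRemainder c δ κ k a w)) ∧
      ∀ (k : ℕ) (b : B), coeff (k + 1) (w b) = -(κ * (κ - 1) / ((k + 1) * (k + 2 * κ))) •
        (α * directionRemainder c δ κ k a w b) := by
  obtain ⟨f, h0, hf⟩ := exists_seq_of_step (S := R × (B → R)) (α, V)
    (fun k f =>
      (-((κ - 1) / ((k + 2) * (k + 2 * κ - 1))) •
        (α * modulusRemainder c δ κ k (PowerSeries.mk fun i => (f i).1)
          (fun b => PowerSeries.mk fun i => (f i).2 b)),
      fun b => -(κ * (κ - 1) / ((k + 1) * (k + 2 * κ))) •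
        (α * directionRemainder c δ κ k (PowerSeries.mk fun i => (f i).1)
          (fun b => PowerSeries.mk fun i => (f i).2 b) b)))
    (by
      intro k f f' h
      have ha : AgreeUpTo k (PowerSeries.mk fun i => (f i).1)
          (PowerSeries.mk fun i => (f' i).1) := fun i hi => by rw [coeff_mk, coeff_mk, h i hi]
      have hw : ∀ b, AgreeUpTo k (PowerSeries.mk fun i => (f i).2 b)
          (PowerSeries.mk fun i => (f' i).2 b) :=
        fun b i hi => by rw [coeff_mk, coeff_mk, h i hi]
      simp only [ha.modulusRemainder_eq hw, ha.directionRemainder_eq hw])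
  refine ⟨PowerSeries.mk fun i => (f i).1, fun b => PowerSeries.mk fun i => (f i).2 b, ?_, ?_, ?_,
    ?_⟩
  · rw [coeff_mk, h0]
  · intro b
    rw [coeff_mk, h0]
  · intro k
    rw [coeff_mk, hf]
  · intro k b
    rw [coeff_mk, hf]

/-- A formal power series satisfying the recursion solves the polar form of the system. -/
theorem formal_solution_of_recursion {a : R⟦X⟧} {w : B → R⟦X⟧} (hκ : 1 < κ)
    (hα : (κ * (κ - 1)) • ((∑ j, c j ^ 2) * α ^ 2) = 1) (ha0 : coeff 0 a = α)
    (ha : ∀ k : ℕ, coeff (k + 1) a = -((κ - 1) / ((k + 2) * (k + 2 * κ - 1))) •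
        (α * modulusRemainder c δ κ k a w))
    (hw : ∀ (k : ℕ) (b : B), coeff (k + 1) (w b) = -(κ * (κ - 1) / ((k + 1) * (k + 2 * κ))) •
        (α * directionRemainder c δ κ k a w b)) :
    modulusOp (fun j => formalDeriv (c j) (δ j)) κ (X * a) w = 1 ∧
      ∀ b, directionOp (fun j => formalDeriv (c j) (δ j)) κ (X * a) w b = 0 := by
  have hκ0 : κ ≠ 0 := by positivity
  have hκ1 : κ - 1 ≠ 0 := by linarith
  have key : ∀ x : R, α * (∑ j, c j ^ 2) * (α * x) = (κ * (κ - 1))⁻¹ • x := by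
    intro x
    have h2 : (∑ j, c j ^ 2) * α ^ 2 = (κ * (κ - 1))⁻¹ • (1 : R) := by
      rw [← hα, smul_smul, inv_mul_cancel₀ (mul_ne_zero hκ0 hκ1), one_smul]
    have h3 : α * (∑ j, c j ^ 2) * (α * x) = ((∑ j, c j ^ 2) * α ^ 2) * x := by ring
    rw [h3, h2, smul_mul_assoc, one_mul]
  constructor
  · ext k
    cases k with
    | zero => rw [coeff_zero_modulusOp, ha0, hα]; simp
    | succ k =>
      have h1 : (k : ℝ) + 2 ≠ 0 := by positivity
      have h2 : (k : ℝ) + 2 * κ - 1 ≠ 0 := by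
        have : (0 : ℝ) ≤ k := by positivity
        linarith
      have h3 : κ * ((k + 2) * (k + 2 * κ - 1)) * (-((κ - 1) / ((k + 2) * (k + 2 * κ - 1))))
          * (κ * (κ - 1))⁻¹ = -1 := by
        generalize (k : ℝ) + 2 * κ - 1 = t at h2
        field_simp
      rw [coeff_succ_modulusOp, ha, ha0, mul_smul_comm, key, smul_smul, smul_smul, h3]
      simp [coeff_one]
  · intro b
    refine X_mul_cancel ?_
    rw [mul_zero]
    ext k
    cases k with
    | zero => rw [coeff_zero_X_mul, map_zero]
    | succ k =>
      have h1 : (k : ℝ) + 1 ≠ 0 := by positivity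
      have h2 : (k : ℝ) + 2 * κ ≠ 0 := by positivity
      have h3 : (k + 1) * (k + 2 * κ) * (-(κ * (κ - 1) / ((k + 1) * (k + 2 * κ))))
          * (κ * (κ - 1))⁻¹ = -1 := by
        field_simp
      rw [coeff_succ_X_mul_directionOp, hw, ha0, mul_smul_comm, key, smul_smul, smul_smul, h3]
      simp

/-- A formal solution of the polar form of the system is determined by its constant
coefficients. -/
theorem formal_solution_unique {a a' : R⟦X⟧} {w w' : B → R⟦X⟧} (hκ : 1 < κ)
    (hα : (κ * (κ - 1)) • ((∑ j, c j ^ 2) * α ^ 2) = 1) (ha0 : coeff 0 a = α)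
    (ha0' : coeff 0 a' = α) (hw0 : ∀ b, coeff 0 (w b) = coeff 0 (w' b))
    (ha : modulusOp (fun j => formalDeriv (c j) (δ j)) κ (X * a) w = 1)
    (ha' : modulusOp (fun j => formalDeriv (c j) (δ j)) κ (X * a') w' = 1)
    (hw : ∀ b, directionOp (fun j => formalDeriv (c j) (δ j)) κ (X * a) w b = 0)
    (hw' : ∀ b, directionOp (fun j => formalDeriv (c j) (δ j)) κ (X * a') w' b = 0) :
    a = a' ∧ w = w' := by
  have key : ∀ x : R, (κ * (κ - 1)) • (α * (α * (∑ j, c j ^ 2) * x)) = x := by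
    intro x
    have h3 : α * (α * (∑ j, c j ^ 2) * x) = ((∑ j, c j ^ 2) * α ^ 2) * x := by ring
    rw [h3, ← smul_mul_assoc, hα, one_mul]
  have cancel : ∀ (r : ℝ) (x y z : R), r ≠ 0 → r • (α * (∑ j, c j ^ 2) * x) + z
      = r • (α * (∑ j, c j ^ 2) * y) + z → x = y := by
    intro r x y z hr h
    have h := add_right_cancel h
    have h : α * (∑ j, c j ^ 2) * x = α * (∑ j, c j ^ 2) * y := by
      simpa [smul_smul, inv_mul_cancel₀ hr] using congrArg (fun z => r⁻¹ • z) h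
    rw [← key x, h, key y]
  have main : ∀ k, AgreeUpTo k a a' ∧ ∀ b, AgreeUpTo k (w b) (w' b) := by
    intro k
    induction k with
    | zero =>
      refine ⟨fun i hi => ?_, fun b i hi => ?_⟩
      · rw [Nat.le_zero.1 hi, ha0, ha0']
      · rw [Nat.le_zero.1 hi, hw0]
    | succ k ih =>
      have hk : (0 : ℝ) ≤ k := by positivity
      refine ⟨fun i hi => ?_, fun b i hi => ?_⟩
      · rcases Nat.lt_or_ge i (k + 1) with h | h
        · exact ih.1 i (by lia)
        · obtain rfl : i = k + 1 := by lia
          have e := congrArg (coeff (k + 1)) (ha.trans ha'.symm)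
          rw [coeff_succ_modulusOp, coeff_succ_modulusOp, ih.1.modulusRemainder_eq ih.2, ha0,
            ha0'] at e
          refine cancel _ _ _ _ ?_ e
          have h1 : (0 : ℝ) < k + 2 * κ - 1 := by linarith
          positivity
      · rcases Nat.lt_or_ge i (k + 1) with h | h
        · exact ih.2 b i (by lia)
        · obtain rfl : i = k + 1 := by lia
          have e := congrArg (fun z => coeff (k + 1) (X * z)) ((hw b).trans (hw' b).symm)
          beta_reduce at e
          rw [coeff_succ_X_mul_directionOp, coeff_succ_X_mul_directionOp,
            ih.1.directionRemainder_eq ih.2, ha0, ha0'] at e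
          refine cancel _ _ _ _ ?_ e
          positivity
  refine ⟨?_, ?_⟩
  · ext k
    exact (main k).1 k le_rfl
  · funext b
    ext k
    exact (main k).2 b k le_rfl

/-- Uniqueness for the linear equation satisfied by `∑ w_b ^ 2 - 1` when the direction equation
holds for `w`. -/
theorem formal_linear_unique {a H Λ : R⟦X⟧} (hκ : 1 < κ)
    (hα : (κ * (κ - 1)) • ((∑ j, c j ^ 2) * α ^ 2) = 1) (ha0 : coeff 0 a = α)
    (hH0 : coeff 0 H = 0)
    (h : (2 * κ) • ∑ j, formalDeriv (c j) (δ j) (X * a) * formalDeriv (c j) (δ j) H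
      + X * a * (∑ j, formalDeriv (c j) (δ j) (formalDeriv (c j) (δ j) H) + Λ * H) = 0) :
    H = 0 := by
  have hX : (2 * κ) • ∑ j, modulusDeriv c δ j a * directionDeriv c δ j H
      + a * directionLaplacian c δ H + X * (X * (a * H * Λ)) = 0 := by
    have h2 : ∑ j, modulusDeriv c δ j a * directionDeriv c δ j H
        = X * ∑ j, formalDeriv (c j) (δ j) (X * a) * formalDeriv (c j) (δ j) H := by
      rw [Finset.mul_sum]
      refine Finset.sum_congr rfl fun j _ => ?_
      rw [modulusDeriv, directionDeriv]
      ring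
    have h3 := congrArg (fun z => X * z) h
    beta_reduce at h3
    rw [mul_zero, mul_add, mul_smul_comm, ← h2] at h3
    rw [← h3, directionLaplacian]
    ring
  have main : ∀ k, AgreeUpTo k H 0 := by
    intro k
    induction k with
    | zero =>
      intro i hi
      rw [Nat.le_zero.1 hi, hH0, map_zero]
    | succ k ih =>
      intro i hi
      rcases Nat.lt_or_ge i (k + 1) with hik | hik
      · exact ih i (by lia)
      · obtain rfl : i = k + 1 := by lia
        have hT : ∀ j, AgreeUpTo k (directionDeriv c δ j H) 0 := fun j i hi => by
          rw [ih.directionDeriv_congr j i hi]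
          cases i with
          | zero => rw [coeff_zero_directionDeriv, map_zero]
          | succ i => rw [coeff_succ_directionDeriv]; simp
        have hM : AgreeUpTo k (directionLaplacian c δ H) 0 := fun i hi => by
          cases i with
          | zero => rw [coeff_zero_directionLaplacian, map_zero]
          | succ i =>
            rw [coeff_succ_directionLaplacian]
            simp [hT _ (i + 1) hi, hT _ i (by lia)]
        have hmid : ∀ F G : R⟦X⟧, AgreeUpTo k G 0 → middleCoeff k F G = 0 := fun F G hG => by
          rw [AgreeUpTo.middleCoeff_eq (fun _ _ => rfl : AgreeUpTo k F F) hG]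
          simp [middleCoeff]
        have hL : coeff (k + 1) (X * (X * (a * H * Λ))) = 0 := by
          rw [coeff_succ_X_mul]
          cases k with
          | zero => rw [coeff_zero_X_mul]
          | succ k =>
            have e : AgreeUpTo (k + 1) (a * H * Λ) (a * 0 * Λ) :=
              AgreeUpTo.mul (AgreeUpTo.mul (fun _ _ => rfl) ih) (fun _ _ => rfl)
            rw [coeff_succ_X_mul, e k (by lia)]
            simp
        have e := congrArg (coeff (k + 1)) hX
        rw [map_add, map_add, coeff_smul, coeff_succ_sum_modulusDeriv_mul_directionDeriv,
          coeff_succ_mul_directionLaplacian, hL, ih k le_rfl, ha0] at e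
        simp only [hmid _ _ (hT _), hmid _ _ hM, hT _ k le_rfl, map_zero, mul_zero, add_zero,
          Finset.sum_const_zero, smul_zero] at e
        have e2 : ((k + 1) * (k + 2 * κ)) • (α * (∑ j, c j ^ 2) * coeff (k + 1) H) = 0 := by
          rw [← e]
          simp only [Algebra.smul_def, map_mul, map_add, map_one, map_ofNat, map_natCast]
          ring
        have h4 : α * (∑ j, c j ^ 2) * coeff (k + 1) H = 0 := by
          refine (smul_eq_zero_iff_right ?_).1 e2
          positivity
        have h5 : coeff (k + 1) H
            = (κ * (κ - 1)) • (α * (α * (∑ j, c j ^ 2) * coeff (k + 1) H)) := by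
          have h6 : α * (α * (∑ j, c j ^ 2) * coeff (k + 1) H)
              = ((∑ j, c j ^ 2) * α ^ 2) * coeff (k + 1) H := by ring
          rw [h6, ← smul_mul_assoc, hα, one_mul]
        rw [h5, h4, mul_zero, smul_zero, map_zero]
  ext k
  exact main k k le_rfl

end FormalSolution

/-! ### Convergence of nonnegative series defined by a recursive inequality -/

section MajorantSeries

open PowerSeries
open scoped ENNReal NNReal

/-- The truncated sum `∑_{k < K} εᵏ F_k`. -/
noncomputable def truncEval (ε : ℝ≥0∞) (K : ℕ) (F : ℝ≥0∞⟦X⟧) : ℝ≥0∞ :=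
  ∑ k ∈ Finset.range K, ε ^ k * coeff k F

theorem truncEval_add (ε : ℝ≥0∞) (K : ℕ) (F G : ℝ≥0∞⟦X⟧) :
    truncEval ε K (F + G) = truncEval ε K F + truncEval ε K G := by
  simp only [truncEval, map_add, mul_add, Finset.sum_add_distrib]

theorem truncEval_mono {ε : ℝ≥0∞} {F G : ℝ≥0∞⟦X⟧} (h : ∀ k, coeff k F ≤ coeff k G) (K : ℕ) :
    truncEval ε K F ≤ truncEval ε K G :=
  Finset.sum_le_sum fun k _ => mul_le_mul_right (h k) _

theorem truncEval_le_succ (ε : ℝ≥0∞) (K : ℕ) (F : ℝ≥0∞⟦X⟧) :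
    truncEval ε K F ≤ truncEval ε (K + 1) F := by
  rw [truncEval, truncEval, Finset.sum_range_succ]
  exact le_self_add

theorem truncEval_mul_le (ε : ℝ≥0∞) (K : ℕ) (F G : ℝ≥0∞⟦X⟧) :
    truncEval ε K (F * G) ≤ truncEval ε K F * truncEval ε K G := by
  have h : truncEval ε K (F * G)
      = ∑ x ∈ (Finset.range K).sigma fun k => Finset.HasAntidiagonal.antidiagonal k,
        (ε ^ x.2.1 * coeff x.2.1 F) * (ε ^ x.2.2 * coeff x.2.2 G) := by
    rw [Finset.sum_sigma, truncEval]
    refine Finset.sum_congr rfl fun k _ => ?_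
    rw [coeff_mul, Finset.mul_sum]
    refine Finset.sum_congr rfl fun x hx => ?_
    rw [← Finset.HasAntidiagonal.mem_antidiagonal.1 hx, pow_add]
    ring
  have hinj : Set.InjOn (fun x : Σ _ : ℕ, ℕ × ℕ => x.2)
      ((Finset.range K).sigma fun k => Finset.HasAntidiagonal.antidiagonal k) := by
    rintro ⟨k, x⟩ hx ⟨l, y⟩ hy rfl
    simp only [Finset.coe_sigma, Set.mem_sigma_iff, Finset.mem_coe,
      Finset.HasAntidiagonal.mem_antidiagonal] at hx hy
    rw [← hx.2, ← hy.2]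
  rw [h, truncEval, truncEval, Finset.sum_mul_sum, ← Finset.sum_product',
    ← Finset.sum_image (f := fun x : ℕ × ℕ => (ε ^ x.1 * coeff x.1 F) * (ε ^ x.2 * coeff x.2 G))
      hinj]
  refine Finset.sum_le_sum_of_subset fun x hx => ?_
  obtain ⟨⟨k, y⟩, hy, rfl⟩ := Finset.mem_image.1 hx
  simp only [Finset.mem_sigma, Finset.mem_range, Finset.HasAntidiagonal.mem_antidiagonal] at hy
  simp only [Finset.mem_product, Finset.mem_range]
  lia

theorem truncEval_succ_X_mul (ε : ℝ≥0∞) (K : ℕ) (F : ℝ≥0∞⟦X⟧) :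
    truncEval ε (K + 1) (X * F) = ε * truncEval ε K F := by
  rw [truncEval, Finset.sum_range_succ', coeff_zero_X_mul, mul_zero, add_zero, truncEval,
    Finset.mul_sum]
  refine Finset.sum_congr rfl fun k _ => ?_
  rw [coeff_succ_X_mul, pow_succ']
  ring

theorem truncEval_X_mul_le (ε : ℝ≥0∞) (K : ℕ) (F : ℝ≥0∞⟦X⟧) :
    truncEval ε K (X * F) ≤ ε * truncEval ε K F := by
  cases K with
  | zero => simp [truncEval]
  | succ K =>
    rw [truncEval_succ_X_mul]
    exact mul_le_mul_right (truncEval_le_succ _ _ _) _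

theorem truncEval_C_le (ε : ℝ≥0∞) (K : ℕ) (r : ℝ≥0∞) : truncEval ε K (C r) ≤ r := by
  cases K with
  | zero => simp [truncEval]
  | succ K => simp [truncEval, coeff_C]

theorem truncEval_one_add_X_mul_le {ε : ℝ≥0∞} (hε : ε ≤ 1) (K : ℕ) (F : ℝ≥0∞⟦X⟧) :
    truncEval ε K ((1 + X) * F) ≤ 2 * truncEval ε K F := by
  rw [add_mul, one_mul, truncEval_add, two_mul]
  gcongr
  exact (truncEval_X_mul_le _ _ _).trans (mul_le_of_le_one_left' hε)

/-- A nonnegative sequence whose terms are bounded by the coefficients of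
`G + X G'² + X G² G'²`, where `G = (1 + X)² ∑ β_k Xᵏ` and `G = G₀ + X G'`, grows at most
geometrically: the linear terms carry a factor `ε`, the other ones are quadratically small. -/
theorem exists_tsum_ne_top {β G' : ℝ≥0∞⟦X⟧} {C : ℝ≥0} (hβ0 : coeff 0 β ≠ ∞)
    (hG' : ∀ k, coeff k G' = coeff (k + 1) ((1 + X) * ((1 + X) * β)))
    (hβ : ∀ k, coeff (k + 1) β ≤ C * coeff k ((1 + X) * ((1 + X) * β) + X * (G' * G')
      + X * (((1 + X) * ((1 + X) * β)) * ((1 + X) * ((1 + X) * β)) * (G' * G')))) :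
    ∃ ε : ℝ≥0, 0 < ε ∧ ∑' k, (ε : ℝ≥0∞) ^ k * coeff k β ≠ ∞ := by
  set G := (1 + X) * ((1 + X) * β) with hG
  lift coeff 0 β to ℝ≥0 using hβ0 with β0 hβ0'
  obtain ⟨C', hC', hC1⟩ : ∃ C' : ℝ≥0, C ≤ C' ∧ 1 ≤ C' := ⟨max C 1, le_max_left _ _, le_max_right _ _⟩
  -- The truncated sums of `ε ∑ β_{k+1} εᵏ` stay below `δ` by induction: those of `G` are then at most
  -- `4 * (β0 + δ)` and those of `ε G'` at most `7 * δ`, so the next one is at most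
  -- `C' * (4 + 7² * (1 + 4²)) * (β0 + 1)² * δ²`, which is `δ` because `4 + 7² * 17 = 837`.
  set δ : ℝ≥0 := (837 * C' * (β0 + 1) ^ 2)⁻¹ with hδ
  set ε : ℝ≥0 := δ ^ 2 / (β0 + 1) with hε
  have hb : (1 : ℝ≥0) ≤ β0 + 1 := le_add_self
  have hδ1 : δ ≤ 1 := by
    refine inv_le_one_of_one_le₀ ?_
    calc (1 : ℝ≥0) = 1 * 1 * 1 ^ 2 := by norm_num
      _ ≤ 837 * C' * (β0 + 1) ^ 2 := by gcongr; norm_num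
  have hδ0 : 0 < δ := by positivity
  have hε0 : 0 < ε := by positivity
  have hεb : ε * (β0 + 1) = δ ^ 2 := by rw [hε]; field_simp
  have hδC : C' * (837 * (β0 + 1) ^ 2 * δ ^ 2) = δ := by
    have : 837 * C' * (β0 + 1) ^ 2 * δ = 1 := by rw [hδ]; field_simp
    calc C' * (837 * (β0 + 1) ^ 2 * δ ^ 2) = (837 * C' * (β0 + 1) ^ 2 * δ) * δ := by ring
      _ = δ := by rw [this, one_mul]
  have hε1 : ε ≤ 1 := by
    calc ε = ε * 1 := (mul_one _).symm
      _ ≤ ε * (β0 + 1) := by gcongr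
      _ = δ ^ 2 := hεb
      _ ≤ 1 := pow_le_one₀ zero_le hδ1
  set B : ℝ≥0∞⟦X⟧ := PowerSeries.mk fun k => coeff (k + 1) β with hB
  have hβB : β = PowerSeries.C (β0 : ℝ≥0∞) + X * B := by
    ext k
    cases k with
    | zero => rw [map_add, coeff_zero_X_mul, add_zero, ← hβ0']; simp
    | succ k => rw [map_add, coeff_succ_X_mul, coeff_C]; simp [hB]
  have hG'B : G' = 2 * PowerSeries.C (β0 : ℝ≥0∞) + X * PowerSeries.C (β0 : ℝ≥0∞)
      + (1 + X) * ((1 + X) * B) := by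
    ext k
    rw [hG']
    have h : (1 + X) * ((1 + X) * β) = PowerSeries.C (β0 : ℝ≥0∞)
        + X * (2 * PowerSeries.C (β0 : ℝ≥0∞) + X * PowerSeries.C (β0 : ℝ≥0∞)
          + (1 + X) * ((1 + X) * B)) := by
      rw [hβB]
      ring
    rw [hG, h, map_add, coeff_succ_X_mul, coeff_C]
    simp
  set x : ℕ → ℝ≥0∞ := fun K => ε * truncEval ε K B with hx
  have hε1' : (ε : ℝ≥0∞) ≤ 1 := by exact_mod_cast hε1
  have hGle : ∀ K, truncEval ε (K + 1) G ≤ 4 * (β0 + x K) := by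
    intro K
    calc truncEval ε (K + 1) G ≤ 2 * (2 * truncEval ε (K + 1) β) :=
          (truncEval_one_add_X_mul_le hε1' _ _).trans
            (mul_le_mul_right (truncEval_one_add_X_mul_le hε1' _ _) _)
      _ = 4 * truncEval ε (K + 1) β := by ring
      _ ≤ 4 * (β0 + x K) := by
          rw [hβB, truncEval_add, truncEval_succ_X_mul]
          gcongr
          exact truncEval_C_le _ _ _
  have hG'le : ∀ K, ε * truncEval ε K G' ≤ 3 * (ε * β0) + 4 * x K := by
    intro K
    have h1 : truncEval ε K G' ≤ 3 * β0 + 4 * truncEval ε K B := by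
      rw [hG'B, two_mul, truncEval_add, truncEval_add, truncEval_add]
      have e1 := truncEval_C_le ε K β0
      have e2 : truncEval ε K (X * PowerSeries.C (β0 : ℝ≥0∞)) ≤ β0 :=
        (truncEval_X_mul_le _ _ _).trans ((mul_le_of_le_one_left' hε1').trans e1)
      have e3 : truncEval ε K ((1 + X) * ((1 + X) * B)) ≤ 4 * truncEval ε K B :=
        calc truncEval ε K ((1 + X) * ((1 + X) * B)) ≤ 2 * (2 * truncEval ε K B) :=
              (truncEval_one_add_X_mul_le hε1' _ _).trans
                (mul_le_mul_right (truncEval_one_add_X_mul_le hε1' _ _) _)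
          _ = 4 * truncEval ε K B := by ring
      calc _ ≤ (β0 : ℝ≥0∞) + β0 + β0 + 4 * truncEval ε K B := by gcongr
        _ = _ := by ring
    calc ε * truncEval ε K G' ≤ ε * (3 * β0 + 4 * truncEval ε K B) := by gcongr
      _ = _ := by rw [hx]; ring
  have hstep : ∀ K, x (K + 1) ≤ C' * (4 * (ε * (β0 + x K))
      + (3 * (ε * β0) + 4 * x K) ^ 2 * (1 + (4 * (β0 + x K)) ^ 2)) := by
    intro K
    have h1 : truncEval ε (K + 1) B ≤ C' * (truncEval ε (K + 1) G
        + ε * (truncEval ε K G' * truncEval ε K G')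
        + ε * (truncEval ε K G * truncEval ε K G * (truncEval ε K G' * truncEval ε K G'))) := by
      calc truncEval ε (K + 1) B
          ≤ truncEval ε (K + 1) (PowerSeries.C (C : ℝ≥0∞) *
            (G + X * (G' * G') + X * (G * G * (G' * G')))) := by
            refine truncEval_mono (fun k => ?_) _
            rw [coeff_C_mul, hB, coeff_mk]
            exact hβ k
        _ ≤ C' * (truncEval ε (K + 1) (G + X * (G' * G') + X * (G * G * (G' * G')))) := by
            refine (truncEval_mul_le _ _ _ _).trans ?_
            gcongr
            exact (truncEval_C_le _ _ _).trans (by exact_mod_cast hC')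
        _ ≤ _ := by
            rw [truncEval_add, truncEval_add, truncEval_succ_X_mul, truncEval_succ_X_mul]
            gcongr
            · exact truncEval_mul_le _ _ _ _
            · refine (truncEval_mul_le _ _ _ _).trans ?_
              gcongr
              · exact truncEval_mul_le _ _ _ _
              · exact truncEval_mul_le _ _ _ _
    calc x (K + 1) ≤ ε * (C' * (truncEval ε (K + 1) G
        + ε * (truncEval ε K G' * truncEval ε K G')
        + ε * (truncEval ε K G * truncEval ε K G * (truncEval ε K G' * truncEval ε K G')))) := by
          exact mul_le_mul_right h1 _
      _ = C' * (ε * truncEval ε (K + 1) G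
          + (ε * truncEval ε K G') ^ 2 * (1 + (truncEval ε K G) ^ 2)) := by ring
      _ ≤ C' * (ε * (4 * (β0 + x K))
          + (3 * (ε * β0) + 4 * x K) ^ 2 * (1 + (4 * (β0 + x K)) ^ 2)) := by
          gcongr
          · exact hGle K
          · exact hG'le K
          · exact (truncEval_le_succ _ _ _).trans (hGle K)
      _ = _ := by ring
  have hxδ : ∀ K, x K ≤ δ := by
    intro K
    induction K with
    | zero => simp [hx, truncEval]
    | succ K ih =>
      refine (hstep K).trans ?_
      have h1 : C' * (4 * (ε * (β0 + δ)) + (3 * (ε * β0) + 4 * δ) ^ 2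
          * (1 + (4 * (β0 + δ)) ^ 2)) ≤ δ := by
        have e1 : ε * (β0 + δ) ≤ δ ^ 2 := by
          rw [← hεb]; gcongr
        have e2 : ε * β0 ≤ δ := by
          calc ε * β0 ≤ ε * (β0 + 1) := by gcongr; exact le_self_add
            _ = δ * δ := by rw [hεb, pow_two]
            _ ≤ δ := mul_le_of_le_one_left' hδ1
        have e3 : 1 + (4 * (β0 + δ)) ^ 2 ≤ 17 * (β0 + 1) ^ 2 := by
          calc 1 + (4 * (β0 + δ)) ^ 2 ≤ (β0 + 1) ^ 2 + (4 * (β0 + 1)) ^ 2 := by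
                gcongr
                exact one_le_pow₀ hb
            _ = 17 * (β0 + 1) ^ 2 := by ring
        calc C' * (4 * (ε * (β0 + δ)) + (3 * (ε * β0) + 4 * δ) ^ 2 * (1 + (4 * (β0 + δ)) ^ 2))
            ≤ C' * (4 * δ ^ 2 + (3 * δ + 4 * δ) ^ 2 * (17 * (β0 + 1) ^ 2)) := by gcongr
          _ ≤ C' * (4 * ((β0 + 1) ^ 2 * δ ^ 2) + (3 * δ + 4 * δ) ^ 2 * (17 * (β0 + 1) ^ 2)) := by
              gcongr
              exact le_mul_of_one_le_left' (one_le_pow₀ hb)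
          _ = C' * (837 * (β0 + 1) ^ 2 * δ ^ 2) := by ring
          _ = δ := hδC
      calc _ ≤ (C' : ℝ≥0∞) * (4 * (ε * (β0 + δ)) + (3 * (ε * β0) + 4 * δ) ^ 2
            * (1 + (4 * (β0 + δ)) ^ 2)) := by gcongr
        _ ≤ δ := by exact_mod_cast h1
  refine ⟨ε, hε0, ?_⟩
  have hK : ∀ K, ∑ k ∈ Finset.range K, (ε : ℝ≥0∞) ^ k * coeff k β ≤ β0 + δ := by
    intro K
    calc truncEval ε K β ≤ truncEval ε (K + 1) β := truncEval_le_succ _ _ _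
      _ ≤ β0 + δ := by
        rw [hβB, truncEval_add, truncEval_succ_X_mul]
        exact add_le_add (truncEval_C_le _ _ _) (hxδ K)
  have h2 : ∑' k, (ε : ℝ≥0∞) ^ k * coeff k β ≤ β0 + δ := ENNReal.tsum_le_of_sum_range_le hK
  exact ne_top_of_le_ne_top (by finiteness) h2

end MajorantSeries

/-! ### Estimates for the formal solution -/

section FormalEstimate

open PowerSeries
open scoped ENNReal NNReal

variable {R : Type*} [CommRing R] [Algebra ℝ R] {ι B : Type*} [Fintype ι] [Fintype B]

theorem coeff_succ_one_add_X_mul {S : Type*} [CommSemiring S] (F : S⟦X⟧) (k : ℕ) :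
    coeff (k + 1) ((1 + X) * F) = coeff (k + 1) F + coeff k F := by
  rw [add_mul, one_mul, map_add, coeff_succ_X_mul]

theorem coeff_le_coeff_one_add_X_mul (F : ℝ≥0∞⟦X⟧) (k : ℕ) :
    coeff k F ≤ coeff k ((1 + X) * F) := by
  rw [add_mul, one_mul, map_add]
  exact le_self_add

/-- A family of extended seminorms `b k` on a differential algebra, such that the `k`-th one is
adapted to the coefficient of index `k` of a power series: it is submultiplicative in the graded
sense, and a derivation costs a factor `k` and raises the index by one. -/
structure IsMajorantNorm (b : ℕ → R → ℝ≥0∞) (δ : ι → Derivation ℝ R R) (r : ℝ≥0) : Prop where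
  zero : ∀ k, b k 0 = 0
  add_le : ∀ k x y, b k (x + y) ≤ b k x + b k y
  smul_le : ∀ k (t : ℝ) x, b k (t • x) ≤ ENNReal.ofReal |t| * b k x
  mul_le : ∀ i j x y, b (i + j) (x * y) ≤ b i x * b j y
  deriv_le : ∀ k j x, b (k + 1) (δ j x) ≤ r * (k + 1) * b k x

namespace IsMajorantNorm

variable {b : ℕ → R → ℝ≥0∞} {δ : ι → Derivation ℝ R R} {r : ℝ≥0}

theorem sum_le (h : IsMajorantNorm b δ r) {α : Type*} (s : Finset α) (k : ℕ) (x : α → R) :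
    b k (∑ i ∈ s, x i) ≤ ∑ i ∈ s, b k (x i) := by
  classical
  induction s using Finset.induction_on with
  | empty => simp [h.zero]
  | insert a s ha ih =>
    rw [Finset.sum_insert ha, Finset.sum_insert ha]
    exact (h.add_le _ _ _).trans (by gcongr)

theorem mul_natCast_le (h : IsMajorantNorm b δ r) (k n : ℕ) (x : R) :
    b k (x * (n : R)) ≤ n * b k x := by
  have e : x * (n : R) = (n : ℝ) • x := by
    rw [Algebra.smul_def, map_natCast, mul_comm]
  rw [e]
  refine (h.smul_le _ _ _).trans ?_
  rw [Nat.abs_cast, ENNReal.ofReal_natCast]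

theorem const_mul_le (h : IsMajorantNorm b δ r) (k : ℕ) (c x : R) :
    b k (c * x) ≤ b 0 c * b k x := by
  simpa using h.mul_le 0 k c x

theorem coeff_mul_le (h : IsMajorantNorm b δ r) (k : ℕ) {F G : R⟦X⟧} {f g : ℝ≥0∞⟦X⟧}
    (hf : ∀ i, b i (coeff i F) ≤ coeff i f) (hg : ∀ i, b i (coeff i G) ≤ coeff i g) :
    b k (coeff k (F * G)) ≤ coeff k (f * g) := by
  rw [coeff_mul, coeff_mul]
  refine (h.sum_le _ _ _).trans (Finset.sum_le_sum fun x hx => ?_)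
  rw [← Finset.HasAntidiagonal.mem_antidiagonal.1 hx]
  exact (h.mul_le _ _ _ _).trans (mul_le_mul' (hf _) (hg _))

/-- The middle terms of a product of two series whose coefficient bounds carry weights `u`, `v`.
Weights growing linearly, or one growing quadratically, obey `huv` because the two extreme indices
are omitted; `(k + 1)²` is what inverting the indicial polynomial gains. -/
theorem middleCoeff_le (h : IsMajorantNorm b δ r) {F G : R⟦X⟧} {f : ℕ → ℝ≥0∞} {u v : ℕ → ℝ≥0∞}
    {C C' : ℝ≥0} (hf : ∀ i, b i (coeff i F) ≤ C * (u i * f i))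
    (hg : ∀ i, b i (coeff i G) ≤ C' * (v i * f i)) {k : ℕ}
    (huv : ∀ i < k, u (i + 1) * v (k - i) ≤ (k + 1) ^ 2) :
    b (k + 1) (middleCoeff k F G) ≤ (C * C' : ℝ≥0)
      * ((k + 1) ^ 2 * coeff k (X * (PowerSeries.mk (fun i => f (i + 1))
        * PowerSeries.mk (fun i => f (i + 1))))) := by
  have e : coeff k (X * (PowerSeries.mk (fun i => f (i + 1))
      * PowerSeries.mk (fun i => f (i + 1)))) = ∑ i ∈ Finset.range k, f (i + 1) * f (k - i) := by
    cases k with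
    | zero => simp
    | succ k =>
      rw [coeff_succ_X_mul, coeff_mul, Finset.Nat.sum_antidiagonal_eq_sum_range_succ
        (fun i j => coeff i (PowerSeries.mk fun i => f (i + 1))
          * coeff j (PowerSeries.mk fun i => f (i + 1)))]
      refine Finset.sum_congr rfl fun i hi => ?_
      have := Finset.mem_range.1 hi
      rw [coeff_mk, coeff_mk, show k + 1 - i = k - i + 1 by lia]
  rw [e, middleCoeff, Finset.mul_sum, Finset.mul_sum]
  refine (h.sum_le _ _ _).trans (Finset.sum_le_sum fun i hi => ?_)
  have hik := Finset.mem_range.1 hi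
  have hk : k + 1 = (i + 1) + (k - i) := by lia
  calc b (k + 1) (coeff (i + 1) F * coeff (k - i) G)
      ≤ b (i + 1) (coeff (i + 1) F) * b (k - i) (coeff (k - i) G) := by
        conv_lhs => rw [hk]
        exact h.mul_le _ _ _ _
    _ ≤ (C * (u (i + 1) * f (i + 1))) * (C' * (v (k - i) * f (k - i))) :=
        mul_le_mul' (hf _) (hg _)
    _ = (C * C') * ((u (i + 1) * v (k - i)) * (f (i + 1) * f (k - i))) := by ring
    _ ≤ (C * C') * ((k + 1) ^ 2 * (f (i + 1) * f (k - i))) := by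
        gcongr
        exact huv i hik
    _ = _ := by push_cast; rfl

/-- The sequence `x` has weighted growth at most quadratic relative to the sequence `Q`. -/
def _root_.QuadBounded (b : ℕ → R → ℝ≥0∞) (Q : ℕ → ℝ≥0∞) (x : ℕ → R) : Prop :=
  ∃ C : ℝ≥0, ∀ k, b (k + 1) (x k) ≤ C * ((k + 1) ^ 2 * Q k)

variable {Q : ℕ → ℝ≥0∞} {x y : ℕ → R}

theorem quadBounded_add (h : IsMajorantNorm b δ r) (hx : QuadBounded b Q x)
    (hy : QuadBounded b Q y) : QuadBounded b Q (fun k => x k + y k) := by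
  obtain ⟨C, hC⟩ := hx
  obtain ⟨C', hC'⟩ := hy
  refine ⟨C + C', fun k => (h.add_le _ _ _).trans ?_⟩
  rw [ENNReal.coe_add, add_mul]
  exact add_le_add (hC k) (hC' k)

theorem quadBounded_smul (h : IsMajorantNorm b δ r) (hx : QuadBounded b Q x) (t : ℝ) :
    QuadBounded b Q (fun k => t • x k) := by
  obtain ⟨C, hC⟩ := hx
  refine ⟨Real.toNNReal |t| * C, fun k => (h.smul_le _ _ _).trans ?_⟩
  rw [ENNReal.coe_mul, mul_assoc]
  exact mul_le_mul_right (hC k) _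

theorem quadBounded_sub (h : IsMajorantNorm b δ r) (hx : QuadBounded b Q x)
    (hy : QuadBounded b Q y) : QuadBounded b Q (fun k => x k - y k) := by
  have := h.quadBounded_add hx (h.quadBounded_smul hy (-1))
  simpa [sub_eq_add_neg] using this

theorem quadBounded_const_mul (h : IsMajorantNorm b δ r) (hx : QuadBounded b Q x) {c : R}
    (hc : b 0 c ≠ ∞) : QuadBounded b Q (fun k => c * x k) := by
  obtain ⟨C, hC⟩ := hx
  lift b 0 c to ℝ≥0 using hc with c' hc'
  refine ⟨c' * C, fun k => (h.const_mul_le _ _ _).trans ?_⟩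
  rw [ENNReal.coe_mul, mul_assoc, hc']
  exact mul_le_mul_right (hC k) _

theorem quadBounded_sum (h : IsMajorantNorm b δ r) {α : Type*} [Fintype α] {x : α → ℕ → R}
    (hx : ∀ i, QuadBounded b Q (x i)) : QuadBounded b Q (fun k => ∑ i, x i k) := by
  choose C hC using hx
  refine ⟨∑ i, C i, fun k => (h.sum_le _ _ _).trans ?_⟩
  rw [ENNReal.ofNNReal_finsetSum, Finset.sum_mul]
  exact Finset.sum_le_sum fun i _ => hC i k

variable {c : ι → R} {c₀ : ℝ≥0} {β : ℝ≥0∞⟦X⟧}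

theorem modulusDeriv_le (h : IsMajorantNorm b δ r) (hc : ∀ j, b 0 (c j) ≤ c₀) {a : R⟦X⟧}
    (ha : ∀ k, b k (coeff k a) ≤ coeff k β) (j : ι) (k : ℕ) :
    b k (coeff k (modulusDeriv c δ j a))
      ≤ (c₀ + r : ℝ≥0) * ((k + 1) * coeff k ((1 + X) * β)) := by
  cases k with
  | zero =>
    rw [coeff_zero_modulusDeriv]
    calc b 0 (c j * coeff 0 a) ≤ b 0 (c j) * b 0 (coeff 0 a) := h.const_mul_le _ _ _
      _ ≤ c₀ * coeff 0 β := mul_le_mul' (hc j) (ha 0)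
      _ ≤ (c₀ + r : ℝ≥0) * (((0 : ℕ) + 1) * coeff 0 ((1 + X) * β)) := by
        gcongr
        · exact le_self_add
        · simp
  | succ k =>
    rw [coeff_succ_modulusDeriv, coeff_succ_one_add_X_mul]
    calc _ ≤ b 0 (c j) * (((k + 2 : ℕ) : ℝ≥0∞) * b (k + 1) (coeff (k + 1) a))
          + r * (k + 1) * b k (coeff k a) := by
          refine (h.add_le _ _ _).trans (add_le_add ?_ (h.deriv_le _ _ _))
          refine (h.const_mul_le _ _ _).trans (mul_le_mul_right ?_ _)
          exact_mod_cast h.mul_natCast_le (k + 1) (k + 2) (coeff (k + 1) a)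
      _ ≤ c₀ * (((k + 2 : ℕ) : ℝ≥0∞) * coeff (k + 1) β) + r * ((k + 2 : ℕ) : ℝ≥0∞) * coeff k β := by
          gcongr
          · exact hc j
          · exact ha _
          · push_cast; gcongr; norm_num
          · exact ha _
      _ ≤ (c₀ + r) * (((k + 2 : ℕ) : ℝ≥0∞) * (coeff (k + 1) β + coeff k β)) := by
          rw [mul_add, mul_add, add_mul, add_mul, mul_assoc]
          gcongr
          · exact le_self_add
          · exact le_add_self
      _ = _ := by push_cast; ring

theorem directionDeriv_le (h : IsMajorantNorm b δ r) (hc : ∀ j, b 0 (c j) ≤ c₀) {w : R⟦X⟧}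
    (hw : ∀ k, b k (coeff k w) ≤ coeff k β) (j : ι) (k : ℕ) :
    b k (coeff k (directionDeriv c δ j w))
      ≤ (c₀ + r : ℝ≥0) * ((k + 1) * coeff k ((1 + X) * β)) := by
  cases k with
  | zero => rw [coeff_zero_directionDeriv, h.zero]; exact zero_le
  | succ k =>
    rw [coeff_succ_directionDeriv, coeff_succ_one_add_X_mul]
    calc _ ≤ b 0 (c j) * (((k + 1 : ℕ) : ℝ≥0∞) * b (k + 1) (coeff (k + 1) w))
          + r * (k + 1) * b k (coeff k w) := by
          refine (h.add_le _ _ _).trans (add_le_add ?_ (h.deriv_le _ _ _))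
          refine (h.const_mul_le _ _ _).trans (mul_le_mul_right ?_ _)
          exact_mod_cast h.mul_natCast_le (k + 1) (k + 1) (coeff (k + 1) w)
      _ ≤ c₀ * (((k + 2 : ℕ) : ℝ≥0∞) * coeff (k + 1) β) + r * ((k + 2 : ℕ) : ℝ≥0∞) * coeff k β := by
          gcongr
          · exact hc j
          · norm_num
          · exact hw _
          · push_cast; gcongr; norm_num
          · exact hw _
      _ ≤ (c₀ + r) * (((k + 2 : ℕ) : ℝ≥0∞) * (coeff (k + 1) β + coeff k β)) := by
          rw [mul_add, mul_add, add_mul, add_mul, mul_assoc]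
          gcongr
          · exact le_self_add
          · exact le_add_self
      _ = _ := by push_cast; ring

theorem second_deriv_le (h : IsMajorantNorm b δ r) (hc : ∀ j, b 0 (c j) ≤ c₀)
    {P : ι → R⟦X⟧} {L : R⟦X⟧} {C : ℝ≥0} {p : ℝ≥0∞⟦X⟧} {n : ℕ → ℕ} (hn : ∀ k, n k ≤ k + 2)
    (hP : ∀ j k, b k (coeff k (P j)) ≤ C * ((k + 1) * coeff k p)) (hL0 : coeff 0 L = 0)
    (hL : ∀ k, coeff (k + 1) L = ∑ j, (c j * (coeff (k + 1) (P j) * (n k : R))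
      + δ j (coeff k (P j)))) (k : ℕ) :
    b k (coeff k L) ≤ (Fintype.card ι * (c₀ + r) * C : ℝ≥0)
      * ((k + 1) ^ 2 * coeff k ((1 + X) * p)) := by
  cases k with
  | zero => rw [hL0, h.zero]; exact zero_le
  | succ k =>
    rw [hL, coeff_succ_one_add_X_mul]
    refine (h.sum_le _ _ _).trans ?_
    have : ∀ j ∈ Finset.univ, b (k + 1) (c j * (coeff (k + 1) (P j) * (n k : R))
        + δ j (coeff k (P j)))
        ≤ (c₀ + r) * C * ((((k + 1 : ℕ) : ℝ≥0∞) + 1) ^ 2 * (coeff (k + 1) p + coeff k p)) := by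
      intro j _
      calc _ ≤ b 0 (c j) * ((n k : ℝ≥0∞) * b (k + 1) (coeff (k + 1) (P j)))
          + r * (k + 1) * b k (coeff k (P j)) := by
            refine (h.add_le _ _ _).trans (add_le_add ?_ (h.deriv_le _ _ _))
            refine (h.const_mul_le _ _ _).trans (mul_le_mul_right ?_ _)
            exact h.mul_natCast_le _ _ _
        _ ≤ c₀ * (((k + 2 : ℕ) : ℝ≥0∞) * (C * (((k + 1 : ℕ) + 1) * coeff (k + 1) p)))
          + r * ((k + 2 : ℕ) : ℝ≥0∞) * (C * (((k + 1 : ℕ) + 1) * coeff k p)) := by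
            gcongr
            · exact hc j
            · exact hn k
            · exact hP _ _
            · push_cast; gcongr; norm_num
            · refine (hP _ _).trans ?_
              gcongr
              lia
        _ = (C * (((k + 1 : ℕ) : ℝ≥0∞) + 1) ^ 2) * (c₀ * coeff (k + 1) p + r * coeff k p) := by
            push_cast; ring
        _ ≤ (C * (((k + 1 : ℕ) : ℝ≥0∞) + 1) ^ 2)
            * ((c₀ + r) * (coeff (k + 1) p + coeff k p)) := by
            rw [mul_add (c₀ + r : ℝ≥0∞), add_mul, add_mul]
            gcongr
            · exact le_self_add
            · exact le_add_self
        _ = _ := by ring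
    refine (Finset.sum_le_sum this).trans ?_
    rw [Finset.sum_const, Finset.card_univ, nsmul_eq_mul]
    push_cast
    rw [mul_assoc (Fintype.card ι : ℝ≥0∞), mul_assoc (Fintype.card ι : ℝ≥0∞)]

/-- The coefficients of this series, formed from the norms of the coefficients of a formal
solution up to the index `k`, bound the norm of the coefficient of index `k + 1`. -/
noncomputable def _root_.recursionMajorant (β : ℝ≥0∞⟦X⟧) : ℝ≥0∞⟦X⟧ :=
  (1 + X) * ((1 + X) * β)
    + X * (PowerSeries.mk (fun i => coeff (i + 1) ((1 + X) * ((1 + X) * β)))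
      * PowerSeries.mk (fun i => coeff (i + 1) ((1 + X) * ((1 + X) * β))))
    + X * (((1 + X) * ((1 + X) * β)) * ((1 + X) * ((1 + X) * β))
      * (PowerSeries.mk (fun i => coeff (i + 1) ((1 + X) * ((1 + X) * β)))
        * PowerSeries.mk (fun i => coeff (i + 1) ((1 + X) * ((1 + X) * β)))))

theorem quadBounded_of_linear {C : ℝ≥0} (hx : ∀ k, b (k + 1) (x k)
    ≤ C * ((k + 1) ^ 2 * coeff k ((1 + X) * ((1 + X) * β)))) :
    QuadBounded b (fun k => coeff k (recursionMajorant β)) x := by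
  refine ⟨C, fun k => (hx k).trans ?_⟩
  beta_reduce
  rw [recursionMajorant, map_add, map_add, add_assoc]
  gcongr
  exact le_self_add

theorem quadBounded_of_quadratic {C : ℝ≥0} (hx : ∀ k, b (k + 1) (x k)
    ≤ C * ((k + 1) ^ 2 * coeff k
      (X * (PowerSeries.mk (fun i => coeff (i + 1) ((1 + X) * ((1 + X) * β)))
        * PowerSeries.mk (fun i => coeff (i + 1) ((1 + X) * ((1 + X) * β))))))) :
    QuadBounded b (fun k => coeff k (recursionMajorant β)) x := by
  refine ⟨C, fun k => (hx k).trans ?_⟩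
  beta_reduce
  rw [recursionMajorant, map_add, map_add]
  gcongr
  exact le_add_self.trans le_self_add

theorem quadBounded_of_quartic {C : ℝ≥0} (hx : ∀ k, b (k + 1) (x k)
    ≤ C * ((k + 1) ^ 2 * coeff k
      (X * (((1 + X) * ((1 + X) * β)) * ((1 + X) * ((1 + X) * β))
        * (PowerSeries.mk (fun i => coeff (i + 1) ((1 + X) * ((1 + X) * β)))
          * PowerSeries.mk (fun i => coeff (i + 1) ((1 + X) * ((1 + X) * β)))))))) :
    QuadBounded b (fun k => coeff k (recursionMajorant β)) x := by
  refine ⟨C, fun k => (hx k).trans ?_⟩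
  beta_reduce
  rw [recursionMajorant, map_add]
  gcongr
  exact le_add_self

theorem quadBounded_smul_deriv (h : IsMajorantNorm b δ r) {F : R⟦X⟧} {s : ℕ → ℝ}
    (hs : ∀ k, |s k| ≤ k + 1) (hF : ∀ k, b k (coeff k F) ≤ coeff k β) (j : ι) :
    QuadBounded b (fun k => coeff k (recursionMajorant β)) (fun k => s k • δ j (coeff k F)) := by
  refine quadBounded_of_linear (C := r) fun k => (h.smul_le _ _ _).trans ?_
  calc _ ≤ ((k : ℝ≥0∞) + 1) * (r * (k + 1) * b k (coeff k F)) := by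
        gcongr
        · refine (ENNReal.ofReal_le_ofReal (hs k)).trans ?_
          rw [ENNReal.ofReal_add (by positivity) (by positivity)]
          simp
        · exact h.deriv_le _ _ _
    _ = r * ((k + 1) ^ 2 * b k (coeff k F)) := by ring
    _ ≤ _ := by
        gcongr
        exact (hF k).trans ((coeff_le_coeff_one_add_X_mul _ _).trans
          (coeff_le_coeff_one_add_X_mul _ _))

theorem quadBounded_deriv_of_le (h : IsMajorantNorm b δ r) {P : R⟦X⟧} {C : ℝ≥0}
    (hP : ∀ k, b k (coeff k P) ≤ C * ((k + 1) * coeff k ((1 + X) * β))) (j : ι) :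
    QuadBounded b (fun k => coeff k (recursionMajorant β)) (fun k => δ j (coeff k P)) := by
  refine quadBounded_of_linear (C := r * C) fun k => (h.deriv_le _ _ _).trans ?_
  calc _ ≤ r * (k + 1) * (C * (((k : ℝ≥0∞) + 1) * coeff k ((1 + X) * β))) := by
        gcongr
        exact hP k
    _ ≤ r * (k + 1) * (C * (((k : ℝ≥0∞) + 1) * coeff k ((1 + X) * ((1 + X) * β)))) := by
        gcongr
        exact coeff_le_coeff_one_add_X_mul _ _
    _ = _ := by push_cast; ring

theorem quadBounded_middleCoeff (h : IsMajorantNorm b δ r) {F G : R⟦X⟧} {C C' : ℝ≥0}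
    (hF : ∀ k, b k (coeff k F) ≤ C * ((k + 1) * coeff k ((1 + X) * β)))
    (hG : ∀ k, b k (coeff k G) ≤ C' * ((k + 1) * coeff k ((1 + X) * β))) :
    QuadBounded b (fun k => coeff k (recursionMajorant β)) (fun k => middleCoeff k F G) := by
  have mono : ∀ k : ℕ, ((k : ℝ≥0∞) + 1) * coeff k ((1 + X) * β)
      ≤ (k + 1) * coeff k ((1 + X) * ((1 + X) * β)) := fun k =>
    mul_le_mul_right (coeff_le_coeff_one_add_X_mul _ _) _
  refine quadBounded_of_quadratic (C := C * C') fun k => h.middleCoeff_le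
    (u := fun k => k + 1) (v := fun k => k + 1)
    (f := fun k => coeff k ((1 + X) * ((1 + X) * β)))
    (fun i => (hF i).trans (mul_le_mul_right (mono i) _))
    (fun i => (hG i).trans (mul_le_mul_right (mono i) _)) fun i hi => ?_
  rw [pow_two]
  refine mul_le_mul' ?_ ?_
  · norm_cast
    lia
  · norm_cast
    lia

theorem quadBounded_middleCoeff' (h : IsMajorantNorm b δ r) {F G : R⟦X⟧} {C' : ℝ≥0}
    (hF : ∀ k, b k (coeff k F) ≤ coeff k β)
    (hG : ∀ k, b k (coeff k G) ≤ C' * ((k + 1) ^ 2 * coeff k ((1 + X) * ((1 + X) * β)))) :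
    QuadBounded b (fun k => coeff k (recursionMajorant β)) (fun k => middleCoeff k F G) := by
  refine quadBounded_of_quadratic (C := 1 * C') fun k => h.middleCoeff_le
    (u := fun k => 1) (v := fun k => (k + 1) ^ 2)
    (f := fun k => coeff k ((1 + X) * ((1 + X) * β))) (fun i => ?_) hG fun i hi => ?_
  · rw [ENNReal.coe_one, one_mul, one_mul]
    exact (hF i).trans ((coeff_le_coeff_one_add_X_mul _ _).trans
          (coeff_le_coeff_one_add_X_mul _ _))
  · rw [one_mul]
    gcongr
    lia

/-- The energy is quadratic in the unknown: each of its two derivatives costs a factor `k + 1`,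
and together they are compensated by the weight `(k + 1)²`. -/
theorem quadBounded_energy (h : IsMajorantNorm b δ r) (hc : ∀ j, b 0 (c j) ≤ c₀)
    {F G : R⟦X⟧} {w : B → R⟦X⟧} (hF : ∀ k, b k (coeff k F) ≤ coeff k β)
    (hG : ∀ k, b k (coeff k G) ≤ coeff k β)
    (hw : ∀ i k, b k (coeff k (w i)) ≤ coeff k β) :
    QuadBounded b (fun k => coeff k (recursionMajorant β))
      (fun k => coeff (k + 1) (F * G * directionEnergy c δ w)) := by
  set g := (1 + X) * ((1 + X) * β) with hg
  set G' : ℝ≥0∞⟦X⟧ := PowerSeries.mk (fun i => coeff (i + 1) g) with hG'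
  have hβg : ∀ k, coeff k β ≤ coeff k g := fun k =>
    (coeff_le_coeff_one_add_X_mul _ _).trans (coeff_le_coeff_one_add_X_mul _ _)
  have mono : ∀ k : ℕ, ((k : ℝ≥0∞) + 1) * coeff k ((1 + X) * β) ≤ (k + 1) * coeff k g := fun k =>
    mul_le_mul_right (coeff_le_coeff_one_add_X_mul _ _) _
  set C : ℝ≥0 := Fintype.card B * (Fintype.card ι * ((c₀ + r) * (c₀ + r))) with hC
  set q : ℝ≥0∞⟦X⟧ := PowerSeries.mk fun k : ℕ => C * (((k : ℝ≥0∞) + 1) ^ 2 * coeff k (X * (G' * G')))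
    with hq
  have hQ : ∀ i, b i (coeff i (directionEnergy c δ w)) ≤ coeff i (X * q) := by
    intro i
    cases i with
    | zero => rw [coeff_zero_directionEnergy, h.zero]; exact zero_le
    | succ k =>
      rw [coeff_succ_directionEnergy, coeff_succ_X_mul, hq, coeff_mk]
      have e : ∀ i j, b (k + 1) (middleCoeff k (directionDeriv c δ j (w i))
          (directionDeriv c δ j (w i))) ≤ ((c₀ + r) * (c₀ + r) : ℝ≥0)
            * (((k : ℝ≥0∞) + 1) ^ 2 * coeff k (X * (G' * G'))) := by
        intro i j
        refine h.middleCoeff_le (u := fun k => k + 1) (v := fun k => k + 1)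
          (f := fun k => coeff k g)
          (fun l => (h.directionDeriv_le hc (hw i) j l).trans (mul_le_mul_right (mono l) _))
          (fun l => (h.directionDeriv_le hc (hw i) j l).trans (mul_le_mul_right (mono l) _))
          fun i hi => ?_
        rw [pow_two]
        refine mul_le_mul' ?_ ?_
        · norm_cast
          lia
        · norm_cast
          lia
      refine (h.sum_le _ _ _).trans ((Finset.sum_le_sum fun i _ =>
        (h.sum_le _ _ _).trans (Finset.sum_le_sum fun j _ => e i j)).trans ?_)
      rw [Finset.sum_const, Finset.sum_const, Finset.card_univ, Finset.card_univ, nsmul_eq_mul,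
        nsmul_eq_mul, hC]
      push_cast
      simp only [mul_assoc]
      exact le_rfl
  refine quadBounded_of_quartic (C := C) fun k => ?_
  have h1 := h.coeff_mul_le (k + 1) (fun i => h.coeff_mul_le i
    (fun i => (hF i).trans (hβg i)) (fun i => (hG i).trans (hβg i))) hQ
  refine h1.trans ?_
  rw [mul_left_comm, coeff_succ_X_mul, mul_left_comm X (g * g), coeff_mul, coeff_mul,
    Finset.mul_sum, Finset.mul_sum]
  refine Finset.sum_le_sum fun x hx => ?_
  have hxk : x.2 ≤ k := by
    have := Finset.HasAntidiagonal.mem_antidiagonal.1 hx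
    lia
  rw [hq, coeff_mk]
  calc coeff x.1 (g * g) * (C * (((x.2 : ℝ≥0∞) + 1) ^ 2 * coeff x.2 (X * (G' * G'))))
      ≤ coeff x.1 (g * g) * (C * (((k : ℝ≥0∞) + 1) ^ 2 * coeff x.2 (X * (G' * G')))) := by
        gcongr
    _ = _ := by ring

variable {κ : ℝ} {a : R⟦X⟧} {w : B → R⟦X⟧}

theorem quadBounded_modulusRemainder (h : IsMajorantNorm b δ r) (hc : ∀ j, b 0 (c j) ≤ c₀)
    (ha : ∀ k, b k (coeff k a) ≤ coeff k β) (hw : ∀ i k, b k (coeff k (w i)) ≤ coeff k β)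
    (ha0 : b 0 (coeff 0 a) ≠ ∞) :
    QuadBounded b (fun k => coeff k (recursionMajorant β))
      (fun k => modulusRemainder c δ κ k a w) := by
  have hcj : ∀ j, b 0 (c j) ≠ ∞ := fun j => ne_top_of_le_ne_top ENNReal.coe_ne_top (hc j)
  have hca : ∀ j, b 0 (c j * coeff 0 a) ≠ ∞ := fun j =>
    ne_top_of_le_ne_top (ENNReal.mul_ne_top (hcj j) ha0) (h.const_mul_le _ _ _)
  have hP := fun j => h.modulusDeriv_le hc ha j
  have hδ : ∀ j, QuadBounded b (fun k => coeff k (recursionMajorant β))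
      (fun k => δ j (coeff k a)) := fun j => by
    simpa using h.quadBounded_smul_deriv (s := fun _ => 1) (by simp) ha j
  have hδ' : ∀ j, QuadBounded b (fun k => coeff k (recursionMajorant β))
      (fun k : ℕ => ((k : ℝ) + 1) • δ j (coeff k a)) := fun j =>
    h.quadBounded_smul_deriv (s := fun k => (k : ℝ) + 1)
      (fun k => (abs_of_nonneg (by positivity)).le) ha j
  unfold modulusRemainder
  refine h.quadBounded_sub (h.quadBounded_add
    (h.quadBounded_smul (h.quadBounded_sum fun j => h.quadBounded_add
      (h.quadBounded_smul (h.quadBounded_const_mul (hδ j) (hca j)) _)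
      (h.quadBounded_middleCoeff (hP j) (hP j))) _)
    (h.quadBounded_smul (h.quadBounded_add
      (h.quadBounded_const_mul (h.quadBounded_sum fun j => h.quadBounded_add ?_
        (h.quadBounded_deriv_of_le (hP j) j)) ha0)
      (h.quadBounded_middleCoeff' ha (h.second_deriv_le hc (n := fun k => k + 1) (by simp) hP
        (coeff_zero_modulusLaplacian c δ a) ?_))) _))
    (h.quadBounded_energy hc ha ha hw)
  · simpa only [mul_smul_comm] using h.quadBounded_const_mul (hδ' j) (hcj j)
  · intro k
    rw [coeff_succ_modulusLaplacian]
    push_cast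
    rfl

theorem quadBounded_directionRemainder (h : IsMajorantNorm b δ r) (hc : ∀ j, b 0 (c j) ≤ c₀)
    (ha : ∀ k, b k (coeff k a) ≤ coeff k β) (hw : ∀ i k, b k (coeff k (w i)) ≤ coeff k β)
    (ha0 : b 0 (coeff 0 a) ≠ ∞) (i : B) :
    QuadBounded b (fun k => coeff k (recursionMajorant β))
      (fun k => directionRemainder c δ κ k a w i) := by
  have hcj : ∀ j, b 0 (c j) ≠ ∞ := fun j => ne_top_of_le_ne_top ENNReal.coe_ne_top (hc j)
  have hca : ∀ j, b 0 (c j * coeff 0 a) ≠ ∞ := fun j =>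
    ne_top_of_le_ne_top (ENNReal.mul_ne_top (hcj j) ha0) (h.const_mul_le _ _ _)
  have hP := fun j => h.modulusDeriv_le hc ha j
  have hT := fun j => h.directionDeriv_le hc (hw i) j
  have hδ : ∀ j, QuadBounded b (fun k => coeff k (recursionMajorant β))
      (fun k => δ j (coeff k (w i))) := fun j => by
    simpa using h.quadBounded_smul_deriv (s := fun _ => 1) (by simp) (hw i) j
  have hδ' : ∀ j, QuadBounded b (fun k => coeff k (recursionMajorant β))
      (fun k : ℕ => (k : ℝ) • δ j (coeff k (w i))) := fun j =>
    h.quadBounded_smul_deriv (s := fun k => (k : ℝ)) (fun k => by simp) (hw i) j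
  unfold directionRemainder
  refine h.quadBounded_add (h.quadBounded_add
    (h.quadBounded_smul (h.quadBounded_sum fun j => h.quadBounded_add
      (h.quadBounded_const_mul (hδ j) (hca j))
      (h.quadBounded_middleCoeff (hP j) (hT j))) _)
    (h.quadBounded_add
      (h.quadBounded_const_mul (h.quadBounded_sum fun j => h.quadBounded_add ?_
        (h.quadBounded_deriv_of_le (hT j) j)) ha0)
      (h.quadBounded_middleCoeff' ha (h.second_deriv_le hc (n := fun k => k) (by simp) hT
        (coeff_zero_directionLaplacian c δ (w i)) ?_))))
    (h.quadBounded_energy hc ha (hw i) hw)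
  · simpa only [mul_smul_comm] using h.quadBounded_const_mul (hδ' j) (hcj j)
  · intro k
    rw [coeff_succ_directionLaplacian]

/-- The norms of the coefficients of the formal solution grow at most geometrically. -/
theorem exists_tsum_formal_solution_ne_top (h : IsMajorantNorm b δ r) {α : R} (hκ : 1 < κ)
    (hc : ∀ j, b 0 (c j) ≠ ∞) (hα : b 0 α ≠ ∞) (hV : ∀ i, b 0 (coeff 0 (w i)) ≠ ∞)
    (ha0 : coeff 0 a = α)
    (ha : ∀ k : ℕ, coeff (k + 1) a = -((κ - 1) / ((k + 2) * (k + 2 * κ - 1))) •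
        (α * modulusRemainder c δ κ k a w))
    (hw : ∀ (k : ℕ) (i : B), coeff (k + 1) (w i) = -(κ * (κ - 1) / ((k + 1) * (k + 2 * κ))) •
        (α * directionRemainder c δ κ k a w i)) :
    ∃ ε : ℝ≥0, 0 < ε ∧ ∑' k, (ε : ℝ≥0∞) ^ k * b k (coeff k a) ≠ ∞ ∧
      ∀ i, ∑' k, (ε : ℝ≥0∞) ^ k * b k (coeff k (w i)) ≠ ∞ := by
  set β : ℝ≥0∞⟦X⟧ := PowerSeries.mk fun k => b k (coeff k a) + ∑ i, b k (coeff k (w i)) with hβ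
  have haβ : ∀ k, b k (coeff k a) ≤ coeff k β := fun k => by
    rw [hβ, coeff_mk]
    exact le_self_add
  have hwβ : ∀ i k, b k (coeff k (w i)) ≤ coeff k β := fun i k => by
    rw [hβ, coeff_mk]
    exact (Finset.single_le_sum (f := fun i => b k (coeff k (w i))) (fun _ _ => zero_le)
      (Finset.mem_univ i)).trans le_add_self
  obtain ⟨c₀, hc₀⟩ : ∃ c₀ : ℝ≥0, ∀ j, b 0 (c j) ≤ c₀ := by
    refine ⟨∑ j, (b 0 (c j)).toNNReal, fun j => ?_⟩
    rw [← ENNReal.coe_toNNReal (hc j)]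
    exact_mod_cast Finset.single_le_sum (f := fun j => (b 0 (c j)).toNNReal)
      (fun _ _ => zero_le) (Finset.mem_univ j)
  have ha0' : b 0 (coeff 0 a) ≠ ∞ := ha0 ▸ hα
  obtain ⟨C₁, hC₁⟩ := h.quadBounded_const_mul
    (h.quadBounded_modulusRemainder (κ := κ) hc₀ haβ hwβ ha0') hα
  choose C₂ hC₂ using fun i => h.quadBounded_const_mul
    (h.quadBounded_directionRemainder (κ := κ) hc₀ haβ hwβ ha0' i) hα
  have hβ0 : coeff 0 β ≠ ∞ := by
    rw [hβ, coeff_mk]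
    exact ENNReal.add_ne_top.2 ⟨ha0', ENNReal.sum_ne_top.2 fun i _ => hV i⟩
  have hfac : ∀ (t : ℝ) (K : ℝ≥0) (k : ℕ), |t| * (k + 1) ^ 2 ≤ K →
      ENNReal.ofReal |t| * (((k : ℝ≥0∞) + 1) ^ 2) ≤ K := by
    intro t K k hK
    have : (((k : ℝ≥0∞) + 1) ^ 2) = ENNReal.ofReal (((k : ℝ) + 1) ^ 2) := by
      rw [ENNReal.ofReal_pow (by positivity), ENNReal.ofReal_add (by positivity) (by positivity)]
      simp
    rw [this, ← ENNReal.ofReal_mul (abs_nonneg _)]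
    exact ENNReal.ofReal_le_of_le_toReal hK
  set K : ℝ≥0 := Real.toNNReal (κ * (κ - 1)) with hK
  have hK0 : (0 : ℝ) ≤ κ * (κ - 1) := mul_nonneg (by linarith) (by linarith)
  have hstep : ∀ k, coeff (k + 1) β ≤ (K * C₁ + ∑ i, K * C₂ i : ℝ≥0) * coeff k (recursionMajorant β) := by
    intro k
    have hk : (0 : ℝ) ≤ k := by positivity
    have hβk : coeff (k + 1) β
        = b (k + 1) (coeff (k + 1) a) + ∑ i, b (k + 1) (coeff (k + 1) (w i)) := by
      rw [hβ, coeff_mk]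
    rw [hβk, ENNReal.coe_add, add_mul, ENNReal.ofNNReal_finsetSum, Finset.sum_mul]
    refine add_le_add ?_ (Finset.sum_le_sum fun i _ => ?_)
    · rw [ha]
      refine (h.smul_le _ _ _).trans ((mul_le_mul_right (hC₁ k) _).trans ?_)
      beta_reduce
      rw [mul_left_comm, ENNReal.coe_mul, mul_comm (K : ℝ≥0∞), mul_assoc,
        ← mul_assoc (ENNReal.ofReal _)]
      refine mul_le_mul_right (mul_le_mul_left (hfac _ _ _ ?_) _) _
      rw [hK, Real.coe_toNNReal _ hK0, abs_neg, abs_of_nonneg, div_mul_eq_mul_div, div_le_iff₀]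
      · have h1 : ((k : ℝ) + 1) ^ 2 ≤ (k + 2) * (k + 2 * κ - 1) := by nlinarith
        have h2 : (κ - 1) ≤ κ * (κ - 1) := by nlinarith
        exact mul_le_mul h2 h1 (by positivity) hK0
      · exact mul_pos (by linarith) (by linarith)
      · exact div_nonneg (by linarith) (mul_nonneg (by linarith) (by linarith))
    · rw [hw]
      refine (h.smul_le _ _ _).trans ((mul_le_mul_right (hC₂ i k) _).trans ?_)
      beta_reduce
      rw [mul_left_comm, ENNReal.coe_mul, mul_comm (K : ℝ≥0∞), mul_assoc,
        ← mul_assoc (ENNReal.ofReal _)]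
      refine mul_le_mul_right (mul_le_mul_left (hfac _ _ _ ?_) _) _
      rw [hK, Real.coe_toNNReal _ hK0, abs_neg, abs_of_nonneg, div_mul_eq_mul_div, div_le_iff₀]
      · have h1 : ((k : ℝ) + 1) ^ 2 ≤ (k + 1) * (k + 2 * κ) := by nlinarith
        exact mul_le_mul_of_nonneg_left h1 hK0
      · exact mul_pos (by linarith) (by linarith)
      · exact div_nonneg hK0 (mul_nonneg (by linarith) (by linarith))
  obtain ⟨ε, hε, hsum⟩ := exists_tsum_ne_top hβ0
    (G' := PowerSeries.mk (fun i => coeff (i + 1) ((1 + X) * ((1 + X) * β))))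
    (fun k => coeff_mk _ _) hstep
  refine ⟨ε, hε, ne_top_of_le_ne_top hsum (ENNReal.tsum_le_tsum fun k => ?_), fun i =>
    ne_top_of_le_ne_top hsum (ENNReal.tsum_le_tsum fun k => ?_)⟩
  · exact mul_le_mul_right (haβ k) _
  · exact mul_le_mul_right (hwβ i k) _

end IsMajorantNorm

end FormalEstimate

/-! ### Norms of jets of analytic germs -/

section JetNorm

open scoped ENNReal NNReal

variable {E : Type*} [NormedAddCommGroup E] [NormedSpace ℝ E] {p : E}

/-- The norm of the Taylor coefficient of order `n` of a germ. -/
noncomputable def jetNorm (n : ℕ) (x : AnGerm p) : ℝ≥0 :=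
  ‖iteratedFDeriv ℝ n (exists_germ_eq x).choose p‖₊ / n.factorial

theorem jetNorm_germ (n : ℕ) {f : E → ℝ} (hf : AnalyticAt ℝ f p) :
    jetNorm n (germ f hf) = ‖iteratedFDeriv ℝ n f p‖₊ / n.factorial := by
  have h := germ_eq_iff.1 (exists_germ_eq (germ f hf)).choose_spec.choose_spec
  rw [jetNorm, (h.iteratedFDeriv ℝ n).eq_of_nhds]

theorem jetNorm_zero (n : ℕ) : jetNorm n (0 : AnGerm p) = 0 := by
  rw [germ_zero, jetNorm_germ]
  have : iteratedFDeriv ℝ n (fun _ : E => (0 : ℝ)) p = 0 := by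
    rw [iteratedFDeriv_fun_zero]
    rfl
  rw [this]
  simp

theorem jetNorm_add_le (n : ℕ) (x y : AnGerm p) :
    jetNorm n (x + y) ≤ jetNorm n x + jetNorm n y := by
  obtain ⟨f, hf, rfl⟩ := exists_germ_eq x
  obtain ⟨g, hg, rfl⟩ := exists_germ_eq y
  rw [germ_add, jetNorm_germ, jetNorm_germ, jetNorm_germ, ← add_div]
  gcongr
  have : (fun x => f x + g x) = f + g := rfl
  rw [this, iteratedFDeriv_add_apply hf.contDiffAt hg.contDiffAt]
  exact nnnorm_add_le _ _

theorem jetNorm_smul (n : ℕ) (t : ℝ) (x : AnGerm p) :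
    jetNorm n (t • x) = ‖t‖₊ * jetNorm n x := by
  obtain ⟨f, hf, rfl⟩ := exists_germ_eq x
  rw [smul_germ, jetNorm_germ, jetNorm_germ, ← mul_div_assoc]
  have : (fun x => t * f x) = t • f := rfl
  rw [this, iteratedFDeriv_const_smul_apply hf.contDiffAt, nnnorm_smul]

theorem jetNorm_mul_le (n : ℕ) (x y : AnGerm p) :
    jetNorm n (x * y)
      ≤ ∑ ij ∈ Finset.HasAntidiagonal.antidiagonal n, jetNorm ij.1 x * jetNorm ij.2 y := by
  obtain ⟨f, hf, rfl⟩ := exists_germ_eq x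
  obtain ⟨g, hg, rfl⟩ := exists_germ_eq y
  rw [germ_mul, Finset.Nat.sum_antidiagonal_eq_sum_range_succ
    (fun i j => jetNorm i (germ f hf) * jetNorm j (germ g hg))]
  simp only [jetNorm_germ]
  obtain ⟨s, hs, hso, hps⟩ := eventually_nhds_iff.1
    (hf.eventually_analyticAt.and hg.eventually_analyticAt)
  have h := norm_iteratedFDerivWithin_mul_le (𝕜 := ℝ) (N := n) (n := n) (f := f) (g := g)
    (fun x hx => (hs x hx).1.contDiffAt.contDiffWithinAt)
    (fun x hx => (hs x hx).2.contDiffAt.contDiffWithinAt) hso.uniqueDiffOn hps le_rfl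
  simp only [iteratedFDerivWithin_of_isOpen _ hso hps] at h
  have h' : ‖iteratedFDeriv ℝ n (fun x => f x * g x) p‖₊
      ≤ ∑ i ∈ Finset.range (n + 1), (n.choose i : ℝ≥0) * ‖iteratedFDeriv ℝ i f p‖₊
        * ‖iteratedFDeriv ℝ (n - i) g p‖₊ := by
    rw [← NNReal.coe_le_coe]
    push_cast
    exact h
  rw [div_le_iff₀ (by positivity), Finset.sum_mul]
  refine h'.trans (Finset.sum_le_sum fun i hi => le_of_eq ?_)
  have hi' : i ≤ n := Nat.lt_succ_iff.1 (Finset.mem_range.1 hi)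
  have e : (n.factorial : ℝ≥0) = n.choose i * i.factorial * (n - i).factorial := by
    exact_mod_cast (Nat.choose_mul_factorial_mul_factorial hi').symm
  rw [e]
  have h1 : (i.factorial : ℝ≥0) ≠ 0 := by positivity
  have h2 : ((n - i).factorial : ℝ≥0) ≠ 0 := by positivity
  field_simp

theorem jetNorm_germDeriv_le (n : ℕ) (v : E) (x : AnGerm p) :
    jetNorm n (germDeriv p v x) ≤ ‖v‖₊ * ((n + 1) * jetNorm (n + 1) x) := by
  obtain ⟨f, hf, rfl⟩ := exists_germ_eq x
  rw [germDeriv_germ, jetNorm_germ, jetNorm_germ]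
  have h : ‖iteratedFDeriv ℝ n (fun z => fderiv ℝ f z v) p‖₊
      ≤ ‖v‖₊ * ‖iteratedFDeriv ℝ (n + 1) f p‖₊ := by
    have e : (fun z => fderiv ℝ f z v) = ContinuousLinearMap.apply ℝ ℝ v ∘ fderiv ℝ f := rfl
    rw [← NNReal.coe_le_coe, NNReal.coe_mul, coe_nnnorm, coe_nnnorm, coe_nnnorm,
      ← norm_iteratedFDeriv_fderiv, e,
      ContinuousLinearMap.iteratedFDeriv_comp_left _ (n := n) hf.fderiv.contDiffAt le_rfl]
    refine (ContinuousLinearMap.norm_compContinuousMultilinearMap_le _ _).trans ?_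
    gcongr
    refine ContinuousLinearMap.opNorm_le_bound _ (norm_nonneg _) fun L => ?_
    rw [mul_comm]
    exact L.le_opNorm v
  rw [div_le_iff₀ (by positivity)]
  refine h.trans (le_of_eq ?_)
  rw [Nat.factorial_succ]
  have : (n.factorial : ℝ≥0) ≠ 0 := by positivity
  push_cast
  field_simp

/-- The weighted sum of the norms of the jets of a germ, adapted to the coefficient of index `k` of
a power series in one more variable: the binomial weights are those for which the derivative of a
coefficient of index `k` is controlled, up to a factor `k + 1`, with the index `k + 1`. -/
noncomputable def majorantNorm (r : ℝ≥0) (k : ℕ) (x : AnGerm p) : ℝ≥0∞ :=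
  ∑' n : ℕ, ((r ^ n * jetNorm n x / (n + k).choose k : ℝ≥0) : ℝ≥0∞)

theorem choose_mul_choose_le (i j n m : ℕ) :
    (n + i).choose i * (m + j).choose j ≤ (n + m + (i + j)).choose (i + j) := by
  have h := Nat.add_choose_eq (n + i) (m + j) (i + j)
  have e : n + m + (i + j) = n + i + (m + j) := by ring
  rw [e, h]
  exact Finset.single_le_sum (f := fun ij : ℕ × ℕ => (n + i).choose ij.1 * (m + j).choose ij.2)
    (fun _ _ => Nat.zero_le _)
    (Finset.HasAntidiagonal.mem_antidiagonal.2 (rfl : ((i, j) : ℕ × ℕ).1 + (i, j).2 = i + j))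

theorem tsum_sum_antidiagonal_mul (f g : ℕ → ℝ≥0∞) :
    ∑' n, ∑ ij ∈ Finset.HasAntidiagonal.antidiagonal n, f ij.1 * g ij.2
      = (∑' n, f n) * ∑' n, g n := by
  have h : (∑' n, f n) * ∑' n, g n = ∑' x : ℕ × ℕ, f x.1 * g x.2 := by
    rw [ENNReal.tsum_prod', ← ENNReal.tsum_mul_right]
    simp only [ENNReal.tsum_mul_left]
  rw [h, ← Finset.HasAntidiagonal.sigmaAntidiagonalEquivProd.tsum_eq, ENNReal.tsum_sigma']
  refine tsum_congr fun n => ?_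
  rw [tsum_fintype, ← Finset.sum_coe_sort]
  rfl

theorem isMajorantNorm_majorantNorm {ι : Type*} [Fintype ι] {r : ℝ≥0} (hr : 0 < r) (v : ι → E) :
    IsMajorantNorm (majorantNorm (p := p) r) (fun j => germDeriv p (v j))
      (r⁻¹ * ∑ j, ‖v j‖₊) where
  zero k := by simp [majorantNorm, jetNorm_zero]
  add_le k x y := by
    rw [majorantNorm, majorantNorm, majorantNorm, ← ENNReal.tsum_add]
    refine ENNReal.tsum_le_tsum fun n => ?_
    rw [← ENNReal.coe_add, ← add_div, ← mul_add]
    gcongr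
    exact jetNorm_add_le _ _ _
  smul_le k t x := by
    rw [majorantNorm, majorantNorm, ← ENNReal.tsum_mul_left]
    refine ENNReal.tsum_le_tsum fun n => ?_
    rw [jetNorm_smul, ← Real.norm_eq_abs, ofReal_norm, enorm_eq_nnnorm, ← ENNReal.coe_mul,
      mul_left_comm, mul_div_assoc]
  mul_le i j x y := by
    rw [majorantNorm, majorantNorm, majorantNorm, ← tsum_sum_antidiagonal_mul]
    refine ENNReal.tsum_le_tsum fun n => ?_
    calc ((r ^ n * jetNorm n (x * y) / (n + (i + j)).choose (i + j) : ℝ≥0) : ℝ≥0∞)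
        ≤ ((r ^ n * (∑ kl ∈ Finset.HasAntidiagonal.antidiagonal n, jetNorm kl.1 x * jetNorm kl.2 y)
          / (n + (i + j)).choose (i + j) : ℝ≥0) : ℝ≥0∞) := by
          gcongr
          exact jetNorm_mul_le _ _ _
      _ = ∑ kl ∈ Finset.HasAntidiagonal.antidiagonal n,
          ((r ^ n * (jetNorm kl.1 x * jetNorm kl.2 y) / (n + (i + j)).choose (i + j) : ℝ≥0)
            : ℝ≥0∞) := by
          rw [← ENNReal.ofNNReal_finsetSum, Finset.mul_sum, Finset.sum_div]
      _ ≤ _ := by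
          refine Finset.sum_le_sum fun kl hkl => ?_
          rw [← ENNReal.coe_mul, ENNReal.coe_le_coe, div_mul_div_comm]
          have hn := Finset.HasAntidiagonal.mem_antidiagonal.1 hkl
          have e : r ^ n * (jetNorm kl.1 x * jetNorm kl.2 y)
              = r ^ kl.1 * jetNorm kl.1 x * (r ^ kl.2 * jetNorm kl.2 y) := by
            rw [← hn, pow_add]
            ring
          rw [e]
          refine div_le_div_of_nonneg_left zero_le ?_ ?_
          · have h1 : 0 < (kl.1 + i).choose i := Nat.choose_pos (by lia)
            have h2 : 0 < (kl.2 + j).choose j := Nat.choose_pos (by lia)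
            positivity
          · rw [← hn]
            exact_mod_cast choose_mul_choose_le i j kl.1 kl.2
  deriv_le k j x := by
    have hterm : ∀ n : ℕ, ((r ^ n * jetNorm n (germDeriv p (v j) x) / (n + (k + 1)).choose (k + 1)
        : ℝ≥0) : ℝ≥0∞) ≤ ((r⁻¹ * (∑ j, ‖v j‖₊) : ℝ≥0) : ℝ≥0∞) * (k + 1)
          * ((r ^ (n + 1) * jetNorm (n + 1) x / (n + 1 + k).choose k : ℝ≥0) : ℝ≥0∞) := by
      intro n
      have hv : ‖v j‖₊ ≤ ∑ j, ‖v j‖₊ :=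
        Finset.single_le_sum (f := fun j => ‖v j‖₊) (fun _ _ => zero_le) (Finset.mem_univ j)
      have hch : (n + (k + 1)).choose (k + 1) * (k + 1) = (n + 1 + k).choose k * (n + 1) := by
        have := Nat.choose_succ_right_eq (n + (k + 1)) k
        rw [this]
        congr 2 <;> lia
      have hch' : ((n + (k + 1)).choose (k + 1) : ℝ≥0) * (k + 1)
          = ((n + 1 + k).choose k : ℝ≥0) * (n + 1) := by exact_mod_cast hch
      have h1 : 0 < ((n + (k + 1)).choose (k + 1) : ℝ≥0) := by
        exact_mod_cast Nat.choose_pos (by lia)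
      have h2 : 0 < ((n + 1 + k).choose k : ℝ≥0) := by exact_mod_cast Nat.choose_pos (by lia)
      have key : r ^ n * jetNorm n (germDeriv p (v j) x) / (n + (k + 1)).choose (k + 1)
          ≤ (r⁻¹ * (∑ j, ‖v j‖₊)) * (k + 1)
            * (r ^ (n + 1) * jetNorm (n + 1) x / (n + 1 + k).choose k) := by
        calc _ ≤ r ^ n * ((∑ j, ‖v j‖₊) * ((n + 1) * jetNorm (n + 1) x))
              / (n + (k + 1)).choose (k + 1) := by
              gcongr
              exact (jetNorm_germDeriv_le _ _ _).trans (by gcongr)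
          _ = _ := by
              rw [div_eq_iff h1.ne', pow_succ]
              have : (r⁻¹ * (∑ j, ‖v j‖₊)) * (k + 1)
                  * (r ^ n * r * jetNorm (n + 1) x / (n + 1 + k).choose k)
                  * ((n + (k + 1)).choose (k + 1) : ℝ≥0)
                  = (r⁻¹ * r) * (∑ j, ‖v j‖₊) * r ^ n * jetNorm (n + 1) x
                    * (((n + (k + 1)).choose (k + 1) : ℝ≥0) * (k + 1))
                    / (n + 1 + k).choose k := by ring
              rw [this, hch', inv_mul_cancel₀ hr.ne']
              field_simp
      exact_mod_cast key
    rw [majorantNorm, majorantNorm]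
    calc _ ≤ ∑' n : ℕ, ((r⁻¹ * (∑ j, ‖v j‖₊) : ℝ≥0) : ℝ≥0∞) * (k + 1)
          * ((r ^ (n + 1) * jetNorm (n + 1) x / (n + 1 + k).choose k : ℝ≥0) : ℝ≥0∞) :=
          ENNReal.tsum_le_tsum hterm
      _ ≤ _ := by
          rw [ENNReal.tsum_mul_left]
          exact mul_le_mul_right (ENNReal.tsum_comp_le_tsum_of_injective (add_left_injective 1)
            fun n => ((r ^ n * jetNorm n x / (n + k).choose k : ℝ≥0) : ℝ≥0∞)) _

theorem nnnorm_iteratedFDeriv_le_of_hasFPowerSeriesOnBall {f : E → ℝ}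
    {q : FormalMultilinearSeries ℝ E ℝ} {s : ℝ≥0∞} (h : HasFPowerSeriesOnBall f q p s) (n : ℕ) :
    ‖iteratedFDeriv ℝ n f p‖₊ ≤ n.factorial * ‖q n‖₊ := by
  rw [← NNReal.coe_le_coe]
  push_cast
  refine ContinuousMultilinearMap.opNorm_le_bound (by positivity) fun m => ?_
  rw [h.iteratedFDeriv_eq_sum_of_completeSpace]
  calc ‖∑ σ : Equiv.Perm (Fin n), q n (fun i => m (σ i))‖
      ≤ ∑ σ : Equiv.Perm (Fin n), ‖q n‖ * ∏ i, ‖m i‖ := by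
        refine norm_sum_le_of_le _ fun σ _ => ?_
        refine ((q n).le_opNorm _).trans (le_of_eq ?_)
        rw [Equiv.prod_comp σ (fun i => ‖m i‖)]
    _ = _ := by
        rw [Finset.sum_const, Finset.card_univ, Fintype.card_perm, Fintype.card_fin, nsmul_eq_mul,
          mul_assoc]

theorem eventually_majorantNorm_ne_top (x : AnGerm p) :
    ∀ᶠ r : ℝ≥0 in 𝓝[>] 0, majorantNorm r 0 x ≠ ∞ := by
  obtain ⟨f, hf, rfl⟩ := exists_germ_eq x
  obtain ⟨q, s, h⟩ := id hf
  obtain ⟨t, ht0, hts⟩ := ENNReal.lt_iff_exists_nnreal_btwn.1 h.r_pos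
  have ht0' : 0 < t := by exact_mod_cast ht0
  filter_upwards [Ioo_mem_nhdsGT ht0'] with r hr
  have hrad : (r : ℝ≥0∞) < q.radius :=
    (ENNReal.coe_lt_coe.2 hr.2).trans (hts.trans_le h.r_le)
  have hs := q.summable_nnnorm_mul_pow hrad
  refine ne_top_of_le_ne_top (ENNReal.tsum_coe_ne_top_iff_summable.2 hs)
    (ENNReal.tsum_le_tsum fun n => ?_)
  rw [ENNReal.coe_le_coe, jetNorm_germ, add_zero, Nat.choose_zero_right, Nat.cast_one, div_one,
    mul_comm]
  gcongr
  rw [div_le_iff₀ (by positivity), mul_comm]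
  exact nnnorm_iteratedFDeriv_le_of_hasFPowerSeriesOnBall h n

end JetNorm

/-! ### Convergent power series with coefficients in a ring of germs -/

section Convergence

open scoped ENNReal NNReal
open PowerSeries

variable {E : Type*} [NormedAddCommGroup E] [NormedSpace ℝ E] {p : E}

/-- A germ all of whose iterated directional derivatives vanish at the base point is zero. -/
theorem eq_zero_of_forall_germDeriv_mem (K : Set (AnGerm p))
    (hK : ∀ x ∈ K, ∀ v, germDeriv p v x ∈ K)
    (h0 : ∀ (f : E → ℝ) (hf : AnalyticAt ℝ f p), germ f hf ∈ K → f p = 0)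
    {x : AnGerm p} (hx : x ∈ K) : x = 0 := by
  have key : ∀ (n : ℕ) (f : E → ℝ) (hf : AnalyticAt ℝ f p), germ f hf ∈ K →
      iteratedFDeriv ℝ n f p = 0 := by
    intro n
    induction n with
    | zero =>
      intro f hf hK'
      ext m
      rw [iteratedFDeriv_zero_apply, h0 f hf hK']
      rfl
    | succ n ih =>
      intro f hf hK'
      ext m
      rw [iteratedFDeriv_succ_apply_right]
      have h1 := ih (fun z => fderiv ℝ f z (m (Fin.last n))) (analyticAt_fderiv_apply hf _)
        (by rw [← germDeriv_germ]; exact hK _ hK' _)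
      have e : (fun z => fderiv ℝ f z (m (Fin.last n)))
          = ContinuousLinearMap.apply ℝ ℝ (m (Fin.last n)) ∘ fderiv ℝ f := rfl
      rw [e, ContinuousLinearMap.iteratedFDeriv_comp_left _ (n := n) hf.fderiv.contDiffAt le_rfl]
        at h1
      have h2 := congrArg (fun L => L (Fin.init m)) h1
      exact h2
  obtain ⟨f, hf, rfl⟩ := exists_germ_eq x
  obtain ⟨q, s, h⟩ := id hf
  rw [germ_zero, germ_eq_iff]
  have hs : ∀ᶠ z in 𝓝 p, z - p ∈ Metric.eball (0 : E) s := by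
    have : Tendsto (fun z => z - p) (𝓝 p) (𝓝 0) := by
      have := (continuous_sub_right p).tendsto p
      rwa [sub_self] at this
    exact this (Metric.eball_mem_nhds _ h.r_pos)
  filter_upwards [hs] with z hz
  have h1 := h.hasSum_iteratedFDeriv hz
  simp only [key _ f hf hx] at h1
  rw [add_sub_cancel] at h1
  refine h1.unique ?_
  convert hasSum_zero with n
  simp

variable {Y : Type*} [NormedAddCommGroup Y] [NormedSpace ℝ Y]

/-- The Taylor coefficient of order `n` of a germ at the origin. -/
noncomputable def jetAtZero (x : AnGerm (0 : Y)) (n : ℕ) : Y [×n]→L[ℝ] ℝ :=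
  ((n.factorial : ℝ)⁻¹) • iteratedFDeriv ℝ n (exists_germ_eq x).choose 0

theorem nnnorm_jetAtZero (x : AnGerm (0 : Y)) (n : ℕ) : ‖jetAtZero x n‖₊ = jetNorm n x := by
  rw [jetAtZero, jetNorm, nnnorm_smul, nnnorm_inv, div_eq_inv_mul]
  simp

theorem eventually_hasSum_jetAtZero {f : Y → ℝ} (hf : AnalyticAt ℝ f 0) :
    ∀ᶠ y in 𝓝 (0 : Y), HasSum (fun n => jetAtZero (germ f hf) n fun _ => y) (f y) := by
  have h := germ_eq_iff.1 (exists_germ_eq (germ f hf)).choose_spec.choose_spec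
  obtain ⟨q, s, hq⟩ := id hf
  filter_upwards [Metric.eball_mem_nhds _ hq.r_pos] with y hy
  have h1 := hq.hasSum_iteratedFDeriv hy
  rw [zero_add] at h1
  have e : ∀ n, (jetAtZero (germ f hf) n fun _ => y)
      = ((n.factorial : ℝ)⁻¹) • iteratedFDeriv ℝ n f 0 fun _ => y := by
    intro n
    unfold jetAtZero
    rw [(h.iteratedFDeriv ℝ n).eq_of_nhds]
    rfl
  simpa only [e] using h1

/-- The formal multilinear series on `ℝ × Y` of `∑ tᵏ aₖ(y)`, defined through the relation
`F = a₀ + t F'`, where `F'` corresponds to the shifted sequence. -/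
noncomputable def sumSeries : (n : ℕ) → (ℕ → AnGerm (0 : Y)) → (ℝ × Y) [×n]→L[ℝ] ℝ
  | 0, a => (jetAtZero (a 0) 0).compContinuousLinearMap fun _ => ContinuousLinearMap.snd ℝ ℝ Y
  | n + 1, a =>
    ((jetAtZero (a 0) (n + 1)).compContinuousLinearMap fun _ => ContinuousLinearMap.snd ℝ ℝ Y)
      + ContinuousLinearMap.uncurryLeft (Ei := fun _ : Fin (n + 1) => ℝ × Y)
        ((ContinuousLinearMap.fst ℝ ℝ Y).smulRight (sumSeries n fun k => a (k + 1)))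

theorem sumSeries_zero_apply (a : ℕ → AnGerm (0 : Y)) (z : ℝ × Y) :
    sumSeries 0 a (fun _ => z) = jetAtZero (a 0) 0 fun _ => z.2 := rfl

theorem sumSeries_succ_apply (n : ℕ) (a : ℕ → AnGerm (0 : Y)) (z : ℝ × Y) :
    sumSeries (n + 1) a (fun _ => z) = (jetAtZero (a 0) (n + 1) fun _ => z.2)
      + z.1 * sumSeries n (fun k => a (k + 1)) fun _ => z := rfl

theorem nnnorm_compContinuousLinearMap_snd_le {n : ℕ} (q : Y [×n]→L[ℝ] ℝ) :
    ‖q.compContinuousLinearMap fun _ => ContinuousLinearMap.snd ℝ ℝ Y‖₊ ≤ ‖q‖₊ := by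
  rw [← NNReal.coe_le_coe]
  refine (ContinuousMultilinearMap.norm_compContinuousLinearMap_le _ _).trans ?_
  refine mul_le_of_le_one_right (norm_nonneg _) (Finset.prod_le_one (fun _ _ => norm_nonneg _) ?_)
  exact fun _ _ => ContinuousLinearMap.norm_snd_le ℝ ℝ Y

theorem nnnorm_sumSeries_le (n : ℕ) (a : ℕ → AnGerm (0 : Y)) :
    ‖sumSeries n a‖₊ ≤ ∑ k ∈ Finset.range (n + 1), jetNorm (n - k) (a k) := by
  induction n generalizing a with
  | zero =>
    rw [Finset.sum_range_one, ← nnnorm_jetAtZero]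
    exact nnnorm_compContinuousLinearMap_snd_le _
  | succ n ih =>
    rw [Finset.sum_range_succ']
    have h0 : ‖sumSeries (n + 1) a‖₊
        ≤ ‖(jetAtZero (a 0) (n + 1)).compContinuousLinearMap
            fun _ => ContinuousLinearMap.snd ℝ ℝ Y‖₊
          + ‖ContinuousLinearMap.uncurryLeft (Ei := fun _ : Fin (n + 1) => ℝ × Y)
            ((ContinuousLinearMap.fst ℝ ℝ Y).smulRight (sumSeries n fun k => a (k + 1)))‖₊ := by
      rw [sumSeries]
      exact nnnorm_add_le _ _
    refine (h0.trans (add_le_add ?_ ?_)).trans (add_comm _ _).le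
    · rw [← nnnorm_jetAtZero]
      exact nnnorm_compContinuousLinearMap_snd_le _
    · have h1 : ‖ContinuousLinearMap.uncurryLeft (Ei := fun _ : Fin (n + 1) => ℝ × Y)
          ((ContinuousLinearMap.fst ℝ ℝ Y).smulRight (sumSeries n fun k => a (k + 1)))‖₊
          ≤ ‖sumSeries n fun k => a (k + 1)‖₊ := by
        rw [← NNReal.coe_le_coe, coe_nnnorm, coe_nnnorm, ContinuousLinearMap.uncurryLeft_norm,
          ContinuousLinearMap.norm_smulRight_apply]
        exact mul_le_of_le_one_left (norm_nonneg _) (ContinuousLinearMap.norm_fst_le ℝ ℝ Y)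
      refine h1.trans ((ih _).trans (le_of_eq (Finset.sum_congr rfl fun k _ => ?_)))
      rw [Nat.add_sub_add_right]

/-- The sum of the series `∑ tᵏ aₖ(y)`. -/
noncomputable def sumFun (a : ℕ → AnGerm (0 : Y)) : ℝ × Y → ℝ :=
  FormalMultilinearSeries.sum (𝕜 := ℝ) fun n => sumSeries n a

theorem hasFPowerSeriesOnBall_sumFun {a : ℕ → AnGerm (0 : Y)} {r : ℝ≥0} (hr : 0 < r)
    (ha : ∑' k, (r : ℝ≥0∞) ^ k * ∑' n, ((r ^ n * jetNorm n (a k) : ℝ≥0) : ℝ≥0∞) ≠ ∞) :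
    ∃ s : ℝ≥0∞, (r : ℝ≥0∞) ≤ s ∧
      HasFPowerSeriesOnBall (sumFun a) (fun n => sumSeries n a) (0 : ℝ × Y) s := by
  set S := ∑' k, (r : ℝ≥0∞) ^ k * ∑' n, ((r ^ n * jetNorm n (a k) : ℝ≥0) : ℝ≥0∞) with hS
  have hrad : (r : ℝ≥0∞) ≤ FormalMultilinearSeries.radius (𝕜 := ℝ) fun n => sumSeries n a := by
    refine FormalMultilinearSeries.le_radius_of_bound_nnreal _ S.toNNReal fun n => ?_
    rw [← ENNReal.coe_le_coe, ENNReal.coe_toNNReal ha]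
    calc ((‖sumSeries n a‖₊ * r ^ n : ℝ≥0) : ℝ≥0∞)
        ≤ (((∑ k ∈ Finset.range (n + 1), jetNorm (n - k) (a k)) * r ^ n : ℝ≥0) : ℝ≥0∞) := by
          gcongr
          exact nnnorm_sumSeries_le n a
      _ = ∑ k ∈ Finset.range (n + 1),
          (r : ℝ≥0∞) ^ k * ((r ^ (n - k) * jetNorm (n - k) (a k) : ℝ≥0) : ℝ≥0∞) := by
          rw [Finset.sum_mul, ENNReal.ofNNReal_finsetSum]
          refine Finset.sum_congr rfl fun k hk => ?_
          have hk' : k ≤ n := Nat.lt_succ_iff.1 (Finset.mem_range.1 hk)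
          rw [← ENNReal.coe_pow, ← ENNReal.coe_mul, ENNReal.coe_inj, ← mul_assoc, ← pow_add,
            Nat.add_sub_cancel' hk', mul_comm]
      _ ≤ ∑ k ∈ Finset.range (n + 1),
          (r : ℝ≥0∞) ^ k * ∑' n, ((r ^ n * jetNorm n (a k) : ℝ≥0) : ℝ≥0∞) := by
          refine Finset.sum_le_sum fun k _ => mul_le_mul_right ?_ _
          exact ENNReal.le_tsum (f := fun n => ((r ^ n * jetNorm n (a k) : ℝ≥0) : ℝ≥0∞)) (n - k)
      _ ≤ S := ENNReal.sum_le_tsum _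
  refine ⟨_, hrad, FormalMultilinearSeries.hasFPowerSeriesOnBall _ (lt_of_lt_of_le ?_ hrad)⟩
  exact_mod_cast hr

theorem tsum_shift_ne_top {a : ℕ → AnGerm (0 : Y)} {r : ℝ≥0} (hr : 0 < r)
    (ha : ∑' k, (r : ℝ≥0∞) ^ k * ∑' n, ((r ^ n * jetNorm n (a k) : ℝ≥0) : ℝ≥0∞) ≠ ∞) :
    ∑' k, (r : ℝ≥0∞) ^ k * ∑' n, ((r ^ n * jetNorm n (a (k + 1)) : ℝ≥0) : ℝ≥0∞) ≠ ∞ := by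
  have h1 : (r : ℝ≥0∞)
      * ∑' k, (r : ℝ≥0∞) ^ k * ∑' n, ((r ^ n * jetNorm n (a (k + 1)) : ℝ≥0) : ℝ≥0∞) ≠ ∞ := by
    rw [← ENNReal.tsum_mul_left]
    refine ne_top_of_le_ne_top ha ?_
    refine le_trans (le_of_eq (tsum_congr fun k => ?_))
      (ENNReal.tsum_comp_le_tsum_of_injective (add_left_injective 1)
        fun k => (r : ℝ≥0∞) ^ k * ∑' n, ((r ^ n * jetNorm n (a k) : ℝ≥0) : ℝ≥0∞))
    rw [← mul_assoc, pow_succ']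
  intro h
  refine h1 ?_
  rw [h, ENNReal.mul_top]
  exact_mod_cast hr.ne'

/-- The relation `F(t, y) = a₀(y) + t F'(t, y)`. -/
theorem sumFun_eventuallyEq {a : ℕ → AnGerm (0 : Y)} {r : ℝ≥0} (hr : 0 < r)
    (ha : ∑' k, (r : ℝ≥0∞) ^ k * ∑' n, ((r ^ n * jetNorm n (a k) : ℝ≥0) : ℝ≥0∞) ≠ ∞)
    {f : Y → ℝ} {hf : AnalyticAt ℝ f 0} (h : a 0 = germ f hf) :
    ∀ᶠ z in 𝓝 (0 : ℝ × Y), sumFun a z = f z.2 + z.1 * sumFun (fun k => a (k + 1)) z := by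
  obtain ⟨s, hs, h1⟩ := hasFPowerSeriesOnBall_sumFun hr ha
  obtain ⟨s', hs', h2⟩ := hasFPowerSeriesOnBall_sumFun hr (tsum_shift_ne_top hr ha)
  have h3 : Tendsto (fun z : ℝ × Y => z.2) (𝓝 0) (𝓝 0) := continuous_snd.tendsto 0
  filter_upwards [Metric.eball_mem_nhds (0 : ℝ × Y) h1.r_pos,
    Metric.eball_mem_nhds (0 : ℝ × Y) h2.r_pos, h3.eventually (eventually_hasSum_jetAtZero hf)]
    with z hz1 hz2 hz3
  have e1 := h1.hasSum hz1
  have e2 := (h2.hasSum hz2).mul_left z.1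
  rw [zero_add] at e1 e2
  rw [← h] at hz3
  rw [← hasSum_nat_add_iff' 1] at e1 hz3
  have e3 := hz3.add e2
  simp only [← sumSeries_succ_apply] at e3
  have e4 := e1.unique e3
  rw [Finset.sum_range_one, Finset.sum_range_one, sumSeries_zero_apply] at e4
  linarith

theorem analyticAt_zero_mk : AnalyticAt ℝ (fun y : Y => ((0 : ℝ), y)) 0 :=
  analyticAt_const.prod analyticAt_id

/-- Taylor expansion in the first variable of germs at the origin of `ℝ × Y`. -/
noncomputable def firstVariableTaylorHom (Y : Type*) [NormedAddCommGroup Y] [NormedSpace ℝ Y] :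
    AnGerm (0 : ℝ × Y) →ₐ[ℝ] (AnGerm (0 : Y))⟦X⟧ :=
  taylorHom (germPullback (fun y : Y => ((0 : ℝ), y)) analyticAt_zero_mk rfl)
    (germDeriv 0 ((1 : ℝ), (0 : Y)))

theorem firstVariableTaylorHom_snd {f : Y → ℝ} (hf : AnalyticAt ℝ f 0)
    (hf' : AnalyticAt ℝ (fun z : ℝ × Y => f z.2) 0) :
    firstVariableTaylorHom Y (germ (fun z => f z.2) hf') = C (germ f hf) := by
  have h0 : germDeriv 0 ((1 : ℝ), (0 : Y)) (germ (fun z => f z.2) hf') = 0 := by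
    rw [germDeriv_germ, germ_zero, germ_eq_iff]
    have h3 : Tendsto (fun z : ℝ × Y => z.2) (𝓝 0) (𝓝 0) := continuous_snd.tendsto 0
    filter_upwards [h3.eventually hf.eventually_analyticAt] with z hz
    have := (hz.differentiableAt.hasFDerivAt.comp z hasFDerivAt_snd).fderiv
    simp only [Function.comp_def] at this
    rw [this]
    simp
  ext k
  rw [firstVariableTaylorHom, coeff_taylorHom, coeff_C]
  cases k with
  | zero =>
    simp only [Nat.factorial_zero, Nat.cast_one, inv_one, one_smul, Function.iterate_zero, id,
      if_true]
    rfl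
  | succ k =>
    rw [Function.iterate_succ_apply, h0, iterate_map_zero]
    simp

theorem firstVariableTaylorHom_fst (h : AnalyticAt ℝ (fun z : ℝ × Y => z.1) 0) :
    firstVariableTaylorHom Y (germ (fun z => z.1) h) = X := by
  have h0 : germDeriv 0 ((1 : ℝ), (0 : Y)) (germ (fun z => z.1) h) = 1 := by
    rw [germDeriv_germ, germ_one, germ_eq_iff]
    refine Eventually.of_forall fun z => ?_
    have := (hasFDerivAt_fst (𝕜 := ℝ) (p := z)).fderiv
    change fderiv ℝ Prod.fst z _ = _
    rw [this]
    rfl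
  ext k
  rw [firstVariableTaylorHom, coeff_taylorHom, coeff_X]
  match k with
  | 0 => simp [germPullback_germ, germ_zero]
  | 1 => simp [h0]
  | k + 2 =>
    rw [Function.iterate_succ_apply, h0, Function.iterate_succ_apply, Derivation.map_one_eq_zero,
      iterate_map_zero]
    simp

theorem coeff_firstVariableTaylorHom_sumFun (k : ℕ) {a : ℕ → AnGerm (0 : Y)} {r : ℝ≥0}
    (hr : 0 < r)
    (ha : ∑' k, (r : ℝ≥0∞) ^ k * ∑' n, ((r ^ n * jetNorm n (a k) : ℝ≥0) : ℝ≥0∞) ≠ ∞)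
    (h : AnalyticAt ℝ (sumFun a) 0) :
    coeff k (firstVariableTaylorHom Y (germ (sumFun a) h)) = a k := by
  obtain ⟨f, hf, hfa⟩ := exists_germ_eq (a 0)
  have hf' : AnalyticAt ℝ (fun z : ℝ × Y => f z.2) 0 :=
    AnalyticAt.fun_comp (g := f) (f := fun z : ℝ × Y => z.2) hf analyticAt_snd
  have hsh : AnalyticAt ℝ (sumFun fun k => a (k + 1)) 0 := by
    obtain ⟨s, -, hs⟩ := hasFPowerSeriesOnBall_sumFun hr (tsum_shift_ne_top hr ha)
    exact hs.analyticAt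
  have e : germ (sumFun a) h = germ (fun z => f z.2) hf'
      + germ (fun z => z.1) analyticAt_fst * germ _ hsh := by
    rw [germ_mul, germ_add, germ_eq_iff]
    exact sumFun_eventuallyEq hr ha hfa.symm
  induction k generalizing a f with
  | zero =>
    rw [e, map_add, map_mul, firstVariableTaylorHom_snd hf, firstVariableTaylorHom_fst]
    simp [hfa]
  | succ k ih =>
    rw [e, map_add, map_mul, firstVariableTaylorHom_snd hf, firstVariableTaylorHom_fst, map_add,
      coeff_succ_X_mul, coeff_C, if_neg k.succ_ne_zero, zero_add]
    obtain ⟨f', hf', hfa'⟩ := exists_germ_eq (a 1)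
    have hsh' : AnalyticAt ℝ (sumFun fun k => a (k + 1 + 1)) 0 := by
      obtain ⟨s, -, hs⟩ := hasFPowerSeriesOnBall_sumFun hr
        (tsum_shift_ne_top hr (tsum_shift_ne_top hr ha))
      exact hs.analyticAt
    have hf'' : AnalyticAt ℝ (fun z : ℝ × Y => f' z.2) 0 :=
      AnalyticAt.fun_comp (g := f') (f := fun z : ℝ × Y => z.2) hf' analyticAt_snd
    refine ih (tsum_shift_ne_top hr ha) hsh f' hf' hfa' hf'' hsh' ?_
    rw [germ_mul, germ_add, germ_eq_iff]
    exact sumFun_eventuallyEq hr (tsum_shift_ne_top hr ha) hfa'.symm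

/-- A power series with coefficients in the ring of germs is the Taylor expansion of a germ if it
converges in the sense of the majorant norms. -/
theorem exists_firstVariableTaylorHom_eq {F : (AnGerm (0 : Y))⟦X⟧} {R ε : ℝ≥0} (hR : 0 < R)
    (hε : 0 < ε) (h : ∑' k, (ε : ℝ≥0∞) ^ k * majorantNorm R k (coeff k F) ≠ ∞) :
    ∃ x, firstVariableTaylorHom Y x = F := by
  set r : ℝ≥0 := min ε R / 2 with hr_def
  have hr : 0 < r := by positivity
  have ha : ∑' k, (r : ℝ≥0∞) ^ k * ∑' n, ((r ^ n * jetNorm n (coeff k F) : ℝ≥0) : ℝ≥0∞) ≠ ∞ := by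
    refine ne_top_of_le_ne_top h (ENNReal.tsum_le_tsum fun k => ?_)
    rw [majorantNorm, ← ENNReal.tsum_mul_left, ← ENNReal.tsum_mul_left]
    refine ENNReal.tsum_le_tsum fun n => ?_
    rw [← ENNReal.coe_pow, ← ENNReal.coe_pow, ← ENNReal.coe_mul, ← ENNReal.coe_mul,
      ENNReal.coe_le_coe]
    have hch : ((n + k).choose k : ℝ≥0) ≤ 2 ^ (n + k) := by
      exact_mod_cast Nat.choose_le_two_pow _ _
    have hch0 : 0 < ((n + k).choose k : ℝ≥0) := by exact_mod_cast Nat.choose_pos (by lia)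
    have h1 : r * 2 ≤ ε := by rw [hr_def, div_mul_cancel₀ _ two_ne_zero]; exact min_le_left _ _
    have h2 : r * 2 ≤ R := by rw [hr_def, div_mul_cancel₀ _ two_ne_zero]; exact min_le_right _ _
    rw [← mul_div_assoc, le_div_iff₀ hch0]
    calc r ^ k * (r ^ n * jetNorm n (coeff k F)) * ((n + k).choose k : ℝ≥0)
        ≤ r ^ k * (r ^ n * jetNorm n (coeff k F)) * 2 ^ (n + k) := by gcongr
      _ = (r * 2) ^ k * ((r * 2) ^ n * jetNorm n (coeff k F)) := by
          rw [mul_pow, mul_pow, pow_add]; ring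
      _ ≤ _ := by gcongr
  obtain ⟨s, -, hs⟩ := hasFPowerSeriesOnBall_sumFun (a := fun k => coeff k F) hr ha
  refine ⟨germ _ hs.analyticAt, ?_⟩
  ext k
  exact coeff_firstVariableTaylorHom_sumFun k hr ha hs.analyticAt

end Convergence

/-! ### The polar form of the system and unit directions -/

section UnitDirection

open PowerSeries

variable {A R : Type*} [CommRing A] [Algebra ℝ A] [CommRing R] [Algebra ℝ R]
  {ι B : Type*} [Fintype ι] [Fintype B]

/-- The component of index `b` of `ρ ^ (2 - κ) Δ (ρ ^ κ w)`, expanded. -/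
def polarOp (D : ι → A → A) (κ : ℝ) (ρ : A) (w : B → A) (b : B) : A :=
  ((κ * (κ - 1)) • ∑ j, D j ρ ^ 2 + κ • (ρ * ∑ j, D j (D j ρ))) * w b
    + (2 * κ) • (ρ * ∑ j, D j ρ * D j (w b)) + ρ ^ 2 * ∑ j, D j (D j (w b))

theorem polarOp_eq (D : ι → A → A) (κ : ℝ) (ρ : A) (w : B → A) (b : B) :
    polarOp D κ ρ w b = modulusOp D κ ρ w * w b + ρ * directionOp D κ ρ w b := by
  simp only [polarOp, modulusOp, directionOp, Algebra.smul_def]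
  ring

variable (d : ι → Derivation ℝ A A)

theorem derivation_sum_sq (d : Derivation ℝ A A) (w : B → A) :
    d (∑ b, w b ^ 2) = 2 * ∑ b, w b * d (w b) := by
  rw [map_sum, Finset.mul_sum]
  refine Finset.sum_congr rfl fun b _ => ?_
  rw [Derivation.leibniz_pow]
  simp only [nsmul_eq_mul, smul_eq_mul]
  push_cast
  ring

theorem derivation_derivation_sum_sq (d : Derivation ℝ A A) (w : B → A) :
    d (d (∑ b, w b ^ 2)) = 2 * ∑ b, (w b * d (d (w b)) + d (w b) ^ 2) := by
  have h2 : d (2 : A) = 0 := by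
    have : (2 : A) = algebraMap ℝ A 2 := (map_ofNat _ 2).symm
    rw [this, Derivation.map_algebraMap]
  rw [derivation_sum_sq, Derivation.leibniz, h2, smul_zero, add_zero, smul_eq_mul, map_sum]
  congr 1
  refine Finset.sum_congr rfl fun b _ => ?_
  rw [Derivation.leibniz]
  simp only [smul_eq_mul]
  ring

theorem sum_sum_derivation_sq (w : B → A) :
    ∑ j, d j (d j (∑ b, w b ^ 2))
      = 2 * (∑ b, w b * ∑ j, d j (d j (w b)) + energyDensity (fun j => d j) w) := by
  simp only [derivation_derivation_sum_sq, energyDensity]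
  rw [← Finset.mul_sum, ← Finset.sum_add_distrib, Finset.sum_comm]
  congr 1
  refine Finset.sum_congr rfl fun b _ => ?_
  rw [Finset.sum_add_distrib, Finset.mul_sum]

/-- The defect `∑ w_b ^ 2 - 1` of a solution of the direction equation satisfies a homogeneous
linear equation. -/
theorem linear_equation_of_directionOp {κ : ℝ} {ρ : A} {w : B → A}
    (hw : ∀ b, directionOp (fun j => d j) κ ρ w b = 0) :
    (2 * κ) • ∑ j, d j ρ * d j (∑ b, w b ^ 2 - 1)
      + ρ * (∑ j, d j (d j (∑ b, w b ^ 2 - 1))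
        + 2 * energyDensity (fun j => d j) w * (∑ b, w b ^ 2 - 1)) = 0 := by
  have h1 : ∀ j, d j (∑ b, w b ^ 2 - 1) = d j (∑ b, w b ^ 2) := fun j => by
    rw [map_sub, Derivation.map_one_eq_zero, sub_zero]
  simp only [h1]
  rw [sum_sum_derivation_sq]
  have h2 : ∑ b, 2 * w b * directionOp (fun j => d j) κ ρ w b = 0 :=
    Finset.sum_eq_zero fun b _ => by rw [hw, mul_zero]
  rw [← h2]
  have h3 : ∑ j, d j ρ * d j (∑ b, w b ^ 2) = ∑ b, 2 * w b * ∑ j, d j ρ * d j (w b) := by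
    simp only [derivation_sum_sq, Finset.mul_sum]
    rw [Finset.sum_comm]
    exact Finset.sum_congr rfl fun b _ => Finset.sum_congr rfl fun j _ => by ring
  have h4 : ∀ b, 2 * w b * directionOp (fun j => d j) κ ρ w b
      = (2 * κ) • (2 * w b * ∑ j, d j ρ * d j (w b))
        + ρ * (2 * (w b * ∑ j, d j (d j (w b))))
        + ρ * (2 * energyDensity (fun j => d j) w) * w b ^ 2 := fun b => by
    simp only [directionOp, Algebra.smul_def]
    ring
  simp only [h4, Finset.sum_add_distrib, ← Finset.smul_sum, ← Finset.mul_sum]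
  rw [h3]
  ring

theorem modulusOp_eq_one_of_polarOp {κ : ℝ} {ρ : A} {w : B → A} (h1 : ∑ b, w b ^ 2 = 1)
    (h : ∀ b, polarOp (fun j => d j) κ ρ w b = w b) : modulusOp (fun j => d j) κ ρ w = 1 := by
  have hd : ∀ j, (2 : A) * ∑ b, w b * d j (w b) = 0 := fun j => by
    rw [← derivation_sum_sq, h1, Derivation.map_one_eq_zero]
  have half : ∀ x : A, 2 * x = 0 → x = 0 := fun x hx => by
    have : (2 : ℝ) • x = 0 := by rw [Algebra.smul_def, map_ofNat]; exact hx
    simpa using this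
  have hd' : ∑ b, w b * (∑ j, d j ρ * d j (w b)) = 0 := by
    have : ∑ b, w b * (∑ j, d j ρ * d j (w b)) = ∑ j, d j ρ * ∑ b, w b * d j (w b) := by
      simp only [Finset.mul_sum]
      rw [Finset.sum_comm]
      exact Finset.sum_congr rfl fun b _ => Finset.sum_congr rfl fun j _ => by ring
    rw [this]
    exact Finset.sum_eq_zero fun j _ => by rw [half _ (hd j), mul_zero]
  have hdd : ∑ b, w b * ∑ j, d j (d j (w b)) + energyDensity (fun j => d j) w = 0 := by
    refine half _ ?_
    rw [← sum_sum_derivation_sq, h1]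
    simp
  have e : ∑ b, w b * polarOp (fun j => d j) κ ρ w b = 1 := by
    rw [← h1]
    exact Finset.sum_congr rfl fun b _ => by rw [h, sq]
  have h4 : ∀ b, w b * polarOp (fun j => d j) κ ρ w b
      = ((κ * (κ - 1)) • ∑ j, d j ρ ^ 2 + κ • (ρ * ∑ j, d j (d j ρ))) * w b ^ 2
        + (2 * κ) • (ρ * (w b * ∑ j, d j ρ * d j (w b)))
        + ρ ^ 2 * (w b * ∑ j, d j (d j (w b))) := fun b => by
    simp only [polarOp, Algebra.smul_def]
    ring
  simp only [h4, Finset.sum_add_distrib, ← Finset.smul_sum, ← Finset.mul_sum] at e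
  rw [h1, hd', eq_neg_of_add_eq_zero_left hdd] at e
  rw [← e, modulusOp]
  simp only [mul_zero, smul_zero]
  ring

variable {c : ι → R} {δ : ι → Derivation ℝ R R} {T : A →ₐ[ℝ] R⟦X⟧} {κ : ℝ} {α : R}

theorem exists_eq_X_mul_of_coeff_zero {F : R⟦X⟧} (h : coeff 0 F = 0) : ∃ a, F = X * a := by
  refine X_dvd_iff.2 ?_
  rwa [← coeff_zero_eq_constantCoeff_apply]

theorem isUnit_of_smul_mul_sq_eq_one {r : ℝ} {s α : R} (h : r • (s * α ^ 2) = 1) : IsUnit α := by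
  refine IsUnit.of_mul_eq_one (r • (s * α)) ?_
  rw [← h, mul_smul_comm]
  congr 1
  ring

theorem directionOp_eq_zero_of_polarOp (hT : Function.Injective T) {ρ : A} {w : B → A}
    (hρ0 : coeff 0 (T ρ) = 0)
    (hρ1 : IsUnit (coeff 1 (T ρ))) (h1 : ∑ b, w b ^ 2 = 1)
    (h : ∀ b, polarOp (fun j => d j) κ ρ w b = w b) (b : B) :
    directionOp (fun j => d j) κ ρ w b = 0 := by
  have h2 := polarOp_eq (fun j => d j) κ ρ w b
  rw [h, modulusOp_eq_one_of_polarOp d h1 h, one_mul, left_eq_add] at h2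
  obtain ⟨a, ha⟩ := exists_eq_X_mul_of_coeff_zero hρ0
  rw [ha, ← zero_add 1, coeff_succ_X_mul] at hρ1
  have hu : IsUnit a := by
    rw [isUnit_iff_constantCoeff, ← coeff_zero_eq_constantCoeff_apply]
    exact hρ1
  have h3 := congrArg T h2
  rw [map_mul, map_zero, ha, mul_assoc] at h3
  have h4 : a * T (directionOp (fun j => d j) κ ρ w b) = 0 := X_mul_cancel (by rw [h3, mul_zero])
  have h5 := (hu.mul_right_eq_zero).1 h4
  exact hT (by rw [h5, map_zero])

/-- If the direction equation holds and the direction is a unit vector on the hypersurface, then it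
is a unit vector everywhere. -/
theorem sum_sq_eq_one_of_directionOp (hT : Function.Injective T)
    (hTd : ∀ j x, T (d j x) = formalDeriv (c j) (δ j) (T x)) (hκ : 1 < κ)
    (hα : (κ * (κ - 1)) • ((∑ j, c j ^ 2) * α ^ 2) = 1) {ρ : A} {w : B → A}
    (hρ0 : coeff 0 (T ρ) = 0) (hρ1 : coeff 1 (T ρ) = α) (h1 : ∑ b, coeff 0 (T (w b)) ^ 2 = 1)
    (hw : ∀ b, directionOp (fun j => d j) κ ρ w b = 0) : ∑ b, w b ^ 2 = 1 := by
  obtain ⟨a, ha⟩ := exists_eq_X_mul_of_coeff_zero hρ0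
  rw [ha, ← zero_add 1, coeff_succ_X_mul] at hρ1
  have h := congrArg T (linear_equation_of_directionOp d hw)
  rw [← sub_eq_zero]
  refine hT ?_
  rw [map_zero]
  refine formal_linear_unique (δ := δ) (Λ := T (2 * energyDensity (fun j => d j) w)) hκ hα hρ1 ?_ ?_
  · rw [map_sub, map_sum, map_one, map_sub, map_sum, sub_eq_zero]
    rw [coeff_one, if_pos rfl, ← h1]
    refine Finset.sum_congr rfl fun b _ => ?_
    rw [map_pow, coeff_zero_eq_constantCoeff_apply, map_pow, coeff_zero_eq_constantCoeff_apply]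
  · rw [map_zero] at h
    rw [← h]
    simp only [map_add, map_smul, map_mul, map_sum, hTd, ha]

theorem polar_solution_unique (hT : Function.Injective T)
    (hTd : ∀ j x, T (d j x) = formalDeriv (c j) (δ j) (T x)) (hκ : 1 < κ)
    (hα : (κ * (κ - 1)) • ((∑ j, c j ^ 2) * α ^ 2) = 1) {ρ ρ' : A} {w w' : B → A}
    (hρ0 : coeff 0 (T ρ) = 0) (hρ1 : coeff 1 (T ρ) = α) (h1 : ∑ b, w b ^ 2 = 1)
    (h : ∀ b, polarOp (fun j => d j) κ ρ w b = w b)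
    (hρ0' : coeff 0 (T ρ') = 0) (hρ1' : coeff 1 (T ρ') = α) (h1' : ∑ b, w' b ^ 2 = 1)
    (h' : ∀ b, polarOp (fun j => d j) κ ρ' w' b = w' b)
    (hw : ∀ b, coeff 0 (T (w b)) = coeff 0 (T (w' b))) : ρ = ρ' ∧ w = w' := by
  have hu : IsUnit α := isUnit_of_smul_mul_sq_eq_one hα
  have e1 := congrArg T (modulusOp_eq_one_of_polarOp d h1 h)
  have e1' := congrArg T (modulusOp_eq_one_of_polarOp d h1' h')
  have e2 := fun b => congrArg T
    (directionOp_eq_zero_of_polarOp d (b := b) hT hρ0 (by rwa [hρ1]) h1 h)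
  have e2' := fun b => congrArg T
    (directionOp_eq_zero_of_polarOp d (b := b) hT hρ0' (by rwa [hρ1']) h1' h')
  simp only [map_modulusOp T hTd, map_directionOp T hTd, map_one, map_zero] at e1 e1' e2 e2'
  obtain ⟨a, ha⟩ := exists_eq_X_mul_of_coeff_zero hρ0
  obtain ⟨a', ha'⟩ := exists_eq_X_mul_of_coeff_zero hρ0'
  rw [ha] at e1 e2
  rw [ha'] at e1' e2'
  rw [ha, ← zero_add 1, coeff_succ_X_mul] at hρ1
  rw [ha', ← zero_add 1, coeff_succ_X_mul] at hρ1'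
  obtain ⟨h3, h4⟩ := formal_solution_unique (δ := δ) hκ hα hρ1 hρ1' hw e1 e1' e2 e2'
  refine ⟨hT (by rw [ha, ha', h3]), funext fun b => hT ?_⟩
  exact congrFun h4 b

end UnitDirection

/-! ### Graph coordinates -/

section GraphCoordinates

open PowerSeries
open scoped ENNReal NNReal

variable {E : Type*} [NormedAddCommGroup E] [InnerProductSpace ℝ E] [FiniteDimensional ℝ E]

/-- The orthogonal projection onto the hyperplane orthogonal to `ν`. -/
noncomputable def hyperplaneProj (ν : E) : E →L[ℝ] (ℝ ∙ ν)ᗮ := (ℝ ∙ ν)ᗮ.orthogonalProjectionOnto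

variable {p ν : E} {g : (ℝ ∙ ν)ᗮ → ℝ}

theorem inner_smul_add_hyperplaneProj (hν : ‖ν‖ = 1) (e : E) :
    inner ℝ ν e • ν + (hyperplaneProj ν e : E) = e := by
  have h := Submodule.starProjection_add_starProjection_orthogonal (K := ℝ ∙ ν) e
  rw [Submodule.starProjection_unit_singleton ℝ hν] at h
  exact h

theorem hyperplaneProj_self (ν : E) : hyperplaneProj ν ν = 0 :=
  Submodule.orthogonalProjectionOnto_orthogonal_apply_eq_zero (Submodule.mem_span_singleton_self ν)

theorem hyperplaneProj_coe (y : (ℝ ∙ ν)ᗮ) : hyperplaneProj ν (y : E) = y :=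
  Submodule.orthogonalProjectionOnto_mem_subspace_eq_self y

theorem inner_coe_hyperplane (y : (ℝ ∙ ν)ᗮ) : inner ℝ ν (y : E) = 0 :=
  Submodule.mem_orthogonal_singleton_iff_inner_right.1 y.2

/-- The parametrization by the hyperplane orthogonal to `ν` of the graph of `g` over it, with the
origin at `p`. -/
def graphMap (p ν : E) (g : (ℝ ∙ ν)ᗮ → ℝ) (y : (ℝ ∙ ν)ᗮ) : E := p + y + g y • ν

/-- The height above the graph of `g`, in the direction `ν`. -/
noncomputable def heightAbove (p ν : E) (g : (ℝ ∙ ν)ᗮ → ℝ) (x : E) : ℝ :=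
  inner ℝ ν (x - p) - g (hyperplaneProj ν (x - p))

/-- The coordinates which straighten the graph of `g`. -/
noncomputable def graphCoord (p ν : E) (g : (ℝ ∙ ν)ᗮ → ℝ) (x : E) : ℝ × (ℝ ∙ ν)ᗮ :=
  (heightAbove p ν g x, hyperplaneProj ν (x - p))

theorem graphMap_add_heightAbove_smul (hν : ‖ν‖ = 1) (x : E) :
    graphMap p ν g (hyperplaneProj ν (x - p)) + heightAbove p ν g x • ν = x := by
  have h := inner_smul_add_hyperplaneProj hν (x - p)
  rw [graphMap, heightAbove, sub_smul]
  calc _ = p + (inner ℝ ν (x - p) • ν + (hyperplaneProj ν (x - p) : E)) := by abel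
    _ = x := by rw [h]; abel

theorem graphCoord_graphMap_add_smul (hν : ‖ν‖ = 1) (y : (ℝ ∙ ν)ᗮ) (s : ℝ) :
    graphCoord p ν g (graphMap p ν g y + s • ν) = (s, y) := by
  have h : graphMap p ν g y + s • ν - p = (y : E) + (g y + s) • ν := by
    rw [graphMap, add_smul]
    abel
  have h2 : hyperplaneProj ν (graphMap p ν g y + s • ν - p) = y := by
    rw [h, map_add, map_smul, hyperplaneProj_self, smul_zero, add_zero, hyperplaneProj_coe]
  rw [graphCoord, heightAbove, h2, h, inner_add_right, inner_coe_hyperplane, inner_smul_right,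
    real_inner_self_eq_norm_sq, hν]
  simp

theorem graphCoord_graphMap (hν : ‖ν‖ = 1) (y : (ℝ ∙ ν)ᗮ) :
    graphCoord p ν g (graphMap p ν g y) = (0, y) := by
  have := graphCoord_graphMap_add_smul (p := p) (g := g) hν y 0
  rwa [zero_smul, add_zero] at this

theorem graphMap_zero (hg0 : g 0 = 0) : graphMap p ν g 0 = p := by
  simp [graphMap, hg0]

theorem graphCoord_self (hg0 : g 0 = 0) : graphCoord p ν g p = 0 := by
  simp [graphCoord, heightAbove, hg0]

theorem analyticAt_graphMap {y : (ℝ ∙ ν)ᗮ} (hg : AnalyticAt ℝ g y) :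
    AnalyticAt ℝ (graphMap p ν g) y :=
  (analyticAt_const.add ((ℝ ∙ ν)ᗮ.subtypeL.analyticAt y)).add (hg.smul analyticAt_const)

theorem analyticAt_hyperplaneProj_sub (x : E) :
    AnalyticAt ℝ (fun x => hyperplaneProj ν (x - p)) x :=
  ((hyperplaneProj ν).analyticAt _).comp (analyticAt_id.sub analyticAt_const)

theorem analyticAt_heightAbove {x : E} (hg : AnalyticAt ℝ g (hyperplaneProj ν (x - p))) :
    AnalyticAt ℝ (heightAbove p ν g) x := by
  refine AnalyticAt.sub ?_ ?_
  · exact ((innerSL ℝ ν).analyticAt _).comp (analyticAt_id.sub analyticAt_const)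
  · exact AnalyticAt.fun_comp (g := g) (f := fun x => hyperplaneProj ν (x - p)) hg
      (analyticAt_hyperplaneProj_sub x)

theorem analyticAt_graphCoord {x : E} (hg : AnalyticAt ℝ g (hyperplaneProj ν (x - p))) :
    AnalyticAt ℝ (graphCoord p ν g) x :=
  (analyticAt_heightAbove hg).prod (analyticAt_hyperplaneProj_sub x)

theorem fderiv_graphMap_apply {y : (ℝ ∙ ν)ᗮ} (hg : DifferentiableAt ℝ g y) (v : (ℝ ∙ ν)ᗮ) :
    fderiv ℝ (graphMap p ν g) y v = v + fderiv ℝ g y v • ν := by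
  have h : HasFDerivAt (graphMap p ν g)
      ((0 + (ℝ ∙ ν)ᗮ.subtypeL) + (fderiv ℝ g y).smulRight ν) y :=
    ((hasFDerivAt_const p y).add ((ℝ ∙ ν)ᗮ.subtypeL.hasFDerivAt)).add
      (hg.hasFDerivAt.smul_const ν)
  rw [h.fderiv]
  simp

theorem fderiv_graphCoord_apply_self (hν : ‖ν‖ = 1) {x : E}
    (hg : DifferentiableAt ℝ g (hyperplaneProj ν (x - p))) :
    fderiv ℝ (graphCoord p ν g) x ν = (1, 0) := by
  have h1 : HasFDerivAt (fun x => hyperplaneProj ν (x - p)) (hyperplaneProj ν) x := by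
    have := (hyperplaneProj ν).hasFDerivAt (x := x - p)
    exact (this.comp x ((hasFDerivAt_id x).sub_const p))
  have h2 : HasFDerivAt (fun x => inner ℝ ν (x - p)) (innerSL ℝ ν) x := by
    have := (innerSL ℝ ν).hasFDerivAt (x := x - p)
    exact (this.comp x ((hasFDerivAt_id x).sub_const p))
  have h3 : HasFDerivAt (graphCoord p ν g)
      ((innerSL ℝ ν - (fderiv ℝ g (hyperplaneProj ν (x - p))).comp (hyperplaneProj ν)).prod
        (hyperplaneProj ν)) x :=
    (h2.sub (hg.hasFDerivAt.comp x h1)).prodMk h1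
  rw [h3.fderiv]
  simp [hyperplaneProj_self, hν]

/-- The coefficient of `∂/∂t` in the expression of the derivative in the direction `e` in graph
coordinates. -/
noncomputable def normalCoeff (ν : E) (g : (ℝ ∙ ν)ᗮ → ℝ) (e : E) (y : (ℝ ∙ ν)ᗮ) : ℝ :=
  inner ℝ ν e - fderiv ℝ g y (hyperplaneProj ν e)

theorem analyticAt_normalCoeff {y : (ℝ ∙ ν)ᗮ} (hg : AnalyticAt ℝ g y) (e : E) :
    AnalyticAt ℝ (normalCoeff ν g e) y :=
  analyticAt_const.sub (analyticAt_fderiv_apply hg _)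

theorem sum_normalCoeff_mul {ι : Type*} [Fintype ι] (e : OrthonormalBasis ι ℝ E) (hν : ‖ν‖ = 1)
    (y : (ℝ ∙ ν)ᗮ) : ∑ j, inner ℝ (e j) ν * normalCoeff ν g (e j) y = 1 := by
  have h : ∑ j, inner ℝ (e j) ν • e j = ν := e.sum_repr' ν
  have h2 : ∀ v, normalCoeff ν g v y
      = (innerSL ℝ ν - (fderiv ℝ g y).comp (hyperplaneProj ν)) v := fun _ => rfl
  simp only [h2]
  simp only [← smul_eq_mul, ← map_smul, ← map_sum]
  rw [h]
  simp [hyperplaneProj_self, hν]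

theorem sum_normalCoeff_sq_pos {ι : Type*} [Fintype ι] (e : OrthonormalBasis ι ℝ E)
    (hν : ‖ν‖ = 1) (y : (ℝ ∙ ν)ᗮ) : 0 < ∑ j, normalCoeff ν g (e j) y ^ 2 := by
  have h := sum_normalCoeff_mul (g := g) e hν y
  refine lt_of_le_of_ne (Finset.sum_nonneg fun j _ => sq_nonneg _) fun h0 => ?_
  have h1 : ∀ j, normalCoeff ν g (e j) y = 0 := fun j => by
    have := (Finset.sum_eq_zero_iff_of_nonneg (fun j _ => sq_nonneg _)).1 h0.symm j
      (Finset.mem_univ j)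
    exact pow_eq_zero_iff two_ne_zero |>.1 this
  simp [h1] at h

/-- Restriction of germs to the graph. -/
noncomputable def graphRestrict (hg : AnalyticAt ℝ g 0) (hg0 : g 0 = 0) :
    AnGerm p →ₐ[ℝ] AnGerm (0 : (ℝ ∙ ν)ᗮ) :=
  germPullback (graphMap p ν g) (analyticAt_graphMap hg) (graphMap_zero hg0)

theorem graphRestrict_germ (hg : AnalyticAt ℝ g 0) (hg0 : g 0 = 0) {f : E → ℝ}
    (hf : AnalyticAt ℝ f p) :
    graphRestrict hg hg0 (germ f hf) = germ (fun y => f (graphMap p ν g y))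
      (AnalyticAt.fun_comp ((graphMap_zero (p := p) hg0).symm ▸ hf) (analyticAt_graphMap hg)) :=
  germPullback_germ _ _ hf

theorem tendsto_graphMap (hg : AnalyticAt ℝ g 0) (hg0 : g 0 = 0) :
    Tendsto (graphMap p ν g) (𝓝 0) (𝓝 p) := by
  have := (analyticAt_graphMap (p := p) hg).continuousAt.tendsto
  rwa [graphMap_zero hg0] at this

theorem graphRestrict_germDeriv (hν : ‖ν‖ = 1) (hg : AnalyticAt ℝ g 0) (hg0 : g 0 = 0) (e : E)
    (x : AnGerm p) : graphRestrict hg hg0 (germDeriv p e x)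
      = germ (normalCoeff ν g e) (analyticAt_normalCoeff hg e)
          * graphRestrict hg hg0 (germDeriv p ν x)
        + germDeriv 0 (hyperplaneProj ν e) (graphRestrict hg hg0 x) := by
  obtain ⟨f, hf, rfl⟩ := exists_germ_eq x
  simp only [germDeriv_germ, graphRestrict_germ, germ_mul, germ_add]
  rw [germ_eq_iff]
  filter_upwards [hg.eventually_analyticAt,
    (tendsto_graphMap (p := p) hg hg0).eventually hf.eventually_analyticAt] with y h1 h2
  have h3 := (h2.differentiableAt.hasFDerivAt.comp y
    (analyticAt_graphMap (p := p) h1).differentiableAt.hasFDerivAt).fderiv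
  simp only [Function.comp_def] at h3
  rw [h3, ContinuousLinearMap.comp_apply, fderiv_graphMap_apply h1.differentiableAt, map_add,
    map_smul, normalCoeff]
  nth_rewrite 1 [← inner_smul_add_hyperplaneProj hν e]
  rw [map_add, map_smul, smul_eq_mul, smul_eq_mul]
  ring

/-- Taylor expansion of germs at `p` along `ν`, at the points of the graph of `g`. -/
noncomputable def graphTaylorHom (hg : AnalyticAt ℝ g 0) (hg0 : g 0 = 0) :
    AnGerm p →ₐ[ℝ] (AnGerm (0 : (ℝ ∙ ν)ᗮ))⟦X⟧ :=
  taylorHom (graphRestrict hg hg0) (germDeriv p ν)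

theorem coeff_zero_graphTaylorHom (hg : AnalyticAt ℝ g 0) (hg0 : g 0 = 0) (x : AnGerm p) :
    coeff 0 (graphTaylorHom hg hg0 x) = graphRestrict hg hg0 x := by
  rw [graphTaylorHom, coeff_taylorHom]
  simp

theorem coeff_one_graphTaylorHom (hg : AnalyticAt ℝ g 0) (hg0 : g 0 = 0) (x : AnGerm p) :
    coeff 1 (graphTaylorHom hg hg0 x) = graphRestrict hg hg0 (germDeriv p ν x) := by
  rw [graphTaylorHom, coeff_taylorHom]
  simp

theorem graphTaylorHom_germDeriv (hν : ‖ν‖ = 1) (hg : AnalyticAt ℝ g 0) (hg0 : g 0 = 0) (e : E)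
    (x : AnGerm p) : graphTaylorHom hg hg0 (germDeriv p e x)
      = formalDeriv (germ (normalCoeff ν g e) (analyticAt_normalCoeff hg e))
        (germDeriv 0 (hyperplaneProj ν e)) (graphTaylorHom hg hg0 x) :=
  taylorHom_derivation (germDeriv_comm ν e) (graphRestrict_germDeriv hν hg hg0 e) x

theorem graphTaylorHom_injective (hν : ‖ν‖ = 1) (hg : AnalyticAt ℝ g 0) (hg0 : g 0 = 0) :
    Function.Injective (graphTaylorHom (p := p) hg hg0) := by
  rw [injective_iff_map_eq_zero]
  intro x hx
  refine eq_zero_of_forall_germDeriv_mem {x | graphTaylorHom hg hg0 x = 0} ?_ ?_ hx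
  · intro x hx v
    have hx' : graphTaylorHom hg hg0 x = 0 := hx
    rw [mem_ofPred_eq, graphTaylorHom_germDeriv hν, hx']
    ext k
    rw [coeff_formalDeriv]
    simp
  · intro f hf hf0
    have h := congrArg (coeff 0) (show graphTaylorHom hg hg0 (germ f hf) = 0 from hf0)
    rw [coeff_zero_graphTaylorHom, graphRestrict_germ, map_zero, germ_zero, germ_eq_iff] at h
    have h2 := h.eq_of_nhds
    rwa [graphMap_zero hg0] at h2

theorem analyticAt_graphCoord_self (hg : AnalyticAt ℝ g 0) : AnalyticAt ℝ (graphCoord p ν g) p :=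
  analyticAt_graphCoord (by simpa using hg)

theorem germPullback_graphCoord_germDeriv (hν : ‖ν‖ = 1) (hg : AnalyticAt ℝ g 0) (hg0 : g 0 = 0)
    (x : AnGerm (0 : ℝ × (ℝ ∙ ν)ᗮ)) :
    germDeriv p ν (germPullback (graphCoord p ν g) (analyticAt_graphCoord_self hg)
        (graphCoord_self hg0) x)
      = germPullback (graphCoord p ν g) (analyticAt_graphCoord_self hg) (graphCoord_self hg0)
        (germDeriv 0 (1, 0) x) := by
  obtain ⟨f, hf, rfl⟩ := exists_germ_eq x
  rw [germPullback_germ, germDeriv_germ, germDeriv_germ, germPullback_germ, germ_eq_iff]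
  have h0 : Tendsto (graphCoord p ν g) (𝓝 p) (𝓝 0) := by
    have := (analyticAt_graphCoord_self (p := p) hg).continuousAt.tendsto
    rwa [graphCoord_self hg0] at this
  have h1 : Tendsto (fun x => hyperplaneProj ν (x - p)) (𝓝 p) (𝓝 0) := by
    have := (analyticAt_hyperplaneProj_sub (p := p) (ν := ν) p).continuousAt.tendsto
    simpa using this
  filter_upwards [h0.eventually hf.eventually_analyticAt, h1.eventually hg.eventually_analyticAt]
    with z h2 h3
  have h4 := (h2.differentiableAt.hasFDerivAt.comp z
    (analyticAt_graphCoord (p := p) h3).differentiableAt.hasFDerivAt).fderiv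
  simp only [Function.comp_def] at h4
  rw [h4, ContinuousLinearMap.comp_apply, fderiv_graphCoord_apply_self hν h3.differentiableAt]

theorem graphTaylorHom_germPullback (hν : ‖ν‖ = 1) (hg : AnalyticAt ℝ g 0) (hg0 : g 0 = 0)
    (x : AnGerm (0 : ℝ × (ℝ ∙ ν)ᗮ)) :
    graphTaylorHom hg hg0 (germPullback (graphCoord p ν g) (analyticAt_graphCoord_self hg)
        (graphCoord_self hg0) x)
      = firstVariableTaylorHom _ x := by
  ext k
  rw [graphTaylorHom, firstVariableTaylorHom, coeff_taylorHom, coeff_taylorHom]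
  congr 1
  have h : (germDeriv p ν)^[k] (germPullback (graphCoord p ν g) (analyticAt_graphCoord_self hg)
        (graphCoord_self hg0) x) = germPullback (graphCoord p ν g) (analyticAt_graphCoord_self hg)
        (graphCoord_self hg0) ((germDeriv 0 (1, 0))^[k] x) := by
    induction k with
    | zero => rfl
    | succ k ih => rw [Function.iterate_succ_apply', ih, Function.iterate_succ_apply',
        germPullback_graphCoord_germDeriv hν hg hg0]
  rw [h]
  generalize (germDeriv 0 (1, 0))^[k] x = z
  obtain ⟨f, hf, rfl⟩ := exists_germ_eq z
  rw [germPullback_germ, germPullback_germ, graphRestrict_germ, germ_eq_iff]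
  exact Eventually.of_forall fun y => by
    beta_reduce
    rw [graphCoord_graphMap hν]

theorem exists_graphTaylorHom_eq (hν : ‖ν‖ = 1) (hg : AnalyticAt ℝ g 0) (hg0 : g 0 = 0)
    {F : (AnGerm (0 : (ℝ ∙ ν)ᗮ))⟦X⟧} {R ε : ℝ≥0} (hR : 0 < R) (hε : 0 < ε)
    (h : ∑' k, (ε : ℝ≥0∞) ^ k * majorantNorm R k (coeff k F) ≠ ∞) :
    ∃ x : AnGerm p, graphTaylorHom hg hg0 x = F := by
  obtain ⟨x, rfl⟩ := exists_firstVariableTaylorHom_eq hR hε h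
  exact ⟨_, graphTaylorHom_germPullback hν hg hg0 x⟩

end GraphCoordinates

/-! ### Solutions in the ring of germs -/

section GermSolution

open PowerSeries
open scoped ENNReal NNReal

variable {E : Type*} [NormedAddCommGroup E] [InnerProductSpace ℝ E] [FiniteDimensional ℝ E]
  {p ν : E} {g : (ℝ ∙ ν)ᗮ → ℝ} {ι B : Type*} [Fintype ι] [Fintype B]

theorem germ_sq {f : E → ℝ} (hf : AnalyticAt ℝ f p) :
    germ f hf ^ 2 = germ (fun x => f x ^ 2) (hf.pow 2) := by
  rw [sq, germ_mul, germ_eq_iff]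
  exact Eventually.of_forall fun x => (sq (f x)).symm

/-- The normal derivative which a modulus must have on the hypersurface. -/
noncomputable def normalSlope (e : OrthonormalBasis ι ℝ E) (ν : E) (g : (ℝ ∙ ν)ᗮ → ℝ) (κ : ℝ)
    (y : (ℝ ∙ ν)ᗮ) : ℝ :=
  Real.exp (-(Real.log (κ * (κ - 1) * ∑ j, normalCoeff ν g (e j) y ^ 2)) / 2)

theorem normalSlope_pos (e : OrthonormalBasis ι ℝ E) (κ : ℝ) (y : (ℝ ∙ ν)ᗮ) :
    0 < normalSlope e ν g κ y := Real.exp_pos _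

theorem normalSlope_sq (e : OrthonormalBasis ι ℝ E) (hν : ‖ν‖ = 1) {κ : ℝ} (hκ : 1 < κ)
    (y : (ℝ ∙ ν)ᗮ) :
    κ * (κ - 1) * ((∑ j, normalCoeff ν g (e j) y ^ 2) * normalSlope e ν g κ y ^ 2) = 1 := by
  have h := sum_normalCoeff_sq_pos (g := g) e hν y
  have hκ' : 0 < κ * (κ - 1) := mul_pos (by linarith) (by linarith)
  have h2 : 0 < κ * (κ - 1) * ∑ j, normalCoeff ν g (e j) y ^ 2 := by positivity
  rw [normalSlope, ← Real.exp_nat_mul]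
  have e1 : ((2 : ℕ) : ℝ) * (-(Real.log (κ * (κ - 1) * ∑ j, normalCoeff ν g (e j) y ^ 2)) / 2)
      = -Real.log (κ * (κ - 1) * ∑ j, normalCoeff ν g (e j) y ^ 2) := by
    push_cast
    ring
  rw [e1, Real.exp_neg, Real.exp_log h2, ← mul_assoc, mul_inv_cancel₀ h2.ne']

theorem analyticAt_normalSlope (e : OrthonormalBasis ι ℝ E) (hν : ‖ν‖ = 1) {κ : ℝ} (hκ : 1 < κ)
    {y : (ℝ ∙ ν)ᗮ} (hg : AnalyticAt ℝ g y) : AnalyticAt ℝ (normalSlope e ν g κ) y := by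
  have h := sum_normalCoeff_sq_pos (g := g) e hν y
  have hκ' : 0 < κ * (κ - 1) := mul_pos (by linarith) (by linarith)
  have h1 : AnalyticAt ℝ (fun y => κ * (κ - 1) * ∑ j, normalCoeff ν g (e j) y ^ 2) y := by
    refine analyticAt_const.mul ?_
    refine Finset.analyticAt_fun_sum _ fun j _ => ?_
    exact (analyticAt_normalCoeff hg _).fun_pow 2
  have h2 : AnalyticAt ℝ
      (fun y => Real.log (κ * (κ - 1) * ∑ j, normalCoeff ν g (e j) y ^ 2)) y :=
    AnalyticAt.fun_comp (g := Real.log) (analyticAt_log (by positivity)) h1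
  exact AnalyticAt.fun_comp (g := Real.exp) analyticAt_rexp
    (h2.neg.div analyticAt_const two_ne_zero)

/-- The germ form of the relation satisfied by the normal slope. -/
theorem smul_sum_sq_mul_normalSlope (e : OrthonormalBasis ι ℝ E) (hν : ‖ν‖ = 1) {κ : ℝ}
    (hκ : 1 < κ) (hg : AnalyticAt ℝ g 0) :
    (κ * (κ - 1)) • ((∑ j, germ (normalCoeff ν g (e j)) (analyticAt_normalCoeff hg (e j)) ^ 2)
      * germ (normalSlope e ν g κ) (analyticAt_normalSlope e hν hκ hg) ^ 2) = 1 := by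
  simp only [germ_sq]
  rw [germ_sum, germ_mul, smul_germ, germ_one, germ_eq_iff]
  exact Eventually.of_forall fun y => normalSlope_sq e hν hκ y

theorem exists_germ_solution (e : OrthonormalBasis ι ℝ E) (hν : ‖ν‖ = 1) {κ : ℝ} (hκ : 1 < κ)
    (hg : AnalyticAt ℝ g 0) (hg0 : g 0 = 0) {V : B → AnGerm (0 : (ℝ ∙ ν)ᗮ)}
    (hV : ∑ b, V b ^ 2 = 1) :
    ∃ (ρ : AnGerm p) (w : B → AnGerm p), graphRestrict hg hg0 ρ = 0 ∧
      graphRestrict hg hg0 (germDeriv p ν ρ)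
        = germ (normalSlope e ν g κ) (analyticAt_normalSlope e hν hκ hg) ∧
      (∀ b, graphRestrict hg hg0 (w b) = V b) ∧ ∑ b, w b ^ 2 = 1 ∧
      ∀ b, polarOp (fun j => germDeriv p (e j)) κ ρ w b = w b := by
  set c : ι → AnGerm (0 : (ℝ ∙ ν)ᗮ) := fun j =>
    germ (normalCoeff ν g (e j)) (analyticAt_normalCoeff hg (e j)) with hc
  set δ : ι → Derivation ℝ (AnGerm (0 : (ℝ ∙ ν)ᗮ)) (AnGerm (0 : (ℝ ∙ ν)ᗮ)) := fun j =>
    germDeriv 0 (hyperplaneProj ν (e j)) with hδ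
  set α := germ (normalSlope e ν g κ) (analyticAt_normalSlope e hν hκ hg) with hα
  have hs : (κ * (κ - 1)) • ((∑ j, c j ^ 2) * α ^ 2) = 1 :=
    smul_sum_sq_mul_normalSlope e hν hκ hg
  obtain ⟨a, W, ha0, hW0, ha, hW⟩ := exists_formal_recursion (c := c) δ κ α V
  obtain ⟨hE1, hE2⟩ := formal_solution_of_recursion (δ := δ) hκ hs ha0 ha hW
  obtain ⟨R, hR, hRα, hRc, hRV⟩ : ∃ R : ℝ≥0, 0 < R ∧ majorantNorm R 0 α ≠ ∞ ∧
      (∀ j, majorantNorm R 0 (c j) ≠ ∞) ∧ ∀ b, majorantNorm R 0 (V b) ≠ ∞ := by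
    have h := (eventually_majorantNorm_ne_top α).and
      ((eventually_all.2 fun j => eventually_majorantNorm_ne_top (c j)).and
        (eventually_all.2 fun b => eventually_majorantNorm_ne_top (V b)))
    obtain ⟨R, hR, h⟩ := (h.and self_mem_nhdsWithin).exists
    exact ⟨R, h, hR⟩
  obtain ⟨ε, hε, hεa, hεW⟩ :=
    (isMajorantNorm_majorantNorm hR fun j => hyperplaneProj ν (e j)).exists_tsum_formal_solution_ne_top
      hκ hRc hRα (fun b => by rw [hW0]; exact hRV b) ha0 ha hW
  obtain ⟨A, hA⟩ := exists_graphTaylorHom_eq (p := p) hν hg hg0 hR hε hεa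
  choose w hw using fun b => exists_graphTaylorHom_eq (p := p) hν hg hg0 hR hε (hεW b)
  have hτ : AnalyticAt ℝ (fun z : ℝ × (ℝ ∙ ν)ᗮ => z.1) 0 := analyticAt_fst
  set t : AnGerm p := germPullback (graphCoord p ν g) (analyticAt_graphCoord_self hg)
    (graphCoord_self hg0) (germ (fun z => z.1) hτ) with ht
  have hTt : graphTaylorHom hg hg0 t = X := by
    rw [ht, graphTaylorHom_germPullback hν, firstVariableTaylorHom_fst]
  have hTρ : graphTaylorHom hg hg0 (t * A) = X * a := by rw [map_mul, hTt, hA]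
  have hTd : ∀ j x, graphTaylorHom (p := p) hg hg0 (germDeriv p (e j) x)
      = formalDeriv (c j) (δ j) (graphTaylorHom hg hg0 x) := fun j x =>
    graphTaylorHom_germDeriv hν hg hg0 (e j) x
  have hinj := graphTaylorHom_injective (p := p) hν hg hg0
  have hW' : (fun b => graphTaylorHom hg hg0 (w b)) = W := funext hw
  have hρ0 : coeff 0 (graphTaylorHom hg hg0 (t * A)) = 0 := by rw [hTρ, coeff_zero_X_mul]
  have hρ1 : coeff 1 (graphTaylorHom hg hg0 (t * A)) = α := by
    rw [hTρ, ← zero_add 1, coeff_succ_X_mul, ha0]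
  have hD : ∀ b, directionOp (fun j => germDeriv p (e j)) κ (t * A) w b = 0 := fun b => by
    refine hinj ?_
    rw [map_directionOp (D := fun j x => germDeriv p (e j) x) _ hTd, hTρ, hW', map_zero, hE2]
  have hM : modulusOp (fun j => germDeriv p (e j)) κ (t * A) w = 1 := by
    refine hinj ?_
    rw [map_modulusOp (D := fun j x => germDeriv p (e j) x) _ hTd, hTρ, hW', map_one, hE1]
  have hsq : ∑ b, w b ^ 2 = 1 :=
    sum_sq_eq_one_of_directionOp (fun j => germDeriv p (e j)) hinj hTd hκ hs hρ0 hρ1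
      (by rw [← hV]; exact Finset.sum_congr rfl fun b _ => by rw [hw, hW0]) hD
  refine ⟨t * A, w, ?_, ?_, ?_, hsq, ?_⟩
  · rw [← coeff_zero_graphTaylorHom, hρ0]
  · rw [← coeff_one_graphTaylorHom, hρ1]
  · intro b
    rw [← coeff_zero_graphTaylorHom, hw, hW0]
  · intro b
    rw [polarOp_eq, hM, hD, one_mul, mul_zero, add_zero]

theorem germ_solution_unique (e : OrthonormalBasis ι ℝ E) (hν : ‖ν‖ = 1) {κ : ℝ} (hκ : 1 < κ)
    (hg : AnalyticAt ℝ g 0) (hg0 : g 0 = 0) {ρ ρ' : AnGerm p} {w w' : B → AnGerm p}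
    (hρ0 : graphRestrict hg hg0 ρ = 0) (hρ1 : graphRestrict hg hg0 (germDeriv p ν ρ)
        = germ (normalSlope e ν g κ) (analyticAt_normalSlope e hν hκ hg))
    (h1 : ∑ b, w b ^ 2 = 1) (h : ∀ b, polarOp (fun j => germDeriv p (e j)) κ ρ w b = w b)
    (hρ0' : graphRestrict hg hg0 ρ' = 0) (hρ1' : graphRestrict hg hg0 (germDeriv p ν ρ')
        = germ (normalSlope e ν g κ) (analyticAt_normalSlope e hν hκ hg))
    (h1' : ∑ b, w' b ^ 2 = 1) (h' : ∀ b, polarOp (fun j => germDeriv p (e j)) κ ρ' w' b = w' b)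
    (hw : ∀ b, graphRestrict hg hg0 (w b) = graphRestrict hg hg0 (w' b)) : ρ = ρ' ∧ w = w' := by
  simp only [← coeff_zero_graphTaylorHom] at hρ0 hρ0' hw
  rw [← coeff_one_graphTaylorHom] at hρ1 hρ1'
  exact polar_solution_unique (fun j => germDeriv p (e j)) (graphTaylorHom_injective hν hg hg0)
    (fun j x => graphTaylorHom_germDeriv hν hg hg0 (e j) x) hκ
    (smul_sum_sq_mul_normalSlope e hν hκ hg) hρ0 hρ1 h1 h hρ0' hρ1' h1' h' hw

/-- The normal slope of a germ solution is determined up to its sign. -/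
theorem sq_graphRestrict_eq (e : OrthonormalBasis ι ℝ E) (hν : ‖ν‖ = 1) {κ : ℝ} (hκ : 1 < κ)
    (hg : AnalyticAt ℝ g 0) (hg0 : g 0 = 0) {ρ : AnGerm p} {w : B → AnGerm p}
    (hρ0 : graphRestrict hg hg0 ρ = 0) (h1 : ∑ b, w b ^ 2 = 1)
    (h : ∀ b, polarOp (fun j => germDeriv p (e j)) κ ρ w b = w b) :
    graphRestrict hg hg0 (germDeriv p ν ρ) ^ 2
      = germ (normalSlope e ν g κ) (analyticAt_normalSlope e hν hκ hg) ^ 2 := by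
  have hs := smul_sum_sq_mul_normalSlope e hν hκ hg
  have hM := congrArg (fun x => coeff 0 (graphTaylorHom hg hg0 x))
    (modulusOp_eq_one_of_polarOp (fun j => germDeriv p (e j)) h1 h)
  rw [map_modulusOp (D := fun j x => germDeriv p (e j) x) _
    (fun j x => graphTaylorHom_germDeriv hν hg hg0 (e j) x), map_one] at hM
  rw [← coeff_zero_graphTaylorHom] at hρ0
  obtain ⟨a, ha⟩ := exists_eq_X_mul_of_coeff_zero hρ0
  rw [← coeff_one_graphTaylorHom, ha, ← zero_add 1, coeff_succ_X_mul]
  rw [ha, coeff_zero_modulusOp, coeff_one, if_pos rfl, ← hs] at hM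
  generalize hS : ∑ j, germ (normalCoeff ν g (e j)) (analyticAt_normalCoeff hg (e j)) ^ 2 = S
    at hM hs
  generalize hα : germ (normalSlope e ν g κ) (analyticAt_normalSlope e hν hκ hg) = α at hM hs ⊢
  calc coeff 0 a ^ 2 = coeff 0 a ^ 2 * ((κ * (κ - 1)) • (S * α ^ 2)) := by rw [hs, mul_one]
    _ = α ^ 2 * ((κ * (κ - 1)) • (S * coeff 0 a ^ 2)) := by
        simp only [Algebra.smul_def]
        ring
    _ = α ^ 2 := by rw [hM, hs, mul_one]

end GermSolution

/-! ### Analytic hypersurfaces as graphs -/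

section Graph

variable {E : Type*} [NormedAddCommGroup E] [InnerProductSpace ℝ E] [FiniteDimensional ℝ E]
  {p ν : E} {g : (ℝ ∙ ν)ᗮ → ℝ}

theorem tendsto_hyperplaneProj_sub (p ν : E) :
    Tendsto (fun x => hyperplaneProj ν (x - p)) (𝓝 p) (𝓝 0) := by
  have := (analyticAt_hyperplaneProj_sub (p := p) (ν := ν) p).continuousAt.tendsto
  simpa using this

/-- A function which vanishes on the graph and increases in the direction `ν` has the sign of the
height above the graph. -/
theorem eventually_pos_iff_heightAbove (hν : ‖ν‖ = 1) (hg : AnalyticAt ℝ g 0) (hg0 : g 0 = 0)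
    {f : E → ℝ} (hf : AnalyticAt ℝ f p) (hf0 : ∀ᶠ y in 𝓝 0, f (graphMap p ν g y) = 0)
    (hf1 : 0 < fderiv ℝ f p ν) :
    ∀ᶠ x in 𝓝 p, (0 < f x ↔ 0 < heightAbove p ν g x) ∧ (f x = 0 ↔ heightAbove p ν g x = 0) := by
  have h1 : ∀ᶠ x in 𝓝 p, 0 < fderiv ℝ f x ν :=
    (analyticAt_fderiv_apply hf ν).continuousAt.eventually (lt_mem_nhds hf1)
  obtain ⟨r, hr, h2⟩ := Metric.eventually_nhds_iff_ball.1 (h1.and hf.eventually_analyticAt)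
  have h3 := tendsto_hyperplaneProj_sub p ν
  have h4 := (tendsto_graphMap (p := p) hg hg0).comp h3
  filter_upwards [h3.eventually hf0, h4.eventually (Metric.ball_mem_nhds p hr),
    Metric.ball_mem_nhds p hr] with x hx0 hx1 hx2
  set z := graphMap p ν g (hyperplaneProj ν (x - p)) with hz
  set t := heightAbove p ν g x with ht
  have hx : z + t • ν = x := graphMap_add_heightAbove_smul hν x
  have hseg : ∀ s ∈ uIcc 0 t, z + s • ν ∈ Metric.ball p r := by
    have hc : Convex ℝ ((fun s : ℝ => z + s • ν) ⁻¹' Metric.ball p r) := by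
      have e : (fun s : ℝ => z + s • ν) = AffineMap.lineMap z (z + ν) := by
        funext s
        simp [AffineMap.lineMap_apply, add_comm]
      rw [e]
      exact (convex_ball p r).affine_preimage _
    have h0 : (0 : ℝ) ∈ (fun s : ℝ => z + s • ν) ⁻¹' Metric.ball p r := by
      rw [mem_preimage, zero_smul, add_zero]
      exact hx1
    have h1 : t ∈ (fun s : ℝ => z + s • ν) ⁻¹' Metric.ball p r := by
      rw [mem_preimage, hx]
      exact hx2
    intro s hs
    rw [← segment_eq_uIcc] at hs
    exact hc.segment_subset h0 h1 hs
  have hder : ∀ s ∈ uIcc 0 t, HasDerivAt (fun s : ℝ => f (z + s • ν))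
      (fderiv ℝ f (z + s • ν) ν) s := by
    intro s hs
    have h5 := (h2 _ (hseg s hs)).2.differentiableAt.hasFDerivAt
    have h6 : HasDerivAt (fun s : ℝ => z + s • ν) ν s := by
      simpa using ((hasDerivAt_id s).smul_const ν).const_add z
    exact h5.comp_hasDerivAt s h6
  have hmono : StrictMonoOn (fun s : ℝ => f (z + s • ν)) (uIcc 0 t) := by
    refine strictMonoOn_of_deriv_pos (convex_uIcc 0 t)
      (fun s hs => (hder s hs).continuousAt.continuousWithinAt) fun s hs => ?_
    have hs' := interior_subset hs
    rw [(hder s hs').deriv]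
    exact (h2 _ (hseg s hs')).1
  have hx0' : f z = 0 := hx0
  have e0 : f (z + (0 : ℝ) • ν) = 0 := by rw [zero_smul, add_zero, hx0']
  have h5 := hmono.lt_iff_lt left_mem_uIcc right_mem_uIcc
  have h6 := hmono.injOn.eq_iff right_mem_uIcc left_mem_uIcc
  beta_reduce at h5 h6
  rw [e0, hx] at h5 h6
  exact ⟨h5, h6⟩

/-- Two functions which vanish on the graph have proportional differentials there. -/
theorem fderiv_graphMap_eq (hν : ‖ν‖ = 1) (hg : AnalyticAt ℝ g 0) (hg0 : g 0 = 0)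
    {f : E → ℝ} (hf : AnalyticAt ℝ f p) (hf0 : ∀ᶠ y in 𝓝 0, f (graphMap p ν g y) = 0) :
    ∀ᶠ y in 𝓝 0, ∀ e, fderiv ℝ f (graphMap p ν g y) e
      = normalCoeff ν g e y * fderiv ℝ f (graphMap p ν g y) ν := by
  filter_upwards [hg.eventually_analyticAt, hf0.eventually_nhds,
    (tendsto_graphMap (p := p) hg hg0).eventually hf.eventually_analyticAt] with y h1 h2 h3 e
  have h4 := (h3.differentiableAt.hasFDerivAt.comp y
    (analyticAt_graphMap (p := p) h1).differentiableAt.hasFDerivAt).fderiv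
  have h5 : f ∘ graphMap p ν g =ᶠ[𝓝 y] fun _ => 0 := h2
  rw [h5.fderiv_eq, fderiv_fun_const] at h4
  have h6 := congrArg (fun L => L (hyperplaneProj ν e)) h4
  simp only [ContinuousLinearMap.comp_apply, fderiv_graphMap_apply h1.differentiableAt, map_add,
    map_smul] at h6
  have h7 : (0 : ℝ) = fderiv ℝ f (graphMap p ν g y) (hyperplaneProj ν e : E)
      + fderiv ℝ g y (hyperplaneProj ν e) * fderiv ℝ f (graphMap p ν g y) ν := h6
  rw [normalCoeff]
  nth_rewrite 1 [← inner_smul_add_hyperplaneProj hν e]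
  rw [map_add, map_smul, smul_eq_mul]
  linarith

/-- The zero set of an analytic function with positive derivative in the direction `ν` is a
graph. -/
theorem exists_graph_of_fderiv_pos {f : E → ℝ} (hf : AnalyticAt ℝ f p)
    (hf0 : f p = 0) (hf1 : 0 < fderiv ℝ f p ν) :
    ∃ g : (ℝ ∙ ν)ᗮ → ℝ, AnalyticAt ℝ g 0 ∧ g 0 = 0 ∧ ∀ᶠ y in 𝓝 0, f (graphMap p ν g y) = 0 := by
  set m : (ℝ ∙ ν)ᗮ × ℝ → E := fun z => p + z.1 + z.2 • ν with hm
  have hm0 : m (0, 0) = p := by simp [hm]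
  have hma : HasFDerivAt m (((0 : (ℝ ∙ ν)ᗮ × ℝ →L[ℝ] E)
      + (ℝ ∙ ν)ᗮ.subtypeL.comp (ContinuousLinearMap.fst ℝ (ℝ ∙ ν)ᗮ ℝ))
      + (ContinuousLinearMap.snd ℝ (ℝ ∙ ν)ᗮ ℝ).smulRight ν) (0, 0) :=
    ((hasFDerivAt_const p _).add ((ℝ ∙ ν)ᗮ.subtypeL.comp
      (ContinuousLinearMap.fst ℝ (ℝ ∙ ν)ᗮ ℝ)).hasFDerivAt).add
      ((ContinuousLinearMap.snd ℝ (ℝ ∙ ν)ᗮ ℝ).hasFDerivAt.smul_const ν)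
  have hman : AnalyticAt ℝ m (0, 0) :=
    (analyticAt_const.add (((ℝ ∙ ν)ᗮ.subtypeL.comp
      (ContinuousLinearMap.fst ℝ (ℝ ∙ ν)ᗮ ℝ)).analyticAt _)).add
      (analyticAt_snd.smul analyticAt_const)
  have hfm : AnalyticAt ℝ (f ∘ m) (0, 0) := AnalyticAt.comp (hm0.symm ▸ hf) hman
  have hC : ContDiffAt ℝ ⊤ (f ∘ m) (0, 0) := hfm.contDiffAt
  have hd : fderiv ℝ (f ∘ m) (0, 0) (0, 1) = fderiv ℝ f p ν := by
    have hf' : HasFDerivAt f (fderiv ℝ f p) (m (0, 0)) := by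
      rw [hm0]
      exact hf.differentiableAt.hasFDerivAt
    rw [(hf'.comp _ hma).fderiv]
    simp
  have hinv : (fderiv ℝ (f ∘ m) (0, 0) ∘L .inr ℝ (ℝ ∙ ν)ᗮ ℝ).IsInvertible := by
    refine ⟨ContinuousLinearEquiv.unitsEquivAut ℝ (Units.mk0 _ hf1.ne'), ?_⟩
    ext
    simp [hd]
  refine ⟨hC.implicitFunction (by simp) hinv, ?_, hC.implicitFunction_apply_self _ hinv, ?_⟩
  · exact analyticWithinAt_univ.1 (contDiffWithinAt_omega_iff_analyticWithinAt.1
      (hC.contDiffAt_implicitFunction (by simp) hinv))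
  · filter_upwards [hC.eventually_apply_implicitFunction (by simp) hinv] with y hy
    have e : (f ∘ m) (0, 0) = 0 := by rw [Function.comp_apply, hm0, hf0]
    rw [e] at hy
    exact hy

end Graph

section Hypersurface

variable {n : ℕ} {Γ : Set (EuclideanSpace ℝ (Fin n))}
  {ν : EuclideanSpace ℝ (Fin n) → EuclideanSpace ℝ (Fin n)} {p : EuclideanSpace ℝ (Fin n)}

theorem fderiv_eq_inner_gradient {f : EuclideanSpace ℝ (Fin n) → ℝ} (x v) :
    fderiv ℝ f x v = inner ℝ (gradient f x) v := by
  rw [gradient, InnerProductSpace.toDual_symm_apply]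

theorem IsDefiningFunctionAt.fderiv_pos {φ : EuclideanSpace ℝ (Fin n) → ℝ}
    (hφ : IsDefiningFunctionAt Γ ν p φ) (hν : ∀ p ∈ Γ, ‖ν p‖ = 1) :
    ∀ᶠ x in 𝓝[Γ] p, 0 < fderiv ℝ φ x (ν x) := by
  filter_upwards [hφ.gradient_eq, self_mem_nhdsWithin] with x ⟨c, hc, h⟩ hx
  rw [fderiv_eq_inner_gradient, h, inner_smul_left, real_inner_self_eq_norm_sq, hν x hx]
  simpa using hc

/-- The function `g` represents the hypersurface near `p` as a graph over the hyperplane orthogonal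
to the normal. -/
structure IsGraphAt (Γ : Set (EuclideanSpace ℝ (Fin n)))
    (ν : EuclideanSpace ℝ (Fin n) → EuclideanSpace ℝ (Fin n)) (p : EuclideanSpace ℝ (Fin n))
    (g : (ℝ ∙ ν p)ᗮ → ℝ) : Prop where
  analyticAt : AnalyticAt ℝ g 0
  map_zero : g 0 = 0
  eventually_mem : ∀ᶠ y in 𝓝 0, graphMap p (ν p) g y ∈ Γ

theorem IsOrientedAnalyticHypersurface.exists_isGraphAt
    (hΓ : IsOrientedAnalyticHypersurface Γ ν) (hp : p ∈ Γ) : ∃ g, IsGraphAt Γ ν p g := by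
  obtain ⟨φ, hφ⟩ := hΓ.exists_definingFunction p hp
  have h1 := (hφ.fderiv_pos hΓ.norm_eq_one).self_of_nhdsWithin hp
  have h0 : φ p = 0 := hφ.zero_iff.self_of_nhds.1 hp
  obtain ⟨g, hg, hg0, hgφ⟩ := exists_graph_of_fderiv_pos hφ.analyticAt h0 h1
  refine ⟨g, hg, hg0, ?_⟩
  filter_upwards [hgφ, (tendsto_graphMap (p := p) hg hg0).eventually hφ.zero_iff] with y h2 h3
  exact h3.2 h2

theorem IsGraphAt.eventually_of_eventually_nhdsWithin {g : (ℝ ∙ ν p)ᗮ → ℝ}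
    (hg : IsGraphAt Γ ν p g) {P : EuclideanSpace ℝ (Fin n) → Prop} (h : ∀ᶠ x in 𝓝[Γ] p, P x) :
    ∀ᶠ y in 𝓝 0, P (graphMap p (ν p) g y) := by
  filter_upwards [(tendsto_graphMap (p := p) hg.analyticAt hg.map_zero).eventually
    (eventually_nhdsWithin_iff.1 h), hg.eventually_mem] with y h1 h2
  exact h1 h2

theorem IsGraphAt.eventually_iff_of_isDefiningFunctionAt {g : (ℝ ∙ ν p)ᗮ → ℝ}
    (hg : IsGraphAt Γ ν p g) (hν : ∀ p ∈ Γ, ‖ν p‖ = 1) (hp : p ∈ Γ)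
    {φ : EuclideanSpace ℝ (Fin n) → ℝ} (hφ : IsDefiningFunctionAt Γ ν p φ) :
    ∀ᶠ x in 𝓝 p, (0 < φ x ↔ 0 < heightAbove p (ν p) g x)
      ∧ (φ x = 0 ↔ heightAbove p (ν p) g x = 0) :=
  eventually_pos_iff_heightAbove (hν p hp) hg.analyticAt hg.map_zero hφ.analyticAt
    (hg.eventually_of_eventually_nhdsWithin (by
      filter_upwards [mem_nhdsWithin_of_mem_nhds hφ.zero_iff, self_mem_nhdsWithin] with x h1 h2
      exact h1.1 h2))
    ((hφ.fderiv_pos hν).self_of_nhdsWithin hp)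

/-- An analytic function which vanishes on the hypersurface and has positive normal derivative is a
defining function. -/
theorem IsOrientedAnalyticHypersurface.isDefiningFunctionAt
    (hΓ : IsOrientedAnalyticHypersurface Γ ν) (hp : p ∈ Γ) {f : EuclideanSpace ℝ (Fin n) → ℝ}
    (hf : AnalyticAt ℝ f p) (hf0 : ∀ᶠ x in 𝓝[Γ] p, f x = 0) (hf1 : 0 < fderiv ℝ f p (ν p)) :
    IsDefiningFunctionAt Γ ν p f := by
  obtain ⟨g, hg⟩ := hΓ.exists_isGraphAt hp
  obtain ⟨φ, hφ⟩ := hΓ.exists_definingFunction p hp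
  have hν := hΓ.norm_eq_one p hp
  have hfg := hg.eventually_of_eventually_nhdsWithin hf0
  have h1 := eventually_pos_iff_heightAbove hν hg.analyticAt hg.map_zero hf hfg hf1
  have h2 := hg.eventually_iff_of_isDefiningFunctionAt hΓ.norm_eq_one hp hφ
  have hφg : ∀ᶠ y in 𝓝 0, φ (graphMap p (ν p) g y) = 0 :=
    hg.eventually_of_eventually_nhdsWithin (by
      filter_upwards [mem_nhdsWithin_of_mem_nhds hφ.zero_iff, self_mem_nhdsWithin] with x h1 h2
      exact h1.1 h2)
  have hφ1 := (hφ.fderiv_pos hΓ.norm_eq_one).self_of_nhdsWithin hp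
  refine ⟨hf, ?_, ?_⟩
  · filter_upwards [h1, h2, hφ.zero_iff] with x h3 h4 h5
    rw [h5, h4.2, h3.2]
  · have h3 := (fderiv_graphMap_eq hν hg.analyticAt hg.map_zero hf hfg).and
      (fderiv_graphMap_eq hν hg.analyticAt hg.map_zero hφ.analyticAt hφg)
    have h4 := (tendsto_hyperplaneProj_sub p (ν p)).eventually h3
    have h5 : ∀ᶠ x in 𝓝 p, 0 < fderiv ℝ f x (ν p) ∧ 0 < fderiv ℝ φ x (ν p) :=
      ((analyticAt_fderiv_apply hf (ν p)).continuousAt.eventually (lt_mem_nhds hf1)).and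
        ((analyticAt_fderiv_apply hφ.analyticAt (ν p)).continuousAt.eventually (lt_mem_nhds hφ1))
    filter_upwards [mem_nhdsWithin_of_mem_nhds h4, mem_nhdsWithin_of_mem_nhds h5,
      mem_nhdsWithin_of_mem_nhds h2, mem_nhdsWithin_of_mem_nhds hφ.zero_iff, self_mem_nhdsWithin,
      hφ.gradient_eq] with x h6 h7 h8 h9 hx ⟨c, hc, h10⟩
    have ht : heightAbove p (ν p) g x = 0 := h8.2.1 (h9.1 hx)
    have hxg : graphMap p (ν p) g (hyperplaneProj (ν p) (x - p)) = x := by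
      have := graphMap_add_heightAbove_smul (p := p) (g := g) hν x
      rwa [ht, zero_smul, add_zero] at this
    rw [hxg] at h6
    refine ⟨fderiv ℝ f x (ν p) / fderiv ℝ φ x (ν p) * c, mul_pos (div_pos h7.1 h7.2) hc, ?_⟩
    rw [mul_smul, ← h10]
    refine ext_inner_right ℝ fun v => ?_
    rw [inner_smul_left, ← fderiv_eq_inner_gradient, ← fderiv_eq_inner_gradient, h6.1, h6.2 v]
    have := h7.2.ne'
    simp only [conj_trivial]
    field_simp

theorem IsOneSidedNhd.eventually_mem_iff_heightAbove {Ω : Set (EuclideanSpace ℝ (Fin n))}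
    (hΩ : IsOneSidedNhd Γ ν Ω) (hν : ∀ p ∈ Γ, ‖ν p‖ = 1) (hp : p ∈ Γ) {g : (ℝ ∙ ν p)ᗮ → ℝ}
    (hg : IsGraphAt Γ ν p g) : ∀ᶠ x in 𝓝 p, (x ∈ Ω ↔ 0 < heightAbove p (ν p) g x) := by
  obtain ⟨φ, hφ, h⟩ := hΩ.eventually_mem_iff p hp
  filter_upwards [h, hg.eventually_iff_of_isDefiningFunctionAt hν hp hφ] with x h1 h2
  rw [h1, h2.1]

/-- Near a point of the hypersurface, the points in the normal direction are on the positive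
side. -/
theorem IsOneSidedNhd.eventually_add_smul_mem {Ω : Set (EuclideanSpace ℝ (Fin n))}
    (hΩ : IsOneSidedNhd Γ ν Ω) (hΓ : IsOrientedAnalyticHypersurface Γ ν) (hp : p ∈ Γ) :
    ∀ᶠ s in 𝓝[>] (0 : ℝ), p + s • ν p ∈ Ω := by
  obtain ⟨g, hg⟩ := hΓ.exists_isGraphAt hp
  have h := hΩ.eventually_mem_iff_heightAbove hΓ.norm_eq_one hp hg
  have ht : Tendsto (fun s : ℝ => p + s • ν p) (𝓝[>] 0) (𝓝 p) := by
    have : Tendsto (fun s : ℝ => p + s • ν p) (𝓝 0) (𝓝 (p + (0 : ℝ) • ν p)) :=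
      (Continuous.tendsto (by fun_prop) 0)
    rw [zero_smul, add_zero] at this
    exact this.mono_left nhdsWithin_le_nhds
  filter_upwards [ht.eventually h, self_mem_nhdsWithin] with s h1 h2
  rw [h1]
  have h3 := graphCoord_graphMap_add_smul (p := p) (g := g) (hΓ.norm_eq_one p hp) 0 s
  rw [graphMap_zero hg.map_zero] at h3
  have h4 := congrArg Prod.fst h3
  have h5 : heightAbove p (ν p) g (p + s • ν p) = s := h4
  rw [h5]
  exact h2

theorem IsOneSidedNhd.tendsto_add_smul {Ω : Set (EuclideanSpace ℝ (Fin n))}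
    (hΩ : IsOneSidedNhd Γ ν Ω) (hΓ : IsOrientedAnalyticHypersurface Γ ν) (hp : p ∈ Γ) :
    Tendsto (fun s : ℝ => p + s • ν p) (𝓝[>] 0) (𝓝[Ω] p) := by
  refine tendsto_nhdsWithin_iff.2 ⟨?_, hΩ.eventually_add_smul_mem hΓ hp⟩
  have : Tendsto (fun s : ℝ => p + s • ν p) (𝓝 0) (𝓝 (p + (0 : ℝ) • ν p)) :=
    (Continuous.tendsto (by fun_prop) 0)
  rw [zero_smul, add_zero] at this
  exact this.mono_left nhdsWithin_le_nhds

theorem IsOneSidedNhd.neBot {Ω : Set (EuclideanSpace ℝ (Fin n))}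
    (hΩ : IsOneSidedNhd Γ ν Ω) (hΓ : IsOrientedAnalyticHypersurface Γ ν) (hp : p ∈ Γ) :
    (𝓝[Ω] p).NeBot := (hΩ.tendsto_add_smul hΓ hp).neBot

/-- Identity theorem across the hypersurface. -/
theorem eventually_eq_zero_of_eventually_nhdsWithin {F : Type*} [NormedAddCommGroup F]
    [NormedSpace ℝ F] [CompleteSpace F] {Ω : Set (EuclideanSpace ℝ (Fin n))} (hΩ : IsOpen Ω) [(𝓝[Ω] p).NeBot]
    {f : EuclideanSpace ℝ (Fin n) → F} (hf : AnalyticAt ℝ f p) (h : ∀ᶠ x in 𝓝[Ω] p, f x = 0) :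
    ∀ᶠ x in 𝓝 p, f x = 0 := by
  obtain ⟨r, hr, h1⟩ := Metric.eventually_nhds_iff_ball.1
    (hf.eventually_analyticAt.and (eventually_nhdsWithin_iff.1 h))
  have hb : ∀ᶠ x in 𝓝[Ω] p, x ∈ Metric.ball p r :=
    mem_nhdsWithin_of_mem_nhds (Metric.ball_mem_nhds p hr)
  obtain ⟨z, hz, hzΩ⟩ := (hb.and self_mem_nhdsWithin).exists
  have h2 : AnalyticOnNhd ℝ f (Metric.ball p r) := fun x hx => (h1 x hx).1
  have h3 : f =ᶠ[𝓝 z] 0 := by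
    filter_upwards [Metric.isOpen_ball.mem_nhds hz, hΩ.mem_nhds hzΩ] with x hx hxΩ
    exact (h1 x hx).2 hxΩ
  have h4 := h2.eqOn_zero_of_preconnected_of_eventuallyEq_zero (convex_ball p r).isPreconnected
    hz h3
  filter_upwards [Metric.ball_mem_nhds p hr] with x hx
  exact h4 hx

end Hypersurface

/-! ### The system in polar form -/

section Polar

variable {A : Type*} [CommRing A] [Algebra ℝ A] {ι B : Type*} [Fintype ι]

/-- The Laplacian of a product `ρ ^ κ w`, for derivations; `Q` stands for `ρ ^ (κ - 2)`. -/
theorem sum_derivation_derivation_mul (d : ι → Derivation ℝ A A) {κ : ℝ} {Q ρ : A} {w : B → A}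
    (h1 : ∀ j, d j (Q * ρ) = (κ - 1) • (Q * d j ρ))
    (h2 : ∀ j, d j (Q * ρ ^ 2) = κ • (Q * ρ * d j ρ)) (b : B) :
    ∑ j, d j (d j (Q * ρ ^ 2 * w b)) = Q * polarOp (fun j => d j) κ ρ w b := by
  have key : ∀ j, d j (d j (Q * ρ ^ 2 * w b))
      = Q * ((κ * (κ - 1)) • (d j ρ ^ 2 * w b) + κ • (ρ * (d j (d j ρ) * w b))
        + (2 * κ) • (ρ * (d j ρ * d j (w b))) + ρ ^ 2 * d j (d j (w b))) := by
    intro j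
    rw [Derivation.leibniz, h2]
    simp only [map_add, smul_eq_mul, Derivation.leibniz, h2, h1, Algebra.smul_def, map_mul, map_sub,
      map_one, map_ofNat, Derivation.map_algebraMap]
    ring
  simp only [key, polarOp]
  rw [← Finset.mul_sum]
  simp only [Finset.sum_add_distrib, ← Finset.smul_sum, ← Finset.mul_sum, ← Finset.sum_mul]
  simp only [Algebra.smul_def]
  ring

variable {E : Type*} [NormedAddCommGroup E] [InnerProductSpace ℝ E] [FiniteDimensional ℝ E]
  {p x : E}

/-- The directional derivatives along the vectors of an orthonormal basis. -/
noncomputable def basisDeriv (e : OrthonormalBasis ι ℝ E) (j : ι) (f : E → ℝ) (z : E) : ℝ :=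
  fderiv ℝ f z (e j)

theorem polarOp_apply (e : OrthonormalBasis ι ℝ E) (κ : ℝ) (ρ : E → ℝ) (w : B → E → ℝ) (b : B)
    (z : E) : polarOp (basisDeriv e) κ ρ w b z
      = (κ * (κ - 1) * ∑ j, fderiv ℝ ρ z (e j) ^ 2
          + κ * (ρ z * ∑ j, fderiv ℝ (fun y => fderiv ℝ ρ y (e j)) z (e j))) * w b z
        + 2 * κ * (ρ z * ∑ j, fderiv ℝ ρ z (e j) * fderiv ℝ (w b) z (e j))
        + ρ z ^ 2 * ∑ j, fderiv ℝ (fun y => fderiv ℝ (w b) y (e j)) z (e j) := by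
  simp only [polarOp, Pi.add_apply, Pi.mul_apply, Pi.smul_apply, Finset.sum_apply, Pi.pow_apply,
    smul_eq_mul]
  rfl

theorem analyticAt_polarOp (e : OrthonormalBasis ι ℝ E) (κ : ℝ) {ρ : E → ℝ} {w : B → E → ℝ}
    (hρ : AnalyticAt ℝ ρ p) (hw : ∀ b, AnalyticAt ℝ (w b) p) (b : B) :
    AnalyticAt ℝ (polarOp (basisDeriv e) κ ρ w b) p := by
  have h1 : ∀ {f : E → ℝ}, AnalyticAt ℝ f p → ∀ j, AnalyticAt ℝ (fun z => fderiv ℝ f z (e j)) p :=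
    fun hf j => analyticAt_fderiv_apply hf (e j)
  have h : AnalyticAt ℝ (fun z => (κ * (κ - 1) * ∑ j, fderiv ℝ ρ z (e j) ^ 2
          + κ * (ρ z * ∑ j, fderiv ℝ (fun y => fderiv ℝ ρ y (e j)) z (e j))) * w b z
        + 2 * κ * (ρ z * ∑ j, fderiv ℝ ρ z (e j) * fderiv ℝ (w b) z (e j))
        + ρ z ^ 2 * ∑ j, fderiv ℝ (fun y => fderiv ℝ (w b) y (e j)) z (e j)) p := by
    refine ((((analyticAt_const.mul (Finset.analyticAt_fun_sum _ fun j _ => ?_)).add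
      (analyticAt_const.mul (hρ.mul (Finset.analyticAt_fun_sum _ fun j _ => ?_)))).mul
      (hw b)).add (analyticAt_const.mul (hρ.mul (Finset.analyticAt_fun_sum _ fun j _ => ?_)))).add
      ((hρ.pow 2).mul (Finset.analyticAt_fun_sum _ fun j _ => ?_))
    · exact (h1 hρ j).fun_pow 2
    · exact h1 (h1 hρ j) j
    · exact (h1 hρ j).mul (h1 (hw b) j)
    · exact h1 (h1 (hw b) j) j
  refine h.congr (Eventually.of_forall fun z => ?_)
  exact (polarOp_apply e κ ρ w b z).symm

theorem polarOp_germ (e : OrthonormalBasis ι ℝ E) (κ : ℝ) {ρ : E → ℝ} {w : B → E → ℝ}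
    (hρ : AnalyticAt ℝ ρ p) (hw : ∀ b, AnalyticAt ℝ (w b) p) (b : B) :
    polarOp (fun j => germDeriv p (e j)) κ (germ ρ hρ) (fun b => germ (w b) (hw b)) b
      = germ _ (analyticAt_polarOp e κ hρ hw b) := by
  simp only [polarOp, germDeriv_germ, germ_sq, germ_mul]
  rw [germ_sum, germ_sum, germ_sum, germ_sum]
  simp only [germ_mul, smul_germ, germ_add]
  rw [germ_eq_iff]
  exact Eventually.of_forall fun z => (polarOp_apply e κ ρ w b z).symm

theorem analyticAt_rpow {ρ : E → ℝ} (hρ : AnalyticAt ℝ ρ x) (hx : 0 < ρ x) (s : ℝ) :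
    AnalyticAt ℝ (fun z => ρ z ^ s) x := by
  have h : AnalyticAt ℝ (fun z => Real.exp (Real.log (ρ z) * s)) x := by
    have h2 : AnalyticAt ℝ (fun z => Real.log (ρ z)) x :=
      AnalyticAt.fun_comp (g := Real.log) (analyticAt_log hx) hρ
    exact AnalyticAt.fun_comp (g := Real.exp) analyticAt_rexp (h2.mul analyticAt_const)
  refine h.congr ?_
  filter_upwards [hρ.continuousAt.eventually (lt_mem_nhds hx)] with z hz
  rw [Real.rpow_def_of_pos hz]

theorem germDeriv_rpow {ρ : E → ℝ} (hρ : AnalyticAt ℝ ρ x) (hx : 0 < ρ x) (s : ℝ) (v : E) :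
    germDeriv x v (germ _ (analyticAt_rpow hρ hx s))
      = s • (germ _ (analyticAt_rpow hρ hx (s - 1)) * germDeriv x v (germ ρ hρ)) := by
  rw [germDeriv_germ, germDeriv_germ, germ_mul, smul_germ, germ_eq_iff]
  filter_upwards [hρ.continuousAt.eventually (lt_mem_nhds hx), hρ.eventually_analyticAt]
    with z hz h
  rw [(h.differentiableAt.hasFDerivAt.rpow_const (p := s) (Or.inl hz.ne')).fderiv]
  simp only [FunLike.coe_smul, Pi.smul_apply, smul_eq_mul]
  ring

theorem laplacian_eq_sum_of_analyticAt (e : OrthonormalBasis ι ℝ E) {f : E → ℝ}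
    (hf : AnalyticAt ℝ f x) : Laplacian.laplacian f x
      = ∑ j, fderiv ℝ (fun y => fderiv ℝ f y (e j)) x (e j) := by
  rw [laplacian_eq_iteratedFDeriv_orthonormalBasis f e]
  refine Finset.sum_congr rfl fun j _ => ?_
  rw [iteratedFDeriv_two_apply]
  have hd : DifferentiableAt ℝ (fderiv ℝ f) x := hf.fderiv.differentiableAt
  have := fderiv_clm_apply hd (differentiableAt_const (e j))
  rw [this]
  simp

theorem laplacian_rpow_mul (e : OrthonormalBasis ι ℝ E) {κ : ℝ} {ρ : E → ℝ} {w : B → E → ℝ}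
    (hρ : AnalyticAt ℝ ρ x) (hw : ∀ b, AnalyticAt ℝ (w b) x) (hx : 0 < ρ x) (b : B) :
    Laplacian.laplacian (fun z => ρ z ^ κ * w b z) x
      = ρ x ^ (κ - 2) * polarOp (basisDeriv e) κ ρ w b x := by
  have hu : AnalyticAt ℝ (fun z => ρ z ^ κ * w b z) x := (analyticAt_rpow hρ hx κ).mul (hw b)
  have hpos := hρ.continuousAt.eventually (lt_mem_nhds hx)
  set Q := germ _ (analyticAt_rpow hρ hx (κ - 2)) with hQ
  have e1 : germ _ (analyticAt_rpow hρ hx (κ - 1)) = Q * germ ρ hρ := by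
    rw [hQ, germ_mul, germ_eq_iff]
    filter_upwards [hpos] with z hz
    rw [← Real.rpow_add_one hz.ne']
    ring_nf
  have e2 : germ _ (analyticAt_rpow hρ hx κ) = Q * germ ρ hρ ^ 2 := by
    rw [hQ, germ_sq, germ_mul, germ_eq_iff]
    filter_upwards [hpos] with z hz
    rw [← Real.rpow_add_natCast hz.ne']
    norm_num
  have h := sum_derivation_derivation_mul (fun j => germDeriv x (e j)) (κ := κ) (Q := Q)
    (ρ := germ ρ hρ) (w := fun b => germ (w b) (hw b))
    (by
      intro j
      rw [← e1, germDeriv_rpow hρ hx, hQ]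
      congr 3
      funext z
      ring_nf)
    (by
      intro j
      rw [← e2, germDeriv_rpow hρ hx, e1]) b
  rw [← e2, germ_mul, polarOp_germ, hQ, germ_mul] at h
  simp only [germDeriv_germ] at h
  rw [germ_sum, germ_eq_iff] at h
  rw [laplacian_eq_sum_of_analyticAt e hu]
  exact h.eq_of_nhds

variable [Fintype B]

theorem analyticAt_euclidean_apply {w : E → EuclideanSpace ℝ B} (hw : AnalyticAt ℝ w x) (b : B) :
    AnalyticAt ℝ (fun z => w z b) x :=
  ((EuclideanSpace.proj (𝕜 := ℝ) b).analyticAt _).comp hw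

/-- The system in polar form. -/
theorem laplacian_rpow_smul_eq_iff (e : OrthonormalBasis ι ℝ E) {q : ℝ} (hq : q < 1)
    {ρ : E → ℝ} {w u : E → EuclideanSpace ℝ B}
    (hρ : AnalyticAt ℝ ρ x) (hw : AnalyticAt ℝ w x) (hx : 0 < ρ x) (hwx : ‖w x‖ = 1)
    (hu : u =ᶠ[𝓝 x] fun z => ρ z ^ (2 / (1 - q)) • w z) :
    Laplacian.laplacian u x = ‖u x‖ ^ (q - 1) • u x
      ↔ ∀ b, polarOp (basisDeriv e) (2 / (1 - q)) ρ (fun b z => w z b) b x = w x b := by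
  set κ := 2 / (1 - q) with hκ
  have hq' : 1 - q ≠ 0 := by linarith
  have hκq : κ * (q - 1) = -2 := by
    rw [hκ]
    field_simp
    ring
  have ha : AnalyticAt ℝ (fun z => ρ z ^ κ • w z) x := (analyticAt_rpow hρ hx κ).smul hw
  rw [(laplacian_congr_nhds hu).eq_of_nhds, hu.eq_of_nhds]
  have hc : ∀ b, Laplacian.laplacian (fun z => ρ z ^ κ • w z) x b
      = ρ x ^ (κ - 2) * polarOp (basisDeriv e) κ ρ (fun b z => w z b) b x := by
    intro b
    rw [← laplacian_rpow_mul e hρ (fun b => analyticAt_euclidean_apply hw b) hx]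
    exact (ContDiffAt.laplacian_CLM_comp_left (l := EuclideanSpace.proj (𝕜 := ℝ) b)
      ha.contDiffAt).symm
  have hn : ‖ρ x ^ κ • w x‖ ^ (q - 1) • ρ x ^ κ • w x = ρ x ^ (κ - 2) • w x := by
    rw [norm_smul, hwx, mul_one, Real.norm_of_nonneg (Real.rpow_nonneg hx.le _),
      ← Real.rpow_mul hx.le, hκq, smul_smul, ← Real.rpow_add hx]
    ring_nf
  have hpos : ρ x ^ (κ - 2) ≠ 0 := (Real.rpow_pos_of_pos hx _).ne'
  rw [hn]
  constructor
  · intro h b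
    have := hc b
    rw [h, PiLp.smul_apply, smul_eq_mul] at this
    exact (mul_left_cancel₀ hpos this).symm
  · intro h
    ext b
    rw [hc, h, PiLp.smul_apply, smul_eq_mul]

end Polar

/-! ### Local solutions in polar form -/

section PolarSolution

variable {n m : ℕ} {κ : ℝ} {Γ : Set (EuclideanSpace ℝ (Fin n))}
  {ν : EuclideanSpace ℝ (Fin n) → EuclideanSpace ℝ (Fin n)}
  {V : EuclideanSpace ℝ (Fin n) → EuclideanSpace ℝ (Fin m)}
  {p : EuclideanSpace ℝ (Fin n)}

/-- The pair `(ρ, w)` solves the polar form of the system near the point `p` of the hypersurface,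
on both sides of it, with `ρ = 0` and `w = V` on the hypersurface. -/
structure IsPolarSolutionAt (κ : ℝ) (Γ : Set (EuclideanSpace ℝ (Fin n)))
    (ν : EuclideanSpace ℝ (Fin n) → EuclideanSpace ℝ (Fin n))
    (V : EuclideanSpace ℝ (Fin n) → EuclideanSpace ℝ (Fin m))
    (p : EuclideanSpace ℝ (Fin n)) (ρ : EuclideanSpace ℝ (Fin n) → ℝ)
    (w : EuclideanSpace ℝ (Fin n) → EuclideanSpace ℝ (Fin m)) : Prop where
  analyticAt_modulus : AnalyticAt ℝ ρ p
  analyticAt_direction : AnalyticAt ℝ w p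
  norm_direction : ∀ᶠ x in 𝓝 p, ‖w x‖ = 1
  equation : ∀ᶠ x in 𝓝 p, ∀ b, polarOp (basisDeriv (EuclideanSpace.basisFun (Fin n) ℝ)) κ ρ
    (fun b z => w z b) b x = w x b
  modulus_eq_zero : ∀ᶠ x in 𝓝[Γ] p, ρ x = 0
  direction_eq : ∀ᶠ x in 𝓝[Γ] p, w x = V x
  slope_nonneg : 0 ≤ fderiv ℝ ρ p (ν p)

theorem norm_eq_one_iff_sum_sq (x : EuclideanSpace ℝ (Fin m)) :
    ‖x‖ = 1 ↔ ∑ b, x b ^ 2 = 1 := by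
  rw [← EuclideanSpace.real_norm_sq_eq]
  constructor
  · intro h
    rw [h, one_pow]
  · intro h
    exact (pow_eq_one_iff_of_nonneg (norm_nonneg x) two_ne_zero).1 h

variable {ρ ρ' : EuclideanSpace ℝ (Fin n) → ℝ}
  {w w' : EuclideanSpace ℝ (Fin n) → EuclideanSpace ℝ (Fin m)}

theorem sum_germ_sq_eq_one {E : Type*} [NormedAddCommGroup E] [NormedSpace ℝ E] {p : E}
    {f : Fin m → E → ℝ} (hf : ∀ b, AnalyticAt ℝ (f b) p) (h : ∀ᶠ x in 𝓝 p, ∑ b, f b x ^ 2 = 1) :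
    ∑ b, germ (f b) (hf b) ^ 2 = 1 := by
  have h1 : ∀ b, germ (f b) (hf b) ^ 2 = germ (fun x => f b x ^ 2) ((hf b).fun_pow 2) := fun b => by
    rw [sq, germ_mul, germ_eq_iff]
    exact Eventually.of_forall fun x => (sq (f b x)).symm
  simp only [h1]
  rw [germ_sum, germ_one, germ_eq_iff]
  exact h

theorem IsPolarSolutionAt.analyticAt_apply (h : IsPolarSolutionAt κ Γ ν V p ρ w) (b : Fin m) :
    AnalyticAt ℝ (fun x => w x b) p := analyticAt_euclidean_apply h.analyticAt_direction b

theorem IsPolarSolutionAt.sum_sq (h : IsPolarSolutionAt κ Γ ν V p ρ w) :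
    ∑ b, germ (fun x => w x b) (h.analyticAt_apply b) ^ 2 = 1 :=
  sum_germ_sq_eq_one (f := fun b x => w x b) _
    (h.norm_direction.mono fun _ hx => (norm_eq_one_iff_sum_sq _).1 hx)

theorem IsPolarSolutionAt.polarOp_germ_eq (h : IsPolarSolutionAt κ Γ ν V p ρ w) (b : Fin m) :
    polarOp (fun j => germDeriv p (EuclideanSpace.basisFun (Fin n) ℝ j)) κ
      (germ ρ h.analyticAt_modulus) (fun b => germ (fun x => w x b) (h.analyticAt_apply b)) b
      = germ (fun x => w x b) (h.analyticAt_apply b) := by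
  rw [polarOp_germ (EuclideanSpace.basisFun (Fin n) ℝ) κ h.analyticAt_modulus h.analyticAt_apply b,
    germ_eq_iff]
  exact h.equation.mono fun x hx => hx b

variable {g : (ℝ ∙ ν p)ᗮ → ℝ}

theorem IsPolarSolutionAt.graphRestrict_modulus (h : IsPolarSolutionAt κ Γ ν V p ρ w)
    (hg : IsGraphAt Γ ν p g) :
    graphRestrict hg.analyticAt hg.map_zero (germ ρ h.analyticAt_modulus) = 0 := by
  rw [graphRestrict_germ, germ_zero, germ_eq_iff]
  exact hg.eventually_of_eventually_nhdsWithin h.modulus_eq_zero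

theorem IsPolarSolutionAt.graphRestrict_slope (h : IsPolarSolutionAt κ Γ ν V p ρ w)
    (hg : IsGraphAt Γ ν p g) (hν : ‖ν p‖ = 1) (hκ : 1 < κ) :
    graphRestrict hg.analyticAt hg.map_zero (germDeriv p (ν p) (germ ρ h.analyticAt_modulus))
      = germ _ (analyticAt_normalSlope (EuclideanSpace.basisFun (Fin n) ℝ) hν hκ
        hg.analyticAt) := by
  have h1 := sq_graphRestrict_eq (EuclideanSpace.basisFun (Fin n) ℝ) hν hκ hg.analyticAt
    hg.map_zero (h.graphRestrict_modulus hg) h.sum_sq h.polarOp_germ_eq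
  rw [germDeriv_germ, graphRestrict_germ] at h1 ⊢
  rw [sq, sq, germ_mul, germ_mul, germ_eq_iff] at h1
  have hc : ContinuousAt (fun y => fderiv ℝ ρ (graphMap p (ν p) g y) (ν p)) 0 := by
    have h2 : AnalyticAt ℝ (fun x => fderiv ℝ ρ x (ν p)) (graphMap p (ν p) g 0) := by
      rw [graphMap_zero hg.map_zero]
      exact analyticAt_fderiv_apply h.analyticAt_modulus _
    exact h2.continuousAt.comp (f := graphMap p (ν p) g)
      (analyticAt_graphMap hg.analyticAt).continuousAt
  have h0 : 0 < fderiv ℝ ρ (graphMap p (ν p) g 0) (ν p) := by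
    have e := h1.eq_of_nhds
    have hpos := normalSlope_pos (ν := ν p) (g := g) (EuclideanSpace.basisFun (Fin n) ℝ) κ 0
    refine lt_of_le_of_ne ?_ fun h3 => ?_
    · rw [graphMap_zero hg.map_zero]
      exact h.slope_nonneg
    · rw [← h3, mul_zero] at e
      exact (mul_pos hpos hpos).ne e
  rw [germ_eq_iff]
  filter_upwards [h1, hc.eventually (lt_mem_nhds h0)] with y h2 h3
  exact (mul_self_inj h3.le (normalSlope_pos _ _ _).le).1 h2

theorem IsPolarSolutionAt.slope_pos (h : IsPolarSolutionAt κ Γ ν V p ρ w)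
    (hΓ : IsOrientedAnalyticHypersurface Γ ν) (hp : p ∈ Γ) (hκ : 1 < κ) :
    0 < fderiv ℝ ρ p (ν p) := by
  obtain ⟨g, hg⟩ := hΓ.exists_isGraphAt hp
  have h1 := h.graphRestrict_slope hg (hΓ.norm_eq_one p hp) hκ
  rw [germDeriv_germ, graphRestrict_germ, germ_eq_iff] at h1
  have h2 := h1.eq_of_nhds
  beta_reduce at h2
  rw [graphMap_zero hg.map_zero] at h2
  rw [h2]
  exact normalSlope_pos _ _ _

theorem IsPolarSolutionAt.isDefiningFunctionAt (h : IsPolarSolutionAt κ Γ ν V p ρ w)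
    (hΓ : IsOrientedAnalyticHypersurface Γ ν) (hp : p ∈ Γ) (hκ : 1 < κ) :
    IsDefiningFunctionAt Γ ν p ρ :=
  hΓ.isDefiningFunctionAt hp h.analyticAt_modulus h.modulus_eq_zero (h.slope_pos hΓ hp hκ)

theorem IsPolarSolutionAt.eventually (h : IsPolarSolutionAt κ Γ ν V p ρ w)
    (hΓ : IsOrientedAnalyticHypersurface Γ ν) (hp : p ∈ Γ) (hκ : 1 < κ) :
    ∀ᶠ x in 𝓝[Γ] p, IsPolarSolutionAt κ Γ ν V x ρ w := by
  have h0 := h.isDefiningFunctionAt hΓ hp hκ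
  filter_upwards [mem_nhdsWithin_of_mem_nhds h.analyticAt_modulus.eventually_analyticAt,
    mem_nhdsWithin_of_mem_nhds h.analyticAt_direction.eventually_analyticAt,
    mem_nhdsWithin_of_mem_nhds h.norm_direction.eventually_nhds,
    mem_nhdsWithin_of_mem_nhds h.equation.eventually_nhds,
    eventually_eventually_nhdsWithin.2 h.modulus_eq_zero,
    eventually_eventually_nhdsWithin.2 h.direction_eq,
    h0.fderiv_pos hΓ.norm_eq_one] with x h1 h2 h3 h4 h5 h6 h7
  exact ⟨h1, h2, h3, h4, h5, h6, h7.le⟩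

/-- Local uniqueness for the polar form of the system. -/
theorem IsPolarSolutionAt.unique (h : IsPolarSolutionAt κ Γ ν V p ρ w)
    (h' : IsPolarSolutionAt κ Γ ν V p ρ' w') (hΓ : IsOrientedAnalyticHypersurface Γ ν)
    (hp : p ∈ Γ) (hκ : 1 < κ) : ρ =ᶠ[𝓝 p] ρ' ∧ w =ᶠ[𝓝 p] w' := by
  obtain ⟨g, hg⟩ := hΓ.exists_isGraphAt hp
  have hν := hΓ.norm_eq_one p hp
  have h1 := germ_solution_unique (EuclideanSpace.basisFun (Fin n) ℝ) hν hκ hg.analyticAt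
    hg.map_zero (h.graphRestrict_modulus hg) (h.graphRestrict_slope hg hν hκ) h.sum_sq
    h.polarOp_germ_eq (h'.graphRestrict_modulus hg) (h'.graphRestrict_slope hg hν hκ) h'.sum_sq
    h'.polarOp_germ_eq (by
      intro b
      rw [graphRestrict_germ, graphRestrict_germ, germ_eq_iff]
      filter_upwards [hg.eventually_of_eventually_nhdsWithin h.direction_eq,
        hg.eventually_of_eventually_nhdsWithin h'.direction_eq] with y h1 h2
      rw [h1, h2])
  refine ⟨germ_eq_iff.1 h1.1, ?_⟩
  have h2 : ∀ b, ∀ᶠ x in 𝓝 p, w x b = w' x b := fun b => germ_eq_iff.1 (congrFun h1.2 b)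
  filter_upwards [eventually_all.2 h2] with x hx
  ext b
  exact hx b

/-- Local existence for the polar form of the system. -/
theorem exists_isPolarSolutionAt (hΓ : IsOrientedAnalyticHypersurface Γ ν)
    (hV : IsAnalyticSphereMap Γ V) (hp : p ∈ Γ) (hκ : 1 < κ) :
    ∃ ρ w, IsPolarSolutionAt κ Γ ν V p ρ w := by
  obtain ⟨g, hg⟩ := hΓ.exists_isGraphAt hp
  have hν := hΓ.norm_eq_one p hp
  obtain ⟨F, hF, hVF⟩ := hV.analytic p hp
  have hFγ : ∀ b, AnalyticAt ℝ (fun y => F (graphMap p (ν p) g y) b) 0 := fun b => by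
    refine AnalyticAt.fun_comp (g := fun x => F x b) ?_ (analyticAt_graphMap hg.analyticAt)
    rw [graphMap_zero hg.map_zero]
    exact analyticAt_euclidean_apply hF b
  obtain ⟨R, W, hR0, hR1, hW, hsq, hE⟩ := exists_germ_solution (p := p)
    (EuclideanSpace.basisFun (Fin n) ℝ) hν hκ hg.analyticAt hg.map_zero
    (V := fun b => germ _ (hFγ b)) (sum_germ_sq_eq_one (f := fun b y => F (graphMap p (ν p) g y) b) _
      (by
        filter_upwards [hg.eventually_of_eventually_nhdsWithin hVF, hg.eventually_mem] with y h1 h2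
        rw [← norm_eq_one_iff_sum_sq, ← h1]
        exact hV.norm_eq_one _ h2))
  obtain ⟨ρ, hρ, rfl⟩ := exists_germ_eq R
  choose f hf hfW using fun b => exists_germ_eq (W b)
  obtain rfl : (fun b => germ (f b) (hf b)) = W := funext hfW
  have hproj := tendsto_hyperplaneProj_sub p (ν p)
  obtain ⟨φ, hφ⟩ := hΓ.exists_definingFunction p hp
  have hmem : ∀ᶠ x in 𝓝[Γ] p, graphMap p (ν p) g (hyperplaneProj (ν p) (x - p)) = x := by
    filter_upwards [mem_nhdsWithin_of_mem_nhds hφ.zero_iff, self_mem_nhdsWithin,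
      mem_nhdsWithin_of_mem_nhds
        (hg.eventually_iff_of_isDefiningFunctionAt hΓ.norm_eq_one hp hφ)] with x h1 h2 h3
    have h4 := graphMap_add_heightAbove_smul (p := p) (g := g) hν x
    rwa [h3.2.1 (h1.1 h2), zero_smul, add_zero] at h4
  have onΓ : ∀ {P : EuclideanSpace ℝ (Fin n) → Prop},
      (∀ᶠ y in 𝓝 0, P (graphMap p (ν p) g y)) → ∀ᶠ x in 𝓝[Γ] p, P x := by
    intro P hP
    filter_upwards [hmem, mem_nhdsWithin_of_mem_nhds (hproj.eventually hP)] with x h1 h2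
    rwa [h1] at h2
  refine ⟨ρ, fun x => WithLp.toLp 2 fun b => f b x, hρ, ?_, ?_, ?_, ?_, ?_, ?_⟩
  · exact ((PiLp.continuousLinearEquiv 2 ℝ (fun _ : Fin m => ℝ)).symm.analyticAt _).comp
      (analyticAt_pi_iff.2 hf)
  · simp only [germ_sq] at hsq
    rw [germ_sum, germ_one, germ_eq_iff] at hsq
    exact hsq.mono fun x hx => (norm_eq_one_iff_sum_sq _).2 hx
  · refine eventually_all.2 fun b => ?_
    have h1 := hE b
    rw [polarOp_germ (EuclideanSpace.basisFun (Fin n) ℝ) κ hρ hf b, germ_eq_iff] at h1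
    exact h1
  · rw [graphRestrict_germ, germ_zero, germ_eq_iff] at hR0
    exact onΓ hR0
  · have h1 : ∀ b, ∀ᶠ y in 𝓝 0, f b (graphMap p (ν p) g y) = F (graphMap p (ν p) g y) b := by
      intro b
      have h2 := hW b
      rw [graphRestrict_germ, germ_eq_iff] at h2
      exact h2
    filter_upwards [onΓ (P := fun x => ∀ b, f b x = F x b) (eventually_all.2 h1), hVF] with x h2 h3
    ext b
    rw [h3]
    exact h2 b
  · rw [germDeriv_germ, graphRestrict_germ, germ_eq_iff] at hR1
    have h2 := hR1.eq_of_nhds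
    beta_reduce at h2
    rw [graphMap_zero hg.map_zero] at h2
    rw [h2]
    exact (normalSlope_pos _ _ _).le

end PolarSolution

/-! ### Uniqueness of local solutions -/

section Uniqueness

variable {n m : ℕ} {q : ℝ} {Γ : Set (EuclideanSpace ℝ (Fin n))}
  {ν : EuclideanSpace ℝ (Fin n) → EuclideanSpace ℝ (Fin n)}
  {V : EuclideanSpace ℝ (Fin n) → EuclideanSpace ℝ (Fin m)}
  {p : EuclideanSpace ℝ (Fin n)}

theorem eq_rpow_smul_of_modulus_direction {E : Type*} [NormedAddCommGroup E] [NormedSpace ℝ E]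
    {κ : ℝ} (hκ : κ ≠ 0) {v : E} (hv : v ≠ 0) : v = (‖v‖ ^ (1 / κ)) ^ κ • ‖v‖⁻¹ • v := by
  rw [← Real.rpow_mul (norm_nonneg v), one_div, inv_mul_cancel₀ hκ, Real.rpow_one, smul_smul,
    mul_inv_cancel₀ (norm_ne_zero_iff.2 hv), one_smul]

/-- The modulus and the direction of a local solution extend to a solution of the polar form of the
system on both sides of the hypersurface. -/
theorem IsLocalSolution.exists_isPolarSolutionAt {Ω : Set (EuclideanSpace ℝ (Fin n))}
    {u : EuclideanSpace ℝ (Fin n) → EuclideanSpace ℝ (Fin m)} (hq : q < 1)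
    (h : IsLocalSolution q Γ ν V Ω u) (hΓ : IsOrientedAnalyticHypersurface Γ ν) (hp : p ∈ Γ) :
    ∃ ρ w, IsPolarSolutionAt (2 / (1 - q)) Γ ν V p ρ w ∧
      ∀ᶠ x in 𝓝[Ω] p, u x = ρ x ^ (2 / (1 - q)) • w x := by
  have hκ : 0 < 2 / (1 - q) := div_pos two_pos (by linarith)
  obtain ⟨ρ, hρ, hρu⟩ := h.analytic_modulus p (Or.inr hp)
  obtain ⟨w, hw, hwu⟩ := h.analytic_direction p (Or.inr hp)
  have hΩ := h.isOneSidedNhd.isOpen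
  have := h.isOneSidedNhd.neBot hΓ hp
  have hu : ∀ᶠ x in 𝓝[Ω] p, u x = ρ x ^ (2 / (1 - q)) • w x := by
    filter_upwards [hρu, hwu, self_mem_nhdsWithin] with x h1 h2 h3
    rw [← h1, ← h2]
    exact eq_rpow_smul_of_modulus_direction hκ.ne' (h.ne_zero x h3)
  have hnorm : ∀ᶠ x in 𝓝[Ω] p, ‖w x‖ = 1 := by
    filter_upwards [hwu, self_mem_nhdsWithin] with x h1 h2
    rw [← h1, norm_smul, norm_inv, norm_norm,
      inv_mul_cancel₀ (norm_ne_zero_iff.2 (h.ne_zero x h2))]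
  refine ⟨ρ, w, ⟨hρ, hw, ?_, ?_, ?_, ?_, ?_⟩, hu⟩
  · have ha : AnalyticAt ℝ (fun x => ∑ b, w x b ^ 2 - 1) p :=
      (Finset.analyticAt_fun_sum _ fun b _ =>
        (analyticAt_euclidean_apply hw b).fun_pow 2).sub analyticAt_const
    filter_upwards [eventually_eq_zero_of_eventually_nhdsWithin hΩ ha
      (hnorm.mono fun x hx => sub_eq_zero.2 ((norm_eq_one_iff_sum_sq _).1 hx))] with x hx
    exact (norm_eq_one_iff_sum_sq _).2 (sub_eq_zero.1 hx)
  · have hE : ∀ᶠ x in 𝓝[Ω] p, ∀ b, polarOp (basisDeriv (EuclideanSpace.basisFun (Fin n) ℝ))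
        (2 / (1 - q)) ρ (fun b z => w z b) b x = w x b := by
      filter_upwards [hρu, hnorm, eventually_eventually_nhdsWithin.2 hu, self_mem_nhdsWithin,
        mem_nhdsWithin_of_mem_nhds hρ.eventually_analyticAt,
        mem_nhdsWithin_of_mem_nhds hw.eventually_analyticAt] with x h1 h2 h3 h4 h5 h6
      rw [hΩ.nhdsWithin_eq h4] at h3
      have hpos : 0 < ‖u x‖ := norm_pos_iff.2 (h.ne_zero x h4)
      have hρx : 0 < ρ x := by
        rw [← h1]
        exact Real.rpow_pos_of_pos hpos _
      refine (laplacian_rpow_smul_eq_iff _ hq h5 h6 hρx h2 h3).1 ?_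
      rw [h.isSolution.2 x h4, indicator_of_mem]
      exact hpos
    refine eventually_all.2 fun b => ?_
    have ha := (analyticAt_polarOp (EuclideanSpace.basisFun (Fin n) ℝ) (2 / (1 - q)) hρ
      (fun b => analyticAt_euclidean_apply hw b) b).sub (analyticAt_euclidean_apply hw b)
    filter_upwards [eventually_eq_zero_of_eventually_nhdsWithin hΩ ha
      (hE.mono fun x hx => sub_eq_zero.2 (hx b))] with x hx
    exact sub_eq_zero.1 hx
  · filter_upwards [self_mem_nhdsWithin, mem_nhdsWithin_of_mem_nhds hρ.eventually_analyticAt,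
      mem_nhdsWithin_of_mem_nhds (eventually_nhdsWithin_iff.1 hρu).eventually_nhds] with x hx h1 h2
    have := h.isOneSidedNhd.neBot hΓ hx
    have h3 : Tendsto ρ (𝓝[Ω] x) (𝓝 (ρ x)) := h1.continuousAt.tendsto.mono_left nhdsWithin_le_nhds
    have h4 : Tendsto (fun x => ‖u x‖ ^ (1 / (2 / (1 - q)))) (𝓝[Ω] x)
        (𝓝 (‖(0 : EuclideanSpace ℝ (Fin m))‖ ^ (1 / (2 / (1 - q))))) :=
      (h.tendsto_zero x hx).norm.rpow_const (Or.inr (by positivity))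
    rw [norm_zero, Real.zero_rpow (by positivity)] at h4
    exact tendsto_nhds_unique h3 (h4.congr' (eventually_nhdsWithin_iff.2 h2))
  · filter_upwards [self_mem_nhdsWithin, mem_nhdsWithin_of_mem_nhds hw.eventually_analyticAt,
      mem_nhdsWithin_of_mem_nhds (eventually_nhdsWithin_iff.1 hwu).eventually_nhds] with x hx h1 h2
    have := h.isOneSidedNhd.neBot hΓ hx
    have h3 : Tendsto w (𝓝[Ω] x) (𝓝 (w x)) := h1.continuousAt.tendsto.mono_left nhdsWithin_le_nhds
    exact tendsto_nhds_unique h3 ((h.tendsto_direction x hx).congr'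
      (eventually_nhdsWithin_iff.2 h2))
  · have hρp : 0 ≤ fderiv ℝ ρ p (ν p) := by
      have hline : HasDerivAt (fun s : ℝ => p + s • ν p) (ν p) 0 := by
        simpa using ((hasDerivAt_id (0 : ℝ)).smul_const (ν p)).const_add p
      have hρ' : HasFDerivAt ρ (fderiv ℝ ρ p) (p + (0 : ℝ) • ν p) := by
        rw [zero_smul, add_zero]
        exact hρ.differentiableAt.hasFDerivAt
      have hd : HasDerivAt (fun s : ℝ => ρ (p + s • ν p)) (fderiv ℝ ρ p (ν p)) 0 :=
        hρ'.comp_hasDerivAt (0 : ℝ) hline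
      have ht : Tendsto (fun s : ℝ => p + s • ν p) (𝓝[>] 0) (𝓝[Ω] p) :=
        h.isOneSidedNhd.tendsto_add_smul hΓ hp
      have hρ0 : ρ p ≤ 0 := by
        have h3 : Tendsto ρ (𝓝[Ω] p) (𝓝 (ρ p)) :=
          hρ.continuousAt.tendsto.mono_left nhdsWithin_le_nhds
        have h4 : Tendsto (fun x => ‖u x‖ ^ (1 / (2 / (1 - q)))) (𝓝[Ω] p)
            (𝓝 (‖(0 : EuclideanSpace ℝ (Fin m))‖ ^ (1 / (2 / (1 - q))))) :=
          (h.tendsto_zero p hp).norm.rpow_const (Or.inr (by positivity))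
        rw [norm_zero, Real.zero_rpow (by positivity)] at h4
        exact (tendsto_nhds_unique h3 (h4.congr' hρu)).le
      refine ge_of_tendsto hd.tendsto_slope_zero_right ?_
      filter_upwards [ht.eventually hρu, self_mem_nhdsWithin] with s h1 h2
      have h3 : 0 ≤ ρ (p + s • ν p) := by
        rw [← h1]
        exact Real.rpow_nonneg (norm_nonneg _) _
      rw [zero_add, zero_smul, add_zero, smul_eq_mul]
      exact mul_nonneg (inv_nonneg.2 (le_of_lt h2)) (by linarith)
    exact hρp

/-- Two local solutions on the same side agree near the hypersurface. -/
theorem IsLocalSolution.unique {Ω₁ Ω₂ : Set (EuclideanSpace ℝ (Fin n))}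
    {u₁ u₂ : EuclideanSpace ℝ (Fin n) → EuclideanSpace ℝ (Fin m)} (hq0 : 0 ≤ q) (hq : q < 1)
    (hΓ : IsOrientedAnalyticHypersurface Γ ν) (h₁ : IsLocalSolution q Γ ν V Ω₁ u₁)
    (h₂ : IsLocalSolution q Γ ν V Ω₂ u₂) :
    ∃ N : Set (EuclideanSpace ℝ (Fin n)), IsOpen N ∧ Γ ⊆ N ∧ N ∩ Ω₁ = N ∩ Ω₂ ∧
        EqOn u₁ u₂ (N ∩ Ω₁) := by
  have hκ : 1 < 2 / (1 - q) := by
    rw [lt_div_iff₀ (by linarith)]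
    linarith
  refine ⟨interior {x | (x ∈ Ω₁ ↔ x ∈ Ω₂) ∧ (x ∈ Ω₁ → u₁ x = u₂ x)}, isOpen_interior, ?_, ?_, ?_⟩
  · intro p hp
    rw [mem_interior_iff_mem_nhds]
    obtain ⟨ρ₁, w₁, hs₁, hu₁⟩ := h₁.exists_isPolarSolutionAt hq hΓ hp
    obtain ⟨ρ₂, w₂, hs₂, hu₂⟩ := h₂.exists_isPolarSolutionAt hq hΓ hp
    obtain ⟨hρ, hw⟩ := hs₁.unique hs₂ hΓ hp hκ
    obtain ⟨g, hg⟩ := hΓ.exists_isGraphAt hp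
    filter_upwards [hρ, hw, eventually_nhdsWithin_iff.1 hu₁, eventually_nhdsWithin_iff.1 hu₂,
      h₁.isOneSidedNhd.eventually_mem_iff_heightAbove hΓ.norm_eq_one hp hg,
      h₂.isOneSidedNhd.eventually_mem_iff_heightAbove hΓ.norm_eq_one hp hg] with x e1 e2 e3 e4 e5 e6
    have e7 : x ∈ Ω₁ ↔ x ∈ Ω₂ := e5.trans e6.symm
    exact ⟨e7, fun hx => by rw [e3 hx, e4 (e7.1 hx), e1, e2]⟩
  · ext x
    exact and_congr_right fun hx => (interior_subset hx).1
  · intro x hx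
    exact (interior_subset hx.1).2 hx.2

end Uniqueness

/-! ### Existence of local solutions -/

section Existence

variable {n m : ℕ} {q κ : ℝ} {Γ : Set (EuclideanSpace ℝ (Fin n))}
  {ν : EuclideanSpace ℝ (Fin n) → EuclideanSpace ℝ (Fin n)}
  {V : EuclideanSpace ℝ (Fin n) → EuclideanSpace ℝ (Fin m)}
  {p : EuclideanSpace ℝ (Fin n)} {ρ ρ' : EuclideanSpace ℝ (Fin n) → ℝ}
  {w w' : EuclideanSpace ℝ (Fin n) → EuclideanSpace ℝ (Fin m)}

theorem IsPolarSolutionAt.congr (h : IsPolarSolutionAt κ Γ ν V p ρ w) (hρ : ρ =ᶠ[𝓝 p] ρ')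
    (hw : w =ᶠ[𝓝 p] w') : IsPolarSolutionAt κ Γ ν V p ρ' w' := by
  have hρ' : AnalyticAt ℝ ρ' p := h.analyticAt_modulus.congr hρ
  have hw' : AnalyticAt ℝ w' p := h.analyticAt_direction.congr hw
  refine ⟨hρ', hw', ?_, ?_, ?_, ?_, ?_⟩
  · filter_upwards [h.norm_direction, hw] with x h1 h2
    rwa [← h2]
  · refine eventually_all.2 fun b => ?_
    have h1 := h.polarOp_germ_eq b
    have e1 : germ ρ h.analyticAt_modulus = germ ρ' hρ' := germ_eq_iff.2 hρ
    have e2 : ∀ b, germ (fun x => w x b) (h.analyticAt_apply b)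
        = germ (fun x => w' x b) (analyticAt_euclidean_apply hw' b) := fun b =>
      germ_eq_iff.2 (hw.mono fun x hx => by beta_reduce; rw [hx])
    simp only [e1, e2] at h1
    rw [polarOp_germ (EuclideanSpace.basisFun (Fin n) ℝ) κ hρ'
      (fun b => analyticAt_euclidean_apply hw' b) b, germ_eq_iff] at h1
    exact h1
  · filter_upwards [h.modulus_eq_zero, mem_nhdsWithin_of_mem_nhds hρ] with x h1 h2
    rw [← h2, h1]
  · filter_upwards [h.direction_eq, mem_nhdsWithin_of_mem_nhds hw] with x h1 h2
    rw [← h2, h1]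
  · rw [← hρ.fderiv_eq]
    exact h.slope_nonneg

/-- The local solutions of the polar form of the system fit together. -/
theorem exists_global_polar_solution (hΓ : IsOrientedAnalyticHypersurface Γ ν)
    (hV : IsAnalyticSphereMap Γ V) (hκ : 1 < κ) :
    ∃ (N : Set (EuclideanSpace ℝ (Fin n))) (ρ : EuclideanSpace ℝ (Fin n) → ℝ)
      (w : EuclideanSpace ℝ (Fin n) → EuclideanSpace ℝ (Fin m)), IsOpen N ∧ Γ ⊆ N ∧
      (∀ p ∈ Γ, IsPolarSolutionAt κ Γ ν V p ρ w) ∧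
      ∀ x ∈ N, AnalyticAt ℝ ρ x ∧ AnalyticAt ℝ w x ∧ ‖w x‖ = 1 ∧
        ∀ b, polarOp (basisDeriv (EuclideanSpace.basisFun (Fin n) ℝ)) κ ρ
          (fun b z => w z b) b x = w x b := by
  choose! ρ w h using fun p (hp : p ∈ Γ) => exists_isPolarSolutionAt hΓ hV hp hκ
  have hr : ∀ p ∈ Γ, ∃ r > 0, ∀ x ∈ Metric.ball p r,
      (AnalyticAt ℝ (ρ p) x ∧ AnalyticAt ℝ (w p) x ∧ ‖w p x‖ = 1 ∧
        ∀ b, polarOp (basisDeriv (EuclideanSpace.basisFun (Fin n) ℝ)) κ (ρ p)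
          (fun b z => w p z b) b x = w p x b) ∧
      (x ∈ Γ → IsPolarSolutionAt κ Γ ν V x (ρ p) (w p)) := by
    intro p hp
    exact Metric.eventually_nhds_iff_ball.1
      (((h p hp).analyticAt_modulus.eventually_analyticAt.and
        ((h p hp).analyticAt_direction.eventually_analyticAt.and
          ((h p hp).norm_direction.and (h p hp).equation))).and
        (eventually_nhdsWithin_iff.1 ((h p hp).eventually hΓ hp hκ)))
  choose! r hr0 hr using hr
  -- With balls of a quarter of the radius, one of two overlapping balls lies, with its centre, in
  -- the domain of the solution which belongs to the other.
  have aux : ∀ p ∈ Γ, ∀ p' ∈ Γ, r p ≤ r p' → ∀ x ∈ Metric.ball p (r p / 4),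
      x ∈ Metric.ball p' (r p' / 4) → ρ p x = ρ p' x ∧ w p x = w p' x := by
    intro p hp p' hp' hle x hx hx'
    have hsub : Metric.ball p (r p / 4) ⊆ Metric.ball p' (r p') := by
      intro y hy
      rw [Metric.mem_ball] at *
      have h1 := dist_triangle4 y p x p'
      rw [dist_comm p x] at h1
      linarith [hr0 p' hp']
    have hsub' : Metric.ball p (r p / 4) ⊆ Metric.ball p (r p) :=
      Metric.ball_subset_ball (by linarith [hr0 p hp])
    have hpp : p ∈ Metric.ball p (r p / 4) := Metric.mem_ball_self (by linarith [hr0 p hp])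
    obtain ⟨e1, e2⟩ := (h p hp).unique ((hr p' hp' p (hsub hpp)).2 hp) hΓ hp hκ
    have hc : IsPreconnected (Metric.ball p (r p / 4)) := (convex_ball p _).isPreconnected
    refine ⟨?_, ?_⟩
    · exact AnalyticOnNhd.eqOn_of_preconnected_of_eventuallyEq (𝕜 := ℝ)
        (fun y hy => (hr p hp y (hsub' hy)).1.1) (fun y hy => (hr p' hp' y (hsub hy)).1.1)
        hc hpp e1 hx
    · exact AnalyticOnNhd.eqOn_of_preconnected_of_eventuallyEq (𝕜 := ℝ)
        (fun y hy => (hr p hp y (hsub' hy)).1.2.1) (fun y hy => (hr p' hp' y (hsub hy)).1.2.1)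
        hc hpp e2 hx
  have compat : ∀ p ∈ Γ, ∀ p' ∈ Γ, ∀ x ∈ Metric.ball p (r p / 4),
      x ∈ Metric.ball p' (r p' / 4) → ρ p x = ρ p' x ∧ w p x = w p' x := by
    intro p hp p' hp' x hx hx'
    rcases le_total (r p) (r p') with hle | hle
    · exact aux p hp p' hp' hle x hx hx'
    · have := aux p' hp' p hp hle x hx' hx
      exact ⟨this.1.symm, this.2.symm⟩
  have hcen : ∀ x, ∃ p, (∃ p ∈ Γ, x ∈ Metric.ball p (r p / 4)) →
      p ∈ Γ ∧ x ∈ Metric.ball p (r p / 4) := by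
    intro x
    by_cases hx : ∃ p ∈ Γ, x ∈ Metric.ball p (r p / 4)
    · obtain ⟨p, hp⟩ := hx
      exact ⟨p, fun _ => hp⟩
    · exact ⟨x, fun h => absurd h hx⟩
  choose c hc using hcen
  have heq : ∀ p ∈ Γ, ∀ x ∈ Metric.ball p (r p / 4),
      (ρ p =ᶠ[𝓝 x] fun x => ρ (c x) x) ∧ w p =ᶠ[𝓝 x] fun x => w (c x) x := by
    intro p hp x hx
    have key : ∀ᶠ y in 𝓝 x, ρ p y = ρ (c y) y ∧ w p y = w (c y) y := by
      filter_upwards [Metric.isOpen_ball.mem_nhds hx] with y hy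
      obtain ⟨h1, h2⟩ := hc y ⟨p, hp, hy⟩
      exact compat p hp (c y) h1 y hy h2
    exact ⟨key.mono fun _ hy => hy.1, key.mono fun _ hy => hy.2⟩
  have hin : ∀ p ∈ Γ, p ∈ Metric.ball p (r p / 4) := fun p hp =>
    Metric.mem_ball_self (by linarith [hr0 p hp])
  refine ⟨⋃ p ∈ Γ, Metric.ball p (r p / 4), fun x => ρ (c x) x, fun x => w (c x) x,
    isOpen_biUnion fun _ _ => Metric.isOpen_ball, fun p hp => mem_biUnion hp (hin p hp), ?_, ?_⟩
  · intro p hp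
    obtain ⟨e1, e2⟩ := heq p hp p (hin p hp)
    exact (h p hp).congr e1 e2
  · intro x hx
    obtain ⟨p, hp, hxp⟩ := mem_iUnion₂.1 hx
    obtain ⟨e1, e2⟩ := heq p hp x hxp
    obtain ⟨h1, h2, h3, h4⟩ :=
      (hr p hp x (Metric.ball_subset_ball (by linarith [hr0 p hp]) hxp)).1
    have h1' := h1.congr e1
    have h2' := h2.congr e2
    refine ⟨h1', h2', ?_, fun b => ?_⟩
    · have h5 : w p x = w (c x) x := e2.eq_of_nhds
      rwa [h5] at h3
    · have g1 : germ (ρ p) h1 = germ _ h1' := germ_eq_iff.2 e1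
      have g2 : ∀ b, germ (fun x => w p x b) (analyticAt_euclidean_apply h2 b)
          = germ (fun x => w (c x) x b) (analyticAt_euclidean_apply h2' b) := fun b =>
        germ_eq_iff.2 (e2.mono fun x hx => by beta_reduce; rw [hx])
      have g3 := polarOp_germ (EuclideanSpace.basisFun (Fin n) ℝ) κ h1
        (fun b => analyticAt_euclidean_apply h2 b) b
      simp only [g1, g2] at g3
      rw [polarOp_germ (EuclideanSpace.basisFun (Fin n) ℝ) κ h1'
        (fun b => analyticAt_euclidean_apply h2' b) b, germ_eq_iff] at g3
      have g4 := g3.eq_of_nhds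
      have g5 := h4 b
      rw [← g4] at g5
      have g6 : w p x b = w (c x) x b := by rw [e2.eq_of_nhds]
      rw [← g6]
      exact g5

theorem exists_isLocalSolution (hq0 : 0 ≤ q) (hq : q < 1)
    (hΓ : IsOrientedAnalyticHypersurface Γ ν) (hV : IsAnalyticSphereMap Γ V) :
    ∃ (Ω : Set (EuclideanSpace ℝ (Fin n)))
      (u : EuclideanSpace ℝ (Fin n) → EuclideanSpace ℝ (Fin m)),
    IsLocalSolution q Γ ν V Ω u := by
  have hκ : 1 < 2 / (1 - q) := by
    rw [lt_div_iff₀ (by linarith)]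
    linarith
  obtain ⟨N, ρ, w, hN, hΓN, hs, h⟩ := exists_global_polar_solution (κ := 2 / (1 - q)) hΓ hV hκ
  set κ := 2 / (1 - q) with hκ_def
  have hκ0 : 0 < κ := by linarith
  have hΩ : IsOpen (N ∩ {x | 0 < ρ x}) := by
    rw [isOpen_iff_mem_nhds]
    intro x hx
    filter_upwards [hN.mem_nhds hx.1, (h x hx.1).1.continuousAt.eventually (lt_mem_nhds hx.2)]
      with y h1 h2
    exact ⟨h1, h2⟩
  have hmem : ∀ x ∈ N ∩ {x | 0 < ρ x} ∪ Γ, x ∈ N := by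
    rintro x (hx | hx)
    · exact hx.1
    · exact hΓN hx
  have hnorm : ∀ x ∈ N ∩ {x | 0 < ρ x}, ‖ρ x ^ κ • w x‖ = ρ x ^ κ := by
    intro x hx
    rw [norm_smul, (h x hx.1).2.2.1, mul_one,
      Real.norm_of_nonneg (Real.rpow_nonneg (le_of_lt hx.2) _)]
  have hmod : ∀ x ∈ N ∩ {x | 0 < ρ x}, ‖ρ x ^ κ • w x‖ ^ (1 / κ) = ρ x := by
    intro x hx
    rw [hnorm x hx, ← Real.rpow_mul (le_of_lt hx.2), mul_one_div_cancel hκ0.ne', Real.rpow_one]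
  have hdir : ∀ x ∈ N ∩ {x | 0 < ρ x}, ‖ρ x ^ κ • w x‖⁻¹ • ρ x ^ κ • w x = w x := by
    intro x hx
    rw [hnorm x hx, smul_smul, inv_mul_cancel₀ (Real.rpow_pos_of_pos hx.2 _).ne', one_smul]
  have hne : ∀ x ∈ N ∩ {x | 0 < ρ x}, ρ x ^ κ • w x ≠ 0 := by
    intro x hx
    rw [← norm_pos_iff, hnorm x hx]
    exact Real.rpow_pos_of_pos hx.2 _
  have hval : ∀ p ∈ Γ, ρ p = 0 ∧ w p = V p := fun p hp =>
    ⟨(hs p hp).modulus_eq_zero.self_of_nhdsWithin hp,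
      (hs p hp).direction_eq.self_of_nhdsWithin hp⟩
  refine ⟨N ∩ {x | 0 < ρ x}, fun x => ρ x ^ κ • w x, ⟨hΩ, ?_⟩, ⟨?_, ?_⟩, hne, ?_, ?_, ?_, ?_⟩
  · intro p hp
    refine ⟨ρ, (hs p hp).isDefiningFunctionAt hΓ hp hκ, ?_⟩
    filter_upwards [hN.mem_nhds (hΓN hp)] with x hx
    exact ⟨fun h => h.2, fun h => ⟨hx, h⟩⟩
  · intro x hx
    exact ((analyticAt_rpow (h x hx.1).1 hx.2 κ).smul
      (h x hx.1).2.1).contDiffAt.contDiffWithinAt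
  · intro x hx
    rw [indicator_of_mem (show x ∈ {y | 0 < ‖ρ y ^ κ • w y‖} from norm_pos_iff.2 (hne x hx))]
    exact (laplacian_rpow_smul_eq_iff (EuclideanSpace.basisFun (Fin n) ℝ) hq (h x hx.1).1
      (h x hx.1).2.1 hx.2 (h x hx.1).2.2.1 EventuallyEq.rfl).2 (h x hx.1).2.2.2
  · intro p hp
    have h1 : ContinuousAt (fun x => ρ x ^ κ • w x) p :=
      ((h p (hΓN hp)).1.continuousAt.rpow_const (Or.inr hκ0.le)).smul
        (h p (hΓN hp)).2.1.continuousAt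
    have h2 := h1.tendsto
    rw [(hval p hp).1, Real.zero_rpow hκ0.ne', zero_smul] at h2
    exact h2.mono_left nhdsWithin_le_nhds
  · intro p hp
    refine ⟨ρ, (h p (hmem p hp)).1, ?_⟩
    filter_upwards [self_mem_nhdsWithin] with x hx
    exact hmod x hx
  · intro p hp
    refine ⟨w, (h p (hmem p hp)).2.1, ?_⟩
    filter_upwards [self_mem_nhdsWithin] with x hx
    exact hdir x hx
  · intro p hp
    have h1 := (h p (hΓN hp)).2.1.continuousAt.tendsto
    rw [(hval p hp).2] at h1
    refine (h1.mono_left nhdsWithin_le_nhds).congr' ?_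
    filter_upwards [self_mem_nhdsWithin] with x hx
    exact (hdir x hx).symm

theorem existsUniqueLocalSolution (hq0 : 0 ≤ q) (hq : q < 1)
    (hΓ : IsOrientedAnalyticHypersurface Γ ν) (hV : IsAnalyticSphereMap Γ V) :
    ExistsUniqueLocalSolution q Γ ν V :=
  ⟨exists_isLocalSolution hq0 hq hΓ hV, fun _ _ _ _ h₁ h₂ => h₁.unique hq0 hq hΓ h₂⟩

/-- Reversing the orientation of a hypersurface. -/
theorem IsOrientedAnalyticHypersurface.neg (hΓ : IsOrientedAnalyticHypersurface Γ ν) :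
    IsOrientedAnalyticHypersurface Γ (-ν) where
  norm_eq_one p hp := by rw [Pi.neg_apply, norm_neg, hΓ.norm_eq_one p hp]
  exists_definingFunction p hp := by
    obtain ⟨φ, hφ⟩ := hΓ.exists_definingFunction p hp
    refine ⟨-φ, hφ.analyticAt.neg, ?_, ?_⟩
    · filter_upwards [hφ.zero_iff] with x hx
      rw [hx, Pi.neg_apply, neg_eq_zero]
    · filter_upwards [hφ.gradient_eq] with x ⟨c, hc, h⟩
      refine ⟨c, hc, ?_⟩
      rw [Pi.neg_apply, smul_neg, ← h, gradient, gradient, fderiv_neg, map_neg]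

end Existence

theorem theorem2 (n m : ℕ) (hn : 2 ≤ n) (hm : 1 ≤ m) (q : ℝ) (hq0 : 0 ≤ q) (hq1 : q < 1)
    (Γ : Set (EuclideanSpace ℝ (Fin n)))
    (ν : EuclideanSpace ℝ (Fin n) → EuclideanSpace ℝ (Fin n))
    (hΓ : IsOrientedAnalyticHypersurface Γ ν)
    (Vp Vm : EuclideanSpace ℝ (Fin n) → EuclideanSpace ℝ (Fin m))
    (hVp : IsAnalyticSphereMap Γ Vp) (hVm : IsAnalyticSphereMap Γ Vm) :
    ExistsUniqueLocalSolution q Γ ν Vp ∧ ExistsUniqueLocalSolution q Γ (-ν) Vm :=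
  ⟨existsUniqueLocalSolution hq0 hq1 hΓ hVp, existsUniqueLocalSolution hq0 hq1 hΓ.neg hVm⟩
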